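/- Let $A$ be an Artinian local ring and let $B=\bigoplus_{\nu\in\mathbb N^r}[B]_\nu$ be a standard $\mathbb N^r$-graded $A$-algebra, that is, $[B]_{\mathbf 0}=A$ and $B$ is generated over $A$ by finitely many elements, each of degree $\mathbf e_i$ for some $1\le i\le r$, where $\mathbf e_i$ is the $i$-th unit vector. Let $M=\bigoplus_{\nu\in\mathbb Z^r}[M]_\nu$ be a finitely generated $\mathbb Z^r$-graded $B$-module. For $n\in\mathbb Z^r$ write $|n|=n_1+\cdots+n_r$, $\mathbf 1=(1,\dots,1)$ and $(1-t)^n=(1-t_1)^{n_1}\cdots(1-t_r)^{n_r}$; inequalities in $\mathbb Z^r$ are componentwise. Let $d=\dim(M)$, let $\mathfrak N=\bigoplus_{\nu_1>0,\dots,\nu_r>0}[B]_\nu$ be the irrelevant ideal, let $H^0_{\mathfrak N}(M)$ be the submodule of the elements of $M$ killed by a power of $\mathfrak N$, let $\mathrm{Supp}_{++}(M)$ be the space of the graded primes in $\mathrm{Supp}(M)$ that do not contain $\mathfrak N$, with the Zariski topology, and let $d_{++}=\dim \mathrm{Supp}_{++}(M)$. The dimension of the zero module and of the empty space, and the degree of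 the zero polynomial, are $-\infty$. (I) All $[M]_\nu$ have finite length over $A$, and for every $n\in\mathbb N^r$ with $|n|=d$ there is a Laurent polynomial $Q_n\in\mathbb Z[t_1^{\pm1},\dots,t_r^{\pm1}]$ with $Q_n(\mathbf 1)\ge 0$ such that, expanding each $1/(1-t_i)$ as a geometric series, $$\sum_{\nu\in\mathbb Z^r}\mathrm{length}_A([M]_\nu)\,t^\nu=\sum_{n\in\mathbb N^r,\ |n|=d}\frac{Q_n(t)}{(1-t)^n},$$ and such that: (a) if $M\neq 0$, then $Q_n(\mathbf 1)>0$ for some $n$ with $|n|=d$; (b) if $Q_n\ne 0$ and $Q_n(\mathbf 1)=0$, then $Q_n$ is divisible by $1-t_i$ for some $i$ with $n_i\neq 0$. Moreover, for every $\delta\in\mathbb N$, if two families of Laurent polynomials in $\mathbb Z[t_1^{\pm1},\dots,t_r^{\pm1}]$ satisfy $\sum_{|n|=\delta}Q_n(t)/(1-t)^n=\sum_{|n|=\delta}Q'_n(t)/(1-t)^n$, then $Q_n(\mathbf 1)=Q'_n(\mathbf 1)$ for all $n\in\mathbb N^r$ with $|n|=\delta$. Hence, for $n\in\mathbb Z^r$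 with $n\ge-\mathbf 1$ and $|n+\mathbf 1|\ge d$, the number $e_n(M)$, equal to $Q_{n+\mathbf 1}(\mathbf 1)$ for any decomposition of the Hilbert series as above if $|n+\mathbf 1|=d$ and to $0$ if $|n+\mathbf 1|>d$, is well defined. (II) $\dim\big(M/H^0_{\mathfrak N}(M)\big)=r+d_{++}$. There is a unique finitely supported family of integers $e(n)$, $n\in\mathbb N^r$, such that the polynomial $$P_M(X_1,\dots,X_r)=\sum_{n\in\mathbb N^r}e(n)\binom{X_1+n_1}{n_1}\cdots\binom{X_r+n_r}{n_r}\in\mathbb Q[X_1,\dots,X_r]$$ satisfies $P_M(\nu)=\mathrm{length}_A([M]_\nu)$ for all $\nu\in\mathbb Z^r$ with all $\nu_i$ sufficiently large. The total degree of $P_M$ is $d_{++}$, one has $e(n)\ge0$ for all $n$ with $|n|=d_{++}$, and $$P_M=\sum_{n\in\mathbb N^r,\ |n|=d_{++}}\frac{e_n\big(M/H^0_{\mathfrak N}(M)\big)}{n_1!\cdots n_r!}X_1^{n_1}\cdots X_r^{n_r}+(\text{terms of total degree}<d_{++}).$$ (III) For $n\in\mathbb N^r$ with $|n|\ge d_{++}$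 let $e(n;M)=e(n)$ if $|n|=d_{++}$ and $e(n;M)=0$ if $|n|>d_{++}$. Then for all $n\in\mathbb N^r$ with $|n|\ge d_{++}$, $$e(n;M)=e_n\big(M/H^0_{\mathfrak N}(M)\big).$$ -/

import Mathlib

open scoped BigOperators

noncomputable section

namespace MultiMixed

/-! ### Multigraded algebras and modules -/

section Graded

variable {r : ℕ} {A B M : Type*} [CommRing A] [CommRing B] [Algebra A B]
  [AddCommGroup M] [Module A M] [Module B M] [IsScalarTower A B M]

/-- An `ℕ^r`-graded `A`-algebra `B` is standard if `[B]_0 = A` and `B` is generated over `A` by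
finitely many elements, each of them homogeneous of degree `e_i` for some `i`. -/
structure IsStandard (𝓑 : (Fin r → ℕ) → Submodule A B) : Prop where
  injective : Function.Injective (algebraMap A B)
  zero_part : ∀ b ∈ 𝓑 0, ∃ a : A, algebraMap A B a = b
  generated : ∃ s : Finset B, (∀ x ∈ s, ∃ i : Fin r, x ∈ 𝓑 (Pi.single i 1)) ∧
    Algebra.adjoin A (s : Set B) = ⊤

/-- `𝓜` is a `ℤ^r`-grading of the `B`-module `M`, compatible with the `ℕ^r`-grading `𝓑` of `B`:
`M` is the internal direct sum of the `𝓜 ν`, and `[B]_μ [M]_ν ⊆ [M]_{μ + ν}`. -/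
structure IsGradedModule (𝓑 : (Fin r → ℕ) → Submodule A B)
    (𝓜 : (Fin r → ℤ) → Submodule A M) : Prop where
  isInternal : DirectSum.IsInternal 𝓜
  smul_mem : ∀ (μ : Fin r → ℕ) (ν : Fin r → ℤ) (b : B) (x : M), b ∈ 𝓑 μ → x ∈ 𝓜 ν →
    b • x ∈ 𝓜 ((fun i => (μ i : ℤ)) + ν)

/-- The irrelevant ideal `𝔑 = ⨁_{ν > 0} [B]_ν`, where `ν > 0` means that every `ν_i` is
positive. -/
def irrelevantIdeal (𝓑 : (Fin r → ℕ) → Submodule A B) : Ideal B :=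
  Ideal.span {b | ∃ ν : Fin r → ℕ, (∀ i, 0 < ν i) ∧ b ∈ 𝓑 ν}

/-- The relevant support `Supp_{++}(M)`: the graded primes in the support of `M` that do not
contain the irrelevant ideal.

It carries the subspace topology from `Spec B`.  For `J` any ideal, a graded prime contains `J` if
and only if it contains the graded ideal generated by the homogeneous components of the elements
of `J`, so this is the topology whose closed sets are the
`V_{++}(J)` with `J` graded, i.e. the one induced from the multiprojective scheme of `B`. -/
def relevantSupport (𝓑 : (Fin r → ℕ) → Submodule A B) [GradedAlgebra 𝓑]
    (M : Type*) [AddCommGroup M] [Module B M] : Set (PrimeSpectrum B) :=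
  {p | p.asIdeal.IsHomogeneous 𝓑 ∧ ¬ irrelevantIdeal 𝓑 ≤ p.asIdeal ∧ p ∈ Module.support B M}

/-- `d_{++} = dim Supp_{++}(M)`, equal to `⊥` (that is, `-∞`) if `Supp_{++}(M)` is empty. -/
def relevantDim (𝓑 : (Fin r → ℕ) → Submodule A B) [GradedAlgebra 𝓑]
    (M : Type*) [AddCommGroup M] [Module B M] : WithBot ℕ∞ :=
  topologicalKrullDim (relevantSupport 𝓑 M)

/-- `H^0_I(M)`: the submodule of the elements of `M` killed by some power of the ideal `I`. -/
def torsionSubmodule (I : Ideal B) (M : Type*) [AddCommGroup M] [Module B M] :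
    Submodule B M where
  carrier := {x | ∃ k : ℕ, ∀ b ∈ I ^ k, b • x = 0}
  zero_mem' := ⟨0, fun b _ => smul_zero b⟩
  add_mem' := by
    rintro x y ⟨k, hk⟩ ⟨l, hl⟩
    refine ⟨k + l, fun b hb => ?_⟩
    rw [smul_add, hk b (Ideal.pow_le_pow_right (Nat.le_add_right k l) hb),
      hl b (Ideal.pow_le_pow_right (Nat.le_add_left l k) hb), add_zero]
  smul_mem' := by
    rintro c x ⟨k, hk⟩
    refine ⟨k, fun b hb => ?_⟩
    rw [smul_comm, hk b hb, smul_zero]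

/-- The grading induced on a quotient `M / N`: the part of degree `ν` is the image of `[M]_ν`. -/
def quotientGrading (N : Submodule B M) (𝓜 : (Fin r → ℤ) → Submodule A M) :
    (Fin r → ℤ) → Submodule A (M ⧸ N) :=
  fun ν => (𝓜 ν).map (N.mkQ.restrictScalars A)

/-- The Hilbert function `ν ↦ length_A [M]_ν`, which is also the family of coefficients of the
Hilbert series `∑_ν length_A [M]_ν t^ν`. -/
def hilbertFunction (𝓜 : (Fin r → ℤ) → Submodule A M) (ν : Fin r → ℤ) : ℤ :=
  ((Module.length A (𝓜 ν)).toNat : ℤ)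

end Graded

/-! ### Laurent polynomials, formal series and the fractions `Q(t) / (1 - t)^n` -/

section Series

/-- The ring `ℤ[t_1, …, t_r, t_1⁻¹, …, t_r⁻¹]` of Laurent polynomials. -/
abbrev LaurentPoly (r : ℕ) : Type := AddMonoidAlgebra ℤ (Fin r → ℤ)

/-- The value `Q(1, …, 1)`, that is, the sum of the coefficients of `Q`. -/
def LaurentPoly.evalOne {r : ℕ} (Q : LaurentPoly r) : ℤ := Q.coeff.sum fun _ c => c

/-- The formal series `∑_ν c_ν t^ν` with `ν ∈ ℤ^r`, integral coefficients and partially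
well-ordered support for the componentwise order of `ℤ^r`.  They form a commutative ring, which
contains all series supported on a translate of `ℕ^r`. -/
abbrev FormalSeries (r : ℕ) : Type := HahnSeries (Fin r → ℤ) ℤ

/-- A Laurent polynomial as a formal series. -/
def LaurentPoly.toSeries {r : ℕ} (Q : LaurentPoly r) : FormalSeries r :=
  HahnSeries.ofFinsupp Q.coeff

/-- The geometric series `∑_{k ≥ 0} t_i^k`. -/
def geomSeries {r : ℕ} (i : Fin r) : FormalSeries r where
  coeff ν := by
    classical
    exact if ν ∈ Set.range (fun k : ℕ => (Pi.single i (k : ℤ) : Fin r → ℤ)) then 1 else 0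
  isPWO_support' := by
    classical
    have hmono : Monotone (fun k : ℕ => (Pi.single i (k : ℤ) : Fin r → ℤ)) := by
      intro a b hab
      exact Pi.single_mono i (by exact_mod_cast hab)
    refine Set.IsPWO.mono (t := (fun k : ℕ => (Pi.single i (k : ℤ) : Fin r → ℤ)) '' Set.univ)
      ?_ ?_
    · exact (Set.IsPWO.of_linearOrder Set.univ).image_of_monotone hmono
    · intro ν hν
      by_contra h
      refine hν ?_
      exact if_neg (by simpa using h)

theorem geomSeries_coeff_eq_one {r : ℕ} (i : Fin r) {ν : Fin r → ℤ}
    (h : ∃ k : ℕ, Pi.single i (k : ℤ) = ν) : (geomSeries i).coeff ν = 1 := if_pos h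

theorem geomSeries_coeff_eq_zero {r : ℕ} (i : Fin r) {ν : Fin r → ℤ}
    (h : ¬ ∃ k : ℕ, Pi.single i (k : ℤ) = ν) : (geomSeries i).coeff ν = 0 := if_neg h

theorem one_sub_mul_geomSeries {r : ℕ} (i : Fin r) :
    (1 - HahnSeries.single (Pi.single i 1) 1) * geomSeries i = 1 := by
  ext ν
  rw [sub_mul, one_mul, HahnSeries.coeff_sub, HahnSeries.coeff_single_mul, one_mul,
    HahnSeries.coeff_one]
  by_cases h : ∃ k : ℕ, Pi.single i (k : ℤ) = ν
  · rw [geomSeries_coeff_eq_one i h]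
    obtain ⟨k, rfl⟩ := h
    cases k with
    | zero =>
      rw [geomSeries_coeff_eq_zero, if_pos] <;> simp
      intro l hl
      have := congrFun hl i
      simp at this
    | succ k =>
      rw [geomSeries_coeff_eq_one, if_neg]
      · simp
      · intro h0
        have := congrFun h0 i
        simp at this
        omega
      · refine ⟨k, ?_⟩
        rw [← Pi.single_sub]
        simp
  · rw [geomSeries_coeff_eq_zero i h, geomSeries_coeff_eq_zero, if_neg]
    · simp
    · rintro rfl
      exact h ⟨0, by simp⟩
    · rintro ⟨k, hk⟩
      refine h ⟨k + 1, ?_⟩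
      rw [eq_sub_iff_add_eq] at hk
      rw [← hk, ← Pi.single_add]
      simp

/-- `1 - t_i` as a unit of the ring of formal series; its inverse is `∑_{k ≥ 0} t_i^k`. -/
def oneSubT {r : ℕ} (i : Fin r) : (FormalSeries r)ˣ where
  val := 1 - HahnSeries.single (Pi.single i 1) 1
  inv := geomSeries i
  val_inv := one_sub_mul_geomSeries i
  inv_val := by rw [mul_comm, one_sub_mul_geomSeries]

/-- The expansion of `1 / ((1 - t_1)^{n_1} ⋯ (1 - t_r)^{n_r})` as a formal series. -/
def invOneSubT {r : ℕ} (n : Fin r → ℕ) : FormalSeries r :=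
  ((∏ i, oneSubT i ^ n i)⁻¹ : (FormalSeries r)ˣ)

/-- The multi-indices `n ∈ ℕ^r` of weight `|n| = n_1 + ⋯ + n_r = d`; there are none if `d` is not
a natural number. -/
def weightIndices (r : ℕ) (d : WithBot ℕ∞) : Finset (Fin r → ℕ) :=
  (Finset.piAntidiag Finset.univ (d.unbotD 0).toNat).filter
    fun n => ((∑ i, n i : ℕ) : WithBot ℕ∞) = d

theorem mem_weightIndices {r : ℕ} {d : WithBot ℕ∞} {n : Fin r → ℕ} :
    n ∈ weightIndices r d ↔ ((∑ i, n i : ℕ) : WithBot ℕ∞) = d := by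
  rw [weightIndices, Finset.mem_filter, and_iff_right_iff_imp]
  rintro rfl
  rw [Finset.mem_piAntidiag]
  refine ⟨?_, by simp⟩
  generalize ∑ i, n i = m
  rfl

/-- The formal series `∑_{|n| = d} Q_n(t) / (1 - t)^n`. -/
def fractionSum {r : ℕ} (d : WithBot ℕ∞) (Q : (Fin r → ℕ) → LaurentPoly r) : FormalSeries r :=
  ∑ n ∈ weightIndices r d, (Q n).toSeries * invOneSubT n

end Series

/-! ### Mixed multiplicities in terms of Hilbert series -/

section SeriesMultiplicities

variable {r : ℕ} {A : Type*} (B : Type*) {M : Type*} [CommRing A] [CommRing B]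
  [AddCommGroup M] [Module A M] [Module B M]

/-- The family `Q` gives a decomposition `Hilb_M(t) = ∑_{|n| = d} Q_n(t) / (1 - t)^n` of the
Hilbert series, where `d = dim(M)` is the dimension of the support of the `B`-module `M`
(with `dim(0) = -∞`). -/
def IsHilbertDecomposition (𝓜 : (Fin r → ℤ) → Submodule A M)
    (Q : (Fin r → ℕ) → LaurentPoly r) : Prop :=
  ∀ ν, (fractionSum (Module.supportDim B M) Q).coeff ν = hilbertFunction 𝓜 ν

open Classical in
/-- The mixed multiplicity `e_n(M)` in terms of Hilbert series, for `n ∈ ℤ^r` with `n ≥ -1` and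
`|n + 1| ≥ d = dim(M)`: it is `Q_{n+1}(1)` for any decomposition of the Hilbert series if
`|n + 1| = d`, and it is `0` if `|n + 1| > d`. -/
def seriesMultiplicity (𝓜 : (Fin r → ℤ) → Submodule A M) (n : Fin r → ℤ) : ℤ :=
  if h : (∃ Q, IsHilbertDecomposition B 𝓜 Q) ∧ (∀ i, -1 ≤ n i) ∧
      ((∑ i, (n i + 1).toNat : ℕ) : WithBot ℕ∞) = Module.supportDim B M then
    (h.1.choose fun i => (n i + 1).toNat).evalOne
  else 0

end SeriesMultiplicities

/-! ### Mixed multiplicities in terms of Hilbert polynomials -/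

section PolynomialMultiplicities

variable {r : ℕ} {A B M : Type*} [CommRing A] [CommRing B] [Algebra A B]
  [AddCommGroup M] [Module A M] [Module B M]

/-- `P(ν) = length_A [M]_ν` for all `ν ≫ 0`. -/
def IsHilbertPolynomial (𝓜 : (Fin r → ℤ) → Submodule A M) (P : MvPolynomial (Fin r) ℚ) : Prop :=
  ∃ c : Fin r → ℤ, ∀ ν, c ≤ ν → MvPolynomial.eval (fun i => (ν i : ℚ)) P = hilbertFunction 𝓜 ν

/-- The polynomial `binom(X_1 + n_1, n_1) ⋯ binom(X_r + n_r, n_r)`, where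
`binom(X + n, n) = (X + 1) ⋯ (X + n) / n!`. -/
def binomialPoly (n : Fin r → ℕ) : MvPolynomial (Fin r) ℚ :=
  ∏ i, (MvPolynomial.C (((n i).factorial : ℚ)⁻¹) *
    ∏ j ∈ Finset.range (n i), (MvPolynomial.X i + MvPolynomial.C ((j : ℚ) + 1)))

/-- The polynomial `∑_n e(n) binom(X_1 + n_1, n_1) ⋯ binom(X_r + n_r, n_r)`. -/
def binomialSum (e : (Fin r → ℕ) →₀ ℤ) : MvPolynomial (Fin r) ℚ :=
  e.sum fun n c => MvPolynomial.C (c : ℚ) * binomialPoly n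

/-- The total degree of a polynomial, with value `⊥` (that is, `-∞`) at `0`. -/
def totalDeg (P : MvPolynomial (Fin r) ℚ) : WithBot ℕ∞ :=
  P.support.sup fun m => ((∑ i, m i : ℕ) : WithBot ℕ∞)

open Classical in
/-- The mixed multiplicity `e(n; M)` in terms of Hilbert polynomials, for `n ∈ ℕ^r` with
`|n| ≥ d_{++} = dim Supp_{++}(M)`: it is the coefficient `e(n)` in the expression
`P_M = ∑_n e(n) binom(X_1 + n_1, n_1) ⋯ binom(X_r + n_r, n_r)` of the Hilbert polynomial of `M` if
`|n| = d_{++}`, and it is `0` if `|n| > d_{++}`. -/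
def polyMultiplicity (𝓑 : (Fin r → ℕ) → Submodule A B) [GradedAlgebra 𝓑]
    (𝓜 : (Fin r → ℤ) → Submodule A M) (n : Fin r → ℕ) : ℤ :=
  if h : (∃ e, IsHilbertPolynomial 𝓜 (binomialSum e)) ∧
      ((∑ i, n i : ℕ) : WithBot ℕ∞) = relevantDim 𝓑 M then
    h.1.choose n
  else 0

end PolynomialMultiplicities

end MultiMixed

end

/-! The proof rests on the fact that the Hilbert series of `M` is a *finite sum* of fractions
`t^c / (1 - t)^n`, all with coefficient `1`. Such a sum is recorded by the multiset `L` of the pairs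
`(c, n)`, its coefficients are `sumCoeff L ν`, and the theorem reduces to comparing the exponents
`n` that occur in `L` with chains of primes.

*Existence of `L`* (`IsGradedModule.hasFractionSum`). For a set `S` of homogeneous elements of `B`,
every finitely generated graded module is obtained from modules killed by `S` by extensions and by
passing from `M / yM` to `M` for `y ∈ S` a nonzerodivisor on `M` (`devissage`). If `S` consists of
generators of `B` of degrees `e_i`, a module killed by `S` has finite length, extensions add the
multisets, and a nonzerodivisor of degree `e_i` increases `n_i` by one in each pair. As the
dimension of the support drops by one modulo a nonzerodivisor, `|n| ≤ dim M` for all pairs in `L`.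

*Series and polynomials.* Since no cancellation can occur in `L`, everything can be read off from
the numbers `a(n)` of pairs with second component `n`. Terms with `|n| < d` are rewritten with
denominators of weight `d` by multiplying numerator and denominator by powers of a fixed `1 - t_i`,
which preserves the values at `1` of the numerators with `|n| = d` and gives the divisibility
statement (`exists_numerators`). The values at `1` are determined by the series: after
multiplication by `(1 - t)^{(d, …, d)}` and the substitution `t_i = 1 - s_i` of power series,
`Q_n(1)` becomes the coefficient of `s^{(d, …, d) - n}` (`evalOne_eq_of_fractionSum_eq`). In large
degrees only the *full* pairs, those with all `n_i > 0`, contribute, each of them a translate of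
`binom(X + n - 1, n - 1)`; hence the Hilbert polynomial exists and its coefficients of highest
weight are the numbers `a(n + 1)` (`exists_binomialSum_eq_sumCoeff`).

*Lower bounds for pole orders.* For a chain `p_0 ⊂ ⋯ ⊂ p_k` in the support of `M`, multiplication
by an element of `p_1` outside `p_0` shows inductively that the lengths of the parts of `B / p_0`
grow at least like `n^k`, and they are bounded by the lengths of the parts of `M`, as `p_0`
contains the annihilator of `M` (`exists_pow_le_mul_length`). Summing over boxes this gives a pair
in `L` with `|n| ≥ k` (`IsGradedModule.exists_length_le`); along the diagonal `(n, …, n)`, for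
graded primes not containing the irrelevant ideal `𝔑`, it gives a full pair with `|n| ≥ k + r`
(`IsGradedModule.exists_length_add_le`). So `dim M` is the maximum of `|n|` over `L`.

*Upper bound for full pairs.* The ideal `𝔑` is generated by elements of degree `(1, …, 1)`. The
dévissage with respect to these shows that the length of `[M]_{(n, …, n)}` is bounded by a
polynomial in `n` of degree `d_{++}`: a module killed by `𝔑` vanishes in large degrees, and for `y`
a nonzerodivisor on `M` every chain in the relevant support of `M / yM` is prolonged in that of `M`
by the homogeneous core of a minimal prime of `M` (`IsGradedModule.hasDiagonalBound`). So `r +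
d_{++}` is the maximum of `|n|` over the full pairs (`IsGradedModule.relevantDim_eq`).

*Torsion.* The module `M' = M / H^0_𝔑(M)` has the Hilbert function of `M` in large degrees and the
same relevant support. As it has no `𝔑`-torsion, `[M']_ν` embeds into a power of `[M']_{ν + 1}`,
and this forces some full pair to have the maximal value of `|n|` (`exists_full_of_le_mul`). Hence
`dim M' = r + d_{++}`, and both kinds of mixed multiplicities are the numbers `a(n + 1)` of the
multiset of `M'`. -/

noncomputable section

namespace MultiMixed

/-! ### Coefficients of the fractions `t^c / (1 - t)^n` -/

section Coefficients

variable {r : ℕ}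

/-- The coefficient of `t^s` in the expansion of `1 / (1 - t)^m`; it vanishes for `s < 0`. -/
def poleCoeff (m : ℕ) (s : ℤ) : ℕ := if 0 ≤ s then Nat.multichoose m s.toNat else 0

/-- The coefficient of `t^ν` in the expansion of `t^c / (1 - t)^n`, for `p = (c, n)`. -/
def fracCoeff (p : (Fin r → ℤ) × (Fin r → ℕ)) (ν : Fin r → ℤ) : ℕ :=
  ∏ i, poleCoeff (p.2 i) (ν i - p.1 i)

/-- The coefficient of `t^ν` in `∑_{(c, n) ∈ L} t^c / (1 - t)^n`.  The multiset `L` encodes this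
sum of fractions, all of which enter with coefficient `1`. -/
def sumCoeff (L : Multiset ((Fin r → ℤ) × (Fin r → ℕ))) (ν : Fin r → ℤ) : ℕ :=
  (L.map fun p => fracCoeff p ν).sum

theorem poleCoeff_of_neg {m : ℕ} {s : ℤ} (h : s < 0) : poleCoeff m s = 0 :=
  if_neg (not_le.2 h)

theorem poleCoeff_natCast (m n : ℕ) : poleCoeff m n = Nat.multichoose m n := by
  simp [poleCoeff]

theorem poleCoeff_zero (s : ℤ) : poleCoeff 0 s = if s = 0 then 1 else 0 := by
  rcases lt_or_ge s 0 with h | h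
  · rw [poleCoeff_of_neg h, if_neg h.ne]
  · lift s to ℕ using h
    rw [poleCoeff_natCast]
    cases s with
    | zero => simp
    | succ k => rw [if_neg (by positivity)]; simp

theorem poleCoeff_succ (m : ℕ) (s : ℤ) :
    poleCoeff (m + 1) s = poleCoeff (m + 1) (s - 1) + poleCoeff m s := by
  rcases lt_or_ge s 0 with h | h
  · rw [poleCoeff_of_neg h, poleCoeff_of_neg h, poleCoeff_of_neg (by omega)]
  · lift s to ℕ using h
    cases s with
    | zero =>
      rw [poleCoeff_of_neg (s := ((0 : ℕ) : ℤ) - 1) (by simp), poleCoeff_natCast,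
        poleCoeff_natCast]
      simp
    | succ k =>
      have : ((k + 1 : ℕ) : ℤ) - 1 = (k : ℤ) := by push_cast; ring
      rw [this, poleCoeff_natCast, poleCoeff_natCast, poleCoeff_natCast,
        Nat.multichoose_succ_succ, add_comm]

theorem sum_poleCoeff_le {m b e : ℕ} (h : ∀ s : ℤ, s ≤ b → poleCoeff m s ≤ (b + 1) ^ e)
    (F : Finset ℤ) (hF : ∀ s ∈ F, s ≤ b) : ∑ s ∈ F, poleCoeff m s ≤ (b + 1) ^ (e + 1) := by
  have h1 : ∑ s ∈ F, poleCoeff m s = ∑ s ∈ F.filter (0 ≤ ·), poleCoeff m s := by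
    refine (Finset.sum_filter_of_ne fun s _ hs => ?_).symm
    by_contra h'
    exact hs (poleCoeff_of_neg (not_le.1 h'))
  have h2 : (F.filter (0 ≤ ·)).card ≤ b + 1 := by
    calc _ ≤ (Finset.Icc (0 : ℤ) b).card := Finset.card_le_card fun s hs => by
            rw [Finset.mem_filter] at hs
            exact Finset.mem_Icc.2 ⟨hs.2, hF s hs.1⟩
      _ = b + 1 := by simp
  rw [h1, pow_succ, mul_comm]
  calc _ ≤ (F.filter (0 ≤ ·)).card • (b + 1) ^ e :=
        Finset.sum_le_card_nsmul _ _ _ fun s hs => h s (hF s (Finset.mem_filter.1 hs).1)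
    _ ≤ _ := by rw [smul_eq_mul]; exact Nat.mul_le_mul_right _ h2

theorem poleCoeff_eq_sum (m : ℕ) (s : ℤ) :
    poleCoeff (m + 1) s = ∑ j ∈ Finset.Icc 0 s, poleCoeff m j := by
  rcases lt_or_ge s 0 with h | h
  · rw [poleCoeff_of_neg h, Finset.Icc_eq_empty (not_le.2 h), Finset.sum_empty]
  · induction s, h using Int.leInduction with
    | base => rw [poleCoeff_succ, poleCoeff_of_neg (by norm_num)]; simp
    | succ k hk ih =>
      have : Finset.Icc 0 (k + 1) = insert (k + 1) (Finset.Icc 0 k) := by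
        ext j
        simp only [Finset.mem_Icc, Finset.mem_insert]
        omega
      rw [poleCoeff_succ, show k + 1 - 1 = k by ring, ih, this, Finset.sum_insert (by simp),
        add_comm]

theorem poleCoeff_le (m : ℕ) {b : ℕ} {s : ℤ} (hs : s ≤ b) :
    poleCoeff m s ≤ (b + 1) ^ (m - 1) := by
  induction m generalizing s with
  | zero => rw [poleCoeff_zero]; split_ifs <;> simp
  | succ m ih =>
    cases m with
    | zero =>
      rcases lt_or_ge s 0 with h | h
      · simp [poleCoeff_of_neg h]
      · simp [poleCoeff, h]
    | succ m =>
      rw [poleCoeff_eq_sum]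
      exact sum_poleCoeff_le (e := m) (fun s hs => ih hs) _
        fun j hj => (Finset.mem_Icc.1 hj).2.trans hs

theorem sum_poleCoeff_le_pow (m : ℕ) {b : ℕ} (F : Finset ℤ) (hF : ∀ s ∈ F, s ≤ b) :
    ∑ s ∈ F, poleCoeff m s ≤ (b + 1) ^ m := by
  cases m with
  | zero => simp only [poleCoeff_zero, Finset.sum_ite_eq', pow_zero]; split_ifs <;> simp
  | succ m => exact sum_poleCoeff_le (e := m) (fun s hs => poleCoeff_le (m + 1) hs) F hF

theorem pow_le_factorial_mul_poleCoeff {m n : ℕ} {s : ℤ} (h : n ≤ s) :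
    (n + 1) ^ m ≤ m.factorial * poleCoeff (m + 1) s := by
  lift s to ℕ using (by omega)
  rw [poleCoeff_natCast, Nat.multichoose_eq, show m + 1 + s - 1 = s + m by omega,
    Nat.choose_symm_add, ← Nat.ascFactorial_eq_factorial_mul_choose]
  exact (Nat.pow_le_pow_left (by omega) m).trans (Nat.pow_succ_le_ascFactorial _ _)

theorem fracCoeff_add_single (c : Fin r → ℤ) (n : Fin r → ℕ) (i : Fin r) (ν : Fin r → ℤ) :
    fracCoeff (c, n + Pi.single i 1) ν =
      fracCoeff (c, n + Pi.single i 1) (ν - Pi.single i 1) + fracCoeff (c, n) ν := by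
  refine (Finset.prod_add_prod_eq (Finset.mem_univ i) ?_ (fun j _ hj => ?_)
    fun j _ hj => ?_).symm
  · simp only [Pi.add_apply, Pi.single_eq_same, Pi.sub_apply]
    rw [poleCoeff_succ _ (ν i - c i), sub_right_comm]
  · simp [Pi.single_eq_of_ne hj]
  · simp [Pi.single_eq_of_ne hj]

theorem fracCoeff_eq_zero_of_lt {p : (Fin r → ℤ) × (Fin r → ℕ)} {ν : Fin r → ℤ} {i : Fin r}
    (h : ν i < p.1 i) : fracCoeff p ν = 0 :=
  Finset.prod_eq_zero (Finset.mem_univ i) (poleCoeff_of_neg (by omega))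

theorem fracCoeff_zero (c ν : Fin r → ℤ) : fracCoeff (c, 0) ν = if ν = c then 1 else 0 := by
  simp only [fracCoeff, Pi.zero_apply, poleCoeff_zero, sub_eq_zero, Finset.prod_ite_zero,
    Finset.mem_univ, true_imp_iff, Finset.prod_const_one, funext_iff]

@[simp]
theorem sumCoeff_zero (ν : Fin r → ℤ) : sumCoeff 0 ν = 0 := rfl

@[simp]
theorem sumCoeff_cons (p : (Fin r → ℤ) × (Fin r → ℕ)) (L) (ν : Fin r → ℤ) :
    sumCoeff (p ::ₘ L) ν = fracCoeff p ν + sumCoeff L ν := by simp [sumCoeff]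

theorem sumCoeff_add (L L' : Multiset ((Fin r → ℤ) × (Fin r → ℕ))) (ν : Fin r → ℤ) :
    sumCoeff (L + L') ν = sumCoeff L ν + sumCoeff L' ν := by simp [sumCoeff]

theorem fracCoeff_le_sumCoeff {L : Multiset ((Fin r → ℤ) × (Fin r → ℕ))} {p} (hp : p ∈ L)
    (ν : Fin r → ℤ) : fracCoeff p ν ≤ sumCoeff L ν :=
  Multiset.le_sum_of_mem (Multiset.mem_map_of_mem (fun p => fracCoeff p ν) hp)

/-- Multiplication by `1 / (1 - t_i)`: the coefficients of the product have those of the original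
sum as differences in the direction `i`. -/
theorem sumCoeff_map_add_single (L : Multiset ((Fin r → ℤ) × (Fin r → ℕ))) (i : Fin r)
    (ν : Fin r → ℤ) :
    sumCoeff (L.map fun p => (p.1, p.2 + Pi.single i 1)) ν =
      sumCoeff (L.map fun p => (p.1, p.2 + Pi.single i 1)) (ν - Pi.single i 1) +
        sumCoeff L ν := by
  induction L using Multiset.induction_on with
  | empty => simp
  | cons p L ih =>
    rw [Multiset.map_cons, sumCoeff_cons, sumCoeff_cons, sumCoeff_cons, ih,
      fracCoeff_add_single]
    ring

theorem exists_sumCoeff_eq_zero (L : Multiset ((Fin r → ℤ) × (Fin r → ℕ))) :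
    ∃ c : ℤ, ∀ (ν : Fin r → ℤ) (i : Fin r), ν i < c → sumCoeff L ν = 0 := by
  induction L using Multiset.induction_on with
  | empty => exact ⟨0, fun _ _ _ => rfl⟩
  | cons p L ih =>
    obtain ⟨c, hc⟩ := ih
    obtain ⟨b, hb⟩ := Set.Finite.bddBelow (Set.finite_range p.1)
    refine ⟨min b c, fun ν i h => ?_⟩
    rw [sumCoeff_cons, hc ν i (h.trans_le (min_le_right _ _)),
      fracCoeff_eq_zero_of_lt (h.trans_le ((min_le_left _ _).trans (hb ⟨i, rfl⟩)))]

/-! ### Growth of the coefficients -/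

theorem le_of_pow_le_mul_pow {a b C n₀ : ℕ}
    (h : ∀ n, n₀ ≤ n → (n + 1) ^ a ≤ C * (n + 1) ^ b) : a ≤ b := by
  by_contra! hab
  have h1 := h (n₀ + C) (Nat.le_add_right _ _)
  have h2 : (n₀ + C + 1) ^ (b + 1) ≤ (n₀ + C + 1) ^ a := Nat.pow_le_pow_right (by omega) hab
  have h3 := h2.trans h1
  rw [pow_succ, mul_comm] at h3
  have := Nat.le_of_mul_le_mul_right h3 (by positivity)
  omega

theorem add_succ_le_mul (N E : ℕ) : N + E + 1 ≤ (E + 1) * (N + 1) := by nlinarith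

theorem exists_forall_le_natCast (c : Fin r → ℤ) : ∃ E : ℕ, ∀ i, |c i| ≤ E := by
  obtain ⟨b, hb⟩ := Set.Finite.bddAbove (Set.finite_range fun i => |c i|)
  exact ⟨b.toNat, fun i => (hb ⟨i, rfl⟩).trans (Int.self_le_toNat b)⟩

theorem exists_sum_fracCoeff_le (p : (Fin r → ℤ) × (Fin r → ℕ)) (E : ℕ) :
    ∃ C : ℕ, ∀ (N : ℕ) (F : Fin r → Finset ℤ), (∀ i, ∀ s ∈ F i, s ≤ N + E) →
      ∑ ν ∈ Fintype.piFinset F, fracCoeff p ν ≤ C * (N + 1) ^ ∑ i, p.2 i := by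
  obtain ⟨D, hD⟩ := exists_forall_le_natCast p.1
  refine ⟨∏ i, (E + D + 1) ^ p.2 i, fun N F hF => ?_⟩
  simp only [fracCoeff]
  rw [← Finset.prod_univ_sum F fun i s => poleCoeff (p.2 i) (s - p.1 i),
    ← Finset.prod_pow_eq_pow_sum, ← Finset.prod_mul_distrib]
  refine Finset.prod_le_prod' fun i _ => ?_
  rw [← mul_pow]
  refine le_trans ?_ (Nat.pow_le_pow_left (add_succ_le_mul N (E + D)) _)
  rw [← Finset.sum_image (f := fun s => poleCoeff (p.2 i) s) (g := fun s => s - p.1 i)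
    (fun x _ y _ hxy => by simpa using hxy)]
  refine sum_poleCoeff_le_pow _ _ fun s hs => ?_
  obtain ⟨x, hx, rfl⟩ := Finset.mem_image.1 hs
  have h1 := hF i x hx
  have h2 := abs_le.1 (hD i)
  push_cast
  omega

theorem exists_sum_sumCoeff_le {L : Multiset ((Fin r → ℤ) × (Fin r → ℕ))} {D : ℕ}
    (hL : ∀ p ∈ L, ∑ i, p.2 i ≤ D) (E : ℕ) :
    ∃ C : ℕ, ∀ (N : ℕ) (F : Fin r → Finset ℤ), (∀ i, ∀ s ∈ F i, s ≤ N + E) →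
      ∑ ν ∈ Fintype.piFinset F, sumCoeff L ν ≤ C * (N + 1) ^ D := by
  induction L using Multiset.induction_on with
  | empty => exact ⟨0, by simp⟩
  | cons p L ih =>
    obtain ⟨C, hC⟩ := ih fun q hq => hL q (Multiset.mem_cons_of_mem hq)
    obtain ⟨C', hC'⟩ := exists_sum_fracCoeff_le p E
    refine ⟨C' + C, fun N F hF => ?_⟩
    simp only [sumCoeff_cons, Finset.sum_add_distrib, add_mul]
    refine add_le_add ((hC' N F hF).trans (Nat.mul_le_mul_left _ ?_)) (hC N F hF)
    exact Nat.pow_le_pow_right (by omega) (hL p (Multiset.mem_cons_self p L))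

/-- If the sums of the coefficients over the boxes of side `N` grow at least like `N^k`, then some
pole has order at least `k`. -/
theorem exists_le_of_pow_le_sum {L : Multiset ((Fin r → ℤ) × (Fin r → ℕ))} {k C E : ℕ}
    (F : ℕ → Fin r → Finset ℤ) (hF : ∀ N i, ∀ s ∈ F N i, s ≤ N + E)
    (h : ∀ N : ℕ, (N + 1) ^ k ≤ C * ∑ ν ∈ Fintype.piFinset (F N), sumCoeff L ν) :
    ∃ p ∈ L, k ≤ ∑ i, p.2 i := by
  by_contra! hlt
  rcases Nat.eq_zero_or_pos k with rfl | hk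
  · have : L = 0 := Multiset.eq_zero_of_forall_notMem fun p hp => by simpa using hlt p hp
    simpa [this] using h 0
  · obtain ⟨C', hC'⟩ := exists_sum_sumCoeff_le (D := k - 1)
      (fun p hp => Nat.le_sub_one_of_lt (hlt p hp)) E
    have := le_of_pow_le_mul_pow (a := k) (b := k - 1) (C := C * C') (n₀ := 0) fun N _ => by
      rw [mul_assoc]
      exact (h N).trans (Nat.mul_le_mul_left _ (hC' N (F N) (hF N)))
    omega

/-- Far out in all directions, only the fractions with poles in all variables contribute, and each
of them contributes a polynomial of degree `|n| - r`. -/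
theorem exists_sumCoeff_le {L : Multiset ((Fin r → ℤ) × (Fin r → ℕ))} {k : ℕ}
    (hL : ∀ p ∈ L, (∀ i, p.2 i ≠ 0) → ∑ i, p.2 i ≤ k + r) :
    ∃ c : ℤ, ∀ E : ℕ, ∃ C : ℕ, ∀ (N : ℕ) (ν : Fin r → ℤ), (∀ i, c ≤ ν i) →
      (∀ i, ν i ≤ N + E) → sumCoeff L ν ≤ C * (N + 1) ^ k := by
  induction L using Multiset.induction_on with
  | empty => exact ⟨0, fun _ => ⟨0, by simp⟩⟩
  | cons p L ih =>
    obtain ⟨c, hc⟩ := ih fun q hq => hL q (Multiset.mem_cons_of_mem hq)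
    obtain ⟨D, hD⟩ := exists_forall_le_natCast p.1
    refine ⟨max c (D + 1), fun E => ?_⟩
    obtain ⟨C, hC⟩ := hc E
    refine ⟨∏ i, (E + D + 1) ^ (p.2 i - 1) + C, fun N ν hν hν' => ?_⟩
    rw [sumCoeff_cons, add_mul]
    refine add_le_add ?_ (hC N ν (fun i => (le_max_left _ _).trans (hν i)) hν')
    by_cases hp : ∀ i, p.2 i ≠ 0
    · have hk : ∑ i, (p.2 i - 1) ≤ k := by
        have h1 : ∑ i, (p.2 i - 1) + ∑ i : Fin r, 1 = ∑ i, p.2 i := by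
          rw [← Finset.sum_add_distrib]
          exact Finset.sum_congr rfl fun i _ => Nat.sub_add_cancel (Nat.pos_of_ne_zero (hp i))
        have h2 := hL p (Multiset.mem_cons_self p L) hp
        simp only [Finset.sum_const, Finset.card_univ, Fintype.card_fin, smul_eq_mul,
          mul_one] at h1
        omega
      refine le_trans ?_ (Nat.mul_le_mul_left _ (Nat.pow_le_pow_right (by omega) hk))
      rw [← Finset.prod_pow_eq_pow_sum, ← Finset.prod_mul_distrib]
      refine Finset.prod_le_prod' fun i _ => ?_
      rw [← mul_pow]
      refine le_trans ?_ (Nat.pow_le_pow_left (add_succ_le_mul N (E + D)) _)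
      refine poleCoeff_le _ ?_
      have h1 := hν' i
      have h2 := abs_le.1 (hD i)
      push_cast
      omega
    · push Not at hp
      obtain ⟨i, hi⟩ := hp
      rw [fracCoeff, Finset.prod_eq_zero (Finset.mem_univ i)]
      · exact Nat.zero_le _
      · rw [hi, poleCoeff_zero, if_neg]
        have h1 := (le_max_right _ _).trans (hν i)
        have h2 := abs_le.1 (hD i)
        omega

theorem exists_sumCoeff_eq_zero_of_forall {L : Multiset ((Fin r → ℤ) × (Fin r → ℕ))}
    (hL : ∀ p ∈ L, ∃ i, p.2 i = 0) :
    ∃ c : ℤ, ∀ ν : Fin r → ℤ, (∀ i, c ≤ ν i) → sumCoeff L ν = 0 := by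
  induction L using Multiset.induction_on with
  | empty => exact ⟨0, by simp⟩
  | cons p L ih =>
    obtain ⟨c, hc⟩ := ih fun q hq => hL q (Multiset.mem_cons_of_mem hq)
    obtain ⟨i, hi⟩ := hL p (Multiset.mem_cons_self p L)
    refine ⟨max c (p.1 i + 1), fun ν hν => ?_⟩
    rw [sumCoeff_cons, hc ν fun i => (le_max_left _ _).trans (hν i), fracCoeff,
      Finset.prod_eq_zero (Finset.mem_univ i)]
    rw [hi, poleCoeff_zero, if_neg]
    have h1 := (le_max_right _ _).trans (hν i)
    omega

theorem pow_le_mul_fracCoeff (p : (Fin r → ℤ) × (Fin r → ℕ)) {n : ℕ} {ν : Fin r → ℤ}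
    (h : ∀ i, p.2 i ≠ 0 → p.1 i + n ≤ ν i) (h' : ∀ i, p.2 i = 0 → ν i = p.1 i) :
    (n + 1) ^ ∑ i, (p.2 i - 1) ≤ (∏ i, (p.2 i - 1).factorial) * fracCoeff p ν := by
  rw [fracCoeff, ← Finset.prod_pow_eq_pow_sum, ← Finset.prod_mul_distrib]
  refine Finset.prod_le_prod' fun i _ => ?_
  by_cases hi : p.2 i = 0
  · simp [hi, h' i hi, poleCoeff_zero]
  · obtain ⟨m, hm⟩ := Nat.exists_eq_succ_of_ne_zero hi
    have := h i hi
    rw [hm]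
    exact pow_le_factorial_mul_poleCoeff (by omega)

/-- If the coefficients do not decrease, up to a constant factor, along the diagonal, then the
maximal total pole order is attained by a fraction with poles in all variables. -/
theorem exists_full_of_le_mul {L : Multiset ((Fin r → ℤ) × (Fin r → ℕ))} {K : ℕ}
    (h : ∀ ν, sumCoeff L ν ≤ K * sumCoeff L (ν + 1)) {p} (hp : p ∈ L) :
    ∃ q ∈ L, (∀ i, q.2 i ≠ 0) ∧ ∑ i, p.2 i ≤ ∑ i, q.2 i := by
  have hiter : ∀ (m : ℕ) (ν), sumCoeff L ν ≤ K ^ m * sumCoeff L (ν + fun _ => (m : ℤ)) := by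
    intro m
    induction m with
    | zero => intro ν; simp [← Pi.zero_def]
    | succ m ih =>
      intro ν
      refine (ih ν).trans ?_
      rw [pow_succ, mul_assoc]
      refine Nat.mul_le_mul_left _ ((h _).trans (le_of_eq ?_))
      congr 2
      ext i
      simp only [Pi.add_apply, Pi.one_apply]
      push_cast
      ring
  by_contra! hlt
  obtain ⟨D, hD⟩ := exists_forall_le_natCast p.1
  -- Along the ray which leaves the coordinates without pole fixed, the fraction `p` grows with
  -- exponent `|n| - #{i | n_i ≠ 0} ≥ |n| - r`.
  set ν : ℕ → Fin r → ℤ := fun n i => p.1 i + if p.2 i = 0 then 0 else n with hν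
  have hlow : ∀ n : ℕ, (n + 1) ^ ∑ i, (p.2 i - 1) ≤
      (∏ i, (p.2 i - 1).factorial) * sumCoeff L (ν n) := fun n =>
    (pow_le_mul_fracCoeff p (fun i hi => by simp [hν, hi]) (fun i hi => by simp [hν, hi])).trans
      (Nat.mul_le_mul_left _ (fracCoeff_le_sumCoeff hp _))
  by_cases hq : ∃ q ∈ L, ∀ i, q.2 i ≠ 0
  · obtain ⟨q, hqL, hq⟩ := hq
    have h1 := hlt q hqL hq
    have h2 : r ≤ ∑ i, q.2 i := by
      calc r = ∑ _i : Fin r, 1 := by simp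
        _ ≤ _ := Finset.sum_le_sum fun i _ => Nat.one_le_iff_ne_zero.2 (hq i)
    obtain ⟨k, hk⟩ := Nat.exists_eq_add_of_lt (h2.trans_lt h1)
    obtain ⟨c, hc⟩ := exists_sumCoeff_le (L := L) (k := k) fun q hqL hq => by
      have := hlt q hqL hq
      omega
    obtain ⟨C, hC⟩ := hc (D + (c.toNat + D))
    have := le_of_pow_le_mul_pow (a := ∑ i, (p.2 i - 1)) (b := k) (n₀ := 0)
      (C := (∏ i, (p.2 i - 1).factorial) * (K ^ (c.toNat + D) * C)) fun n _ => by
        refine (hlow n).trans ?_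
        rw [mul_assoc, mul_assoc]
        refine Nat.mul_le_mul_left _ ((hiter (c.toNat + D) _).trans (Nat.mul_le_mul_left _ ?_))
        refine hC n _ (fun i => ?_) (fun i => ?_)
        · have h2 := abs_le.1 (hD i)
          simp only [hν, Pi.add_apply]
          split_ifs <;> push_cast <;> omega
        · have h2 := abs_le.1 (hD i)
          simp only [hν, Pi.add_apply]
          split_ifs <;> push_cast <;> omega
    have h3 : ∑ i, p.2 i ≤ ∑ i, (p.2 i - 1) + ∑ _i : Fin r, 1 := by
      rw [← Finset.sum_add_distrib]
      exact Finset.sum_le_sum fun i _ => by omega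
    simp at h3
    omega
  · push Not at hq
    obtain ⟨c, hc⟩ := exists_sumCoeff_eq_zero_of_forall hq
    have h1 := (hlow 0).trans (Nat.mul_le_mul_left _ (hiter (c.toNat + D) _))
    rw [hc] at h1
    · simp at h1
    · intro i
      have h2 := abs_le.1 (hD i)
      simp only [hν, Pi.add_apply]
      split_ifs <;> push_cast <;> omega

/-- Lower bound for the pole orders by the growth of the coefficients along the diagonal. -/
theorem exists_full_of_pow_le {ι : Type*} {L : Multiset ((Fin r → ℤ) × (Fin r → ℕ))} {k C : ℕ}
    (J : Finset ι) (μ : ι → Fin r → ℤ)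
    (h : ∀ n : ℕ, (n + 1) ^ k ≤ C * ∑ j ∈ J, sumCoeff L ((fun _ => (n : ℤ)) + μ j)) :
    ∃ p ∈ L, (∀ i, p.2 i ≠ 0) ∧ k + r ≤ ∑ i, p.2 i := by
  have hE : ∃ E : ℕ, ∀ j ∈ J, ∀ i, |μ j i| ≤ E := by
    choose D hD using fun j => exists_forall_le_natCast (μ j)
    refine ⟨J.sup D, fun j hj i => (hD j i).trans ?_⟩
    exact_mod_cast Finset.le_sup hj
  obtain ⟨E, hE⟩ := hE
  by_contra! hlt
  by_cases hq : ∃ q ∈ L, ∀ i, q.2 i ≠ 0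
  · obtain ⟨q, hqL, hq⟩ := hq
    have h1 := hlt q hqL hq
    have h2 : r ≤ ∑ i, q.2 i := by
      calc r = ∑ _i : Fin r, 1 := by simp
        _ ≤ _ := Finset.sum_le_sum fun i _ => Nat.one_le_iff_ne_zero.2 (hq i)
    obtain ⟨c, hc⟩ := exists_sumCoeff_le (L := L) (k := k - 1) fun q hqL hq => by
      have := hlt q hqL hq
      omega
    obtain ⟨C', hC'⟩ := hc E
    have := le_of_pow_le_mul_pow (a := k) (b := k - 1) (n₀ := c.toNat + E)
      (C := C * (J.card * C')) fun n hn => by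
        refine (h n).trans ?_
        rw [mul_assoc, mul_assoc]
        refine Nat.mul_le_mul_left _ ?_
        rw [← smul_eq_mul J.card]
        refine Finset.sum_le_card_nsmul _ _ _ fun j hj => ?_
        refine hC' n _ (fun i => ?_) (fun i => ?_)
        · have h2 := abs_le.1 (hE j hj i)
          simp only [Pi.add_apply]
          omega
        · have h2 := abs_le.1 (hE j hj i)
          simp only [Pi.add_apply]
          omega
    omega
  · push Not at hq
    obtain ⟨c, hc⟩ := exists_sumCoeff_eq_zero_of_forall hq
    have h1 := h (c.toNat + E)
    rw [Finset.sum_eq_zero] at h1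
    · simp at h1
    · intro j hj
      refine hc _ fun i => ?_
      have h2 := abs_le.1 (hE j hj i)
      simp only [Pi.add_apply]
      push_cast
      omega

/-- Upper bound for the pole orders by the growth of the coefficients along the diagonal. -/
theorem sum_le_of_sumCoeff_le {L : Multiset ((Fin r → ℤ) × (Fin r → ℕ))} {p} (hp : p ∈ L)
    (hp' : ∀ i, p.2 i ≠ 0) {k C n₀ : ℕ}
    (h : ∀ n : ℕ, n₀ ≤ n → sumCoeff L (fun _ => (n : ℤ)) ≤ C * (n + 1) ^ k) :
    ∑ i, p.2 i ≤ k + r := by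
  obtain ⟨D, hD⟩ := exists_forall_le_natCast p.1
  have := le_of_pow_le_mul_pow (a := ∑ i, (p.2 i - 1)) (b := k) (n₀ := n₀)
    (C := (∏ i, (p.2 i - 1).factorial) * (C * (D + 1) ^ k)) fun n hn => by
      refine (pow_le_mul_fracCoeff p (ν := fun _ => ((n + D : ℕ) : ℤ)) (fun i _ => ?_)
        (fun i hi => absurd hi (hp' i))).trans ?_
      · have := abs_le.1 (hD i)
        push_cast
        omega
      · rw [mul_assoc, mul_assoc, ← mul_pow]
        refine Nat.mul_le_mul_left _ ((fracCoeff_le_sumCoeff hp _).trans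
          ((h (n + D) (by omega)).trans ?_))
        exact Nat.mul_le_mul_left _ (Nat.pow_le_pow_left (add_succ_le_mul n D) _)
  have h3 : ∑ i, p.2 i ≤ ∑ i, (p.2 i - 1) + ∑ _i : Fin r, 1 := by
    rw [← Finset.sum_add_distrib]
    exact Finset.sum_le_sum fun i _ => by omega
  simp at h3
  omega

theorem exists_sumCoeff_pos {L : Multiset ((Fin r → ℤ) × (Fin r → ℕ))} {p} (hp : p ∈ L)
    (hp' : ∀ i, p.2 i ≠ 0) (c : ℤ) : ∃ ν : Fin r → ℤ, (∀ i, c ≤ ν i) ∧ 0 < sumCoeff L ν := by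
  obtain ⟨D, hD⟩ := exists_forall_le_natCast p.1
  refine ⟨fun _ => ((c.toNat + D : ℕ) : ℤ), fun i => by push_cast; omega, ?_⟩
  have := pow_le_mul_fracCoeff p (n := 0) (ν := fun _ => ((c.toNat + D : ℕ) : ℤ))
    (fun i _ => by have := abs_le.1 (hD i); push_cast; omega) (fun i hi => absurd hi (hp' i))
  refine lt_of_lt_of_le ?_ (fracCoeff_le_sumCoeff hp _)
  by_contra! h0
  rw [Nat.le_zero.1 h0] at this
  simp at this

end Coefficients

/-! ### Laurent polynomials and formal series -/

section LaurentSeries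

variable {r : ℕ}

namespace LaurentPoly

theorem evalOne_add (P Q : LaurentPoly r) : evalOne (P + Q) = evalOne P + evalOne Q := by
  simp only [evalOne, AddMonoidAlgebra.coeff_add]
  exact Finsupp.sum_add_index' (fun _ => rfl) fun _ _ _ => rfl

@[simp]
theorem evalOne_single (c : Fin r → ℤ) (a : ℤ) :
    evalOne (AddMonoidAlgebra.single c a : LaurentPoly r) = a := by
  simp [evalOne]

@[simp]
theorem evalOne_zero : evalOne (0 : LaurentPoly r) = 0 := rfl

/-- Evaluation at `(1, …, 1)` as a homomorphism of additive groups. -/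
def evalOneHom : LaurentPoly r →+ ℤ := AddMonoidHom.mk' evalOne evalOne_add

theorem evalOne_sub (P Q : LaurentPoly r) : evalOne (P - Q) = evalOne P - evalOne Q :=
  map_sub evalOneHom P Q

theorem evalOne_mul (P Q : LaurentPoly r) : evalOne (P * Q) = evalOne P * evalOne Q := by
  induction P using AddMonoidAlgebra.induction_linear with
  | zero => simp
  | add P P' h h' => rw [add_mul, evalOne_add, h, h', evalOne_add, add_mul]
  | single c a =>
    induction Q using AddMonoidAlgebra.induction_linear with
    | zero => simp
    | add P P' h h' => rw [mul_add, evalOne_add, h, h', evalOne_add, mul_add]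
    | single c' a' => simp [AddMonoidAlgebra.single_mul_single]

theorem toSeries_add (P Q : LaurentPoly r) : toSeries (P + Q) = toSeries P + toSeries Q := by
  ext ν
  simp [toSeries, HahnSeries.coeff_ofFinsupp]

@[simp]
theorem toSeries_zero : toSeries (0 : LaurentPoly r) = 0 := by
  simp [toSeries]

theorem toSeries_single (c : Fin r → ℤ) (a : ℤ) :
    toSeries (AddMonoidAlgebra.single c a : LaurentPoly r) = HahnSeries.single c a := by
  classical
  ext ν
  simp only [toSeries, HahnSeries.coeff_ofFinsupp, AddMonoidAlgebra.coeff_single,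
    HahnSeries.coeff_single, Finsupp.single_apply, eq_comm]

theorem toSeries_mul (P Q : LaurentPoly r) : toSeries (P * Q) = toSeries P * toSeries Q := by
  induction P using AddMonoidAlgebra.induction_linear with
  | zero => simp
  | add P P' h h' => rw [add_mul, toSeries_add, h, h', toSeries_add, add_mul]
  | single c a =>
    induction Q using AddMonoidAlgebra.induction_linear with
    | zero => simp
    | add P P' h h' => rw [mul_add, toSeries_add, h, h', toSeries_add, mul_add]
    | single c' a' => simp [AddMonoidAlgebra.single_mul_single, toSeries_single]

/-- The embedding of the Laurent polynomials into the formal series. -/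
def toSeriesHom : LaurentPoly r →+* FormalSeries r where
  toFun := toSeries
  map_one' := by rw [AddMonoidAlgebra.one_def, toSeries_single]; rfl
  map_mul' := toSeries_mul
  map_zero' := toSeries_zero
  map_add' := toSeries_add

theorem toSeriesHom_apply (Q : LaurentPoly r) : toSeriesHom Q = toSeries Q := rfl

theorem toSeriesHom_injective : Function.Injective (toSeriesHom : LaurentPoly r →+* _) := by
  intro P Q h
  apply AddMonoidAlgebra.coeff_injective
  ext ν
  exact congrArg (fun s : FormalSeries r => s.coeff ν) h

/-- The Laurent polynomial `1 - t_i`. -/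
def oneSub (i : Fin r) : LaurentPoly r := 1 - AddMonoidAlgebra.single (Pi.single i 1) 1

theorem toSeriesHom_oneSub (i : Fin r) : toSeriesHom (oneSub i) = oneSubT i := by
  rw [oneSub, map_sub, map_one, toSeriesHom_apply, toSeries_single]
  rfl

theorem evalOne_oneSub (i : Fin r) : evalOne (oneSub i) = 0 := by
  rw [oneSub, evalOne_sub, AddMonoidAlgebra.one_def, evalOne_single, evalOne_single, sub_self]

end LaurentPoly

theorem invOneSubT_add (m n : Fin r → ℕ) : invOneSubT (m + n) = invOneSubT m * invOneSubT n := by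
  simp only [invOneSubT, Pi.add_apply, pow_add, Finset.prod_mul_distrib, mul_inv, Units.val_mul]

theorem invOneSubT_zero : invOneSubT (0 : Fin r → ℕ) = 1 := by
  simp [invOneSubT]

theorem oneSubT_pow_mul_invOneSubT (i : Fin r) (k : ℕ) :
    (oneSubT i : FormalSeries r) ^ k * invOneSubT (Pi.single i k) = 1 := by
  have h : ∏ j, oneSubT j ^ (Pi.single i k : Fin r → ℕ) j = oneSubT (r := r) i ^ k := by
    rw [Finset.prod_eq_single i]
    · simp
    · intro j _ hj; simp [Pi.single_eq_of_ne hj]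
    · simp
  rw [invOneSubT, h, ← Units.val_pow_eq_pow_val, Units.mul_inv]

/-- The formal series with coefficients `fracCoeff (0, n)`. -/
def fracSeries (n : Fin r → ℕ) : FormalSeries r where
  coeff ν := fracCoeff (0, n) ν
  isPWO_support' := by
    have hmono : Monotone (fun (k : Fin r → ℕ) (i : Fin r) => (k i : ℤ)) :=
      fun a b hab i => Int.ofNat_le.2 (hab i)
    refine Set.IsPWO.mono (t := (fun (k : Fin r → ℕ) (i : Fin r) => (k i : ℤ)) '' Set.univ)
      ((Set.isPWO_of_wellQuasiOrderedLE (Set.univ : Set (Fin r → ℕ))).image_of_monotone hmono)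
      fun ν hν => ?_
    refine ⟨fun i => (ν i).toNat, Set.mem_univ _, funext fun i => Int.toNat_of_nonneg ?_⟩
    by_contra! h
    refine hν ?_
    change ((fracCoeff (0, n) ν : ℕ) : ℤ) = 0
    rw [fracCoeff_eq_zero_of_lt (i := i) (by simpa using h), Nat.cast_zero]

theorem oneSubT_mul_fracSeries (n : Fin r → ℕ) (i : Fin r) :
    (oneSubT i : FormalSeries r) * fracSeries (n + Pi.single i 1) = fracSeries n := by
  ext ν
  change ((1 - HahnSeries.single (Pi.single i 1) 1) * fracSeries (n + Pi.single i 1)).coeff ν = _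
  rw [sub_mul, one_mul, HahnSeries.coeff_sub, HahnSeries.coeff_single_mul, one_mul]
  simp only [fracSeries]
  rw [fracCoeff_add_single 0 n i ν]
  push_cast
  ring

theorem invOneSubT_eq_fracSeries (n : Fin r → ℕ) : invOneSubT n = fracSeries n := by
  generalize hk : ∑ i, n i = k
  induction k generalizing n with
  | zero =>
    have : n = 0 := by
      ext i
      have := Finset.single_le_sum (fun j _ => Nat.zero_le (n j)) (Finset.mem_univ i)
      simpa [hk] using this
    subst this
    classical
    rw [invOneSubT_zero]
    ext ν
    simp only [fracSeries, HahnSeries.coeff_one, fracCoeff_zero]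
    split_ifs <;> simp
  | succ k ih =>
    have : ∃ i, n i ≠ 0 := by
      by_contra! h
      simp [h] at hk
    obtain ⟨i, hi⟩ := this
    obtain ⟨m, rfl⟩ : ∃ m, n = m + Pi.single i 1 := by
      refine ⟨n - Pi.single i 1, (tsub_add_cancel_of_le ?_).symm⟩
      intro j
      rcases eq_or_ne j i with rfl | hj
      · simpa using Nat.one_le_iff_ne_zero.2 hi
      · simp [Pi.single_eq_of_ne hj]
    have hm : ∑ j, m j = k := by
      simp only [Pi.add_apply, Finset.sum_add_distrib, Finset.sum_pi_single',
        Finset.mem_univ, if_true] at hk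
      omega
    apply (oneSubT (r := r) i).isUnit.mul_left_cancel
    rw [oneSubT_mul_fracSeries, ← ih m hm, invOneSubT_add, mul_left_comm, ← pow_one
      (oneSubT i : FormalSeries r), oneSubT_pow_mul_invOneSubT, mul_one]

theorem coeff_single_mul_invOneSubT (c : Fin r → ℤ) (n : Fin r → ℕ) (ν : Fin r → ℤ) :
    (HahnSeries.single c (1 : ℤ) * invOneSubT n).coeff ν = fracCoeff (c, n) ν := by
  rw [HahnSeries.coeff_single_mul, one_mul, invOneSubT_eq_fracSeries]
  simp [fracSeries, fracCoeff]

/-! ### Uniqueness of the values at `1` -/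

/-- The substitution `t_i ↦ 1 - s_i`, from Laurent polynomials to power series in the `s_i`. -/
def substOneSub : LaurentPoly r →+* MvPowerSeries (Fin r) ℤ :=
  (AddMonoidAlgebra.lift ℤ (MvPowerSeries (Fin r) ℤ) (Fin r → ℤ)
    { toFun := fun ν => ((∏ i, (MvPowerSeries.isUnit_iff_constantCoeff.2
        (show IsUnit (MvPowerSeries.constantCoeff (1 - MvPowerSeries.X (R := ℤ) i)) by
          simp)).unit ^ (Multiplicative.toAdd ν i) : (MvPowerSeries (Fin r) ℤ)ˣ) :
          MvPowerSeries (Fin r) ℤ)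
      map_one' := by simp
      map_mul' := fun a b => by
        simp only [toAdd_mul, Pi.add_apply, zpow_add, Finset.prod_mul_distrib,
          Units.val_mul] }).toRingHom

theorem substOneSub_oneSub (i : Fin r) :
    substOneSub (LaurentPoly.oneSub i) = MvPowerSeries.X i := by
  rw [LaurentPoly.oneSub, map_sub, map_one, sub_eq_iff_eq_add, ← sub_eq_iff_eq_add']
  simp only [substOneSub, AlgHom.toRingHom_eq_coe, RingHom.coe_coe, AddMonoidAlgebra.lift_single,
    MonoidHom.coe_mk, OneHom.coe_mk, toAdd_ofAdd]
  rw [Algebra.smul_def, map_one, one_mul, Finset.prod_eq_single i]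
  · simp
  · intro j _ hj; simp [Pi.single_eq_of_ne hj]
  · simp

theorem constantCoeff_substOneSub (Q : LaurentPoly r) :
    MvPowerSeries.constantCoeff (substOneSub Q) = Q.evalOne := by
  induction Q using AddMonoidAlgebra.induction_linear with
  | zero => simp
  | add P Q h h' => rw [map_add, map_add, h, h', LaurentPoly.evalOne_add]
  | single c a =>
    simp only [substOneSub, AlgHom.toRingHom_eq_coe, RingHom.coe_coe,
      AddMonoidAlgebra.lift_single, MonoidHom.coe_mk, OneHom.coe_mk, LaurentPoly.evalOne_single]
    have h : ∀ u : (MvPowerSeries (Fin r) ℤ)ˣ,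
        Units.map (MvPowerSeries.constantCoeff (σ := Fin r) (R := ℤ)).toMonoidHom u = 1 →
        MvPowerSeries.constantCoeff (u : MvPowerSeries (Fin r) ℤ) = 1 := fun u hu =>
      congrArg Units.val hu
    rw [Algebra.smul_def, map_mul, h, eq_intCast, map_intCast, mul_one]
    · simp
    · rw [map_prod]
      refine Finset.prod_eq_one fun i _ => ?_
      rw [map_zpow]
      convert one_zpow _
      ext
      simp

/-- After multiplication by `(1 - t)^{(d, …, d)}` and the substitution `t_i = 1 - s_i`, the value
`Q_n(1)` is the coefficient of the monomial `s^{(d, …, d) - n}`. -/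
theorem evalOne_eq_of_fractionSum_eq {d : ℕ} {Q Q' : (Fin r → ℕ) → LaurentPoly r}
    (h : fractionSum d Q = fractionSum d Q') {n : Fin r → ℕ} (hn : ∑ i, n i = d) :
    (Q n).evalOne = (Q' n).evalOne := by
  have hmem : ∀ m : Fin r → ℕ, m ∈ weightIndices r (d : WithBot ℕ∞) ↔ ∑ i, m i = d := fun m => by
    rw [mem_weightIndices]
    norm_cast
  have hle : ∀ m : Fin r → ℕ, ∑ i, m i = d → ∀ i, m i ≤ d := fun m hm i =>
    hm ▸ Finset.single_le_sum (fun j _ => Nat.zero_le (m j)) (Finset.mem_univ i)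
  -- `u = (1 - t)^{(d, …, d)}` clears the denominators.
  have hclear : ∀ P : (Fin r → ℕ) → LaurentPoly r,
      fractionSum d P * ((∏ i, oneSubT i ^ d : (FormalSeries r)ˣ) : FormalSeries r) =
        LaurentPoly.toSeriesHom (∑ m ∈ weightIndices r (d : WithBot ℕ∞),
          P m * ∏ i, LaurentPoly.oneSub i ^ (d - m i)) := fun P => by
    rw [fractionSum, Finset.sum_mul, map_sum]
    refine Finset.sum_congr rfl fun m hm => ?_
    rw [hmem] at hm
    rw [map_mul, LaurentPoly.toSeriesHom_apply, mul_assoc]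
    congr 1
    rw [invOneSubT, ← Units.val_mul, ← Finset.prod_inv_distrib, ← Finset.prod_mul_distrib,
      map_prod, Units.coe_prod]
    refine Finset.prod_congr rfl fun i _ => ?_
    rw [map_pow, LaurentPoly.toSeriesHom_oneSub, ← Units.val_pow_eq_pow_val,
      pow_sub _ (hle m hm i), mul_comm]
  have h1 := LaurentPoly.toSeriesHom_injective
    ((hclear Q).symm.trans ((congrArg (· * _) h).trans (hclear Q')))
  have hcoeff : ∀ P : (Fin r → ℕ) → LaurentPoly r,
      MvPowerSeries.coeff (Finsupp.equivFunOnFinite.symm fun i => d - n i)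
        (substOneSub (∑ m ∈ weightIndices r (d : WithBot ℕ∞),
          P m * ∏ i, LaurentPoly.oneSub i ^ (d - m i))) = (P n).evalOne := fun P => by
    classical
    have hmon : ∀ m : Fin r → ℕ, substOneSub (∏ i, LaurentPoly.oneSub i ^ (d - m i)) =
        MvPowerSeries.monomial (Finsupp.equivFunOnFinite.symm fun i => d - m i) 1 := fun m => by
      rw [map_prod]
      simp only [map_pow, substOneSub_oneSub]
      rw [MvPowerSeries.monomial_eq' , map_one, one_mul, Finsupp.prod_fintype _ _ (by simp)]
      simp
    rw [map_sum, map_sum, Finset.sum_eq_single n]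
    · rw [map_mul, hmon, MvPowerSeries.coeff_mul_monomial, if_pos le_rfl, mul_one, tsub_self,
        MvPowerSeries.coeff_zero_eq_constantCoeff_apply, constantCoeff_substOneSub]
    · intro m hm hmn
      rw [hmem] at hm
      rw [map_mul, hmon, MvPowerSeries.coeff_mul_monomial, if_neg]
      intro hle'
      have hnm : ∀ i ∈ Finset.univ, n i ≤ m i := fun i _ => by
        have h2 := hle' i
        simp only [Finsupp.equivFunOnFinite_symm_apply_apply] at h2
        have h3 := hle n hn i
        have h4 := hle m hm i
        omega
      exact hmn (funext fun i =>
        ((Finset.sum_eq_sum_iff_of_le hnm).1 (hn.trans hm.symm) i (Finset.mem_univ i)).symm)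
    · intro hn'
      exact absurd ((hmem n).2 hn) hn'
  rw [← hcoeff Q, ← hcoeff Q', h1]

end LaurentSeries

/-! ### Decompositions with fixed total pole order -/

section Numerators

variable {r : ℕ}

theorem natCast_mem_weightIndices {d : ℕ} {n : Fin r → ℕ} :
    n ∈ weightIndices r (d : WithBot ℕ∞) ↔ ∑ i, n i = d := by
  rw [mem_weightIndices]
  norm_cast

/-- Every fraction `t^c / (1 - t)^n` with `|n| ≤ d` can be expanded to total pole order `d`, using
powers of the same `1 - t_i` for all of them. -/
theorem exists_expanded_fractions {L : Multiset ((Fin r → ℤ) × (Fin r → ℕ))} {d : ℕ}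
    (hd : ∀ p ∈ L, ∑ i, p.2 i ≤ d) (hmax : ∃ p ∈ L, ∑ i, p.2 i = d) :
    ∃ (N : (Fin r → ℤ) × (Fin r → ℕ) → Fin r → ℕ)
      (q : (Fin r → ℤ) × (Fin r → ℕ) → LaurentPoly r),
      (∀ p ∈ L, ∑ i, N p i = d ∧
        (q p).toSeries * invOneSubT (N p) = HahnSeries.single p.1 1 * invOneSubT p.2) ∧
      (∀ p ∈ L, ∑ i, p.2 i = d → N p = p.2 ∧ (q p).evalOne = 1) ∧
      (∀ p ∈ L, p.2 ≠ N p → (q p).evalOne = 0) ∧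
      ∀ n, (∀ p ∈ L, N p = n → p.2 ≠ N p) → (∃ p ∈ L, N p = n) →
        ∃ i, n i ≠ 0 ∧ ∀ p ∈ L, N p = n → LaurentPoly.oneSub i ∣ q p := by
  rcases isEmpty_or_nonempty (Fin r) with hr | ⟨⟨j⟩⟩
  · refine ⟨fun p => p.2, fun p => AddMonoidAlgebra.single p.1 1, fun p _ => ⟨?_, ?_⟩,
      fun p _ _ => ⟨rfl, LaurentPoly.evalOne_single _ _⟩, fun p _ h => absurd rfl h,
      fun n hn ⟨p, hp, hpn⟩ => absurd rfl (hn p hp hpn)⟩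
    · obtain ⟨p', -, hp'⟩ := hmax
      rw [← hp']
      simp
    · rw [LaurentPoly.toSeries_single]
  · have hne : ∀ p : (Fin r → ℤ) × (Fin r → ℕ),
        p.2 ≠ p.2 + Pi.single j (d - ∑ i, p.2 i) → d - ∑ i, p.2 i ≠ 0 := fun p h h0 => by
      rw [h0] at h
      simp at h
    refine ⟨fun p => p.2 + Pi.single j (d - ∑ i, p.2 i),
      fun p => AddMonoidAlgebra.single p.1 1 * LaurentPoly.oneSub j ^ (d - ∑ i, p.2 i),
      fun p hp => ⟨?_, ?_⟩, fun p hp h => ?_, fun p hp h => ?_, fun n hn ⟨p, hp, hpn⟩ => ?_⟩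
    · have := hd p hp
      simp only [Pi.add_apply, Finset.sum_add_distrib, Finset.sum_pi_single', Finset.mem_univ,
        if_true]
      omega
    · rw [← LaurentPoly.toSeriesHom_apply, map_mul, map_pow, LaurentPoly.toSeriesHom_oneSub,
        LaurentPoly.toSeriesHom_apply, LaurentPoly.toSeries_single, invOneSubT_add,
        mul_comm (invOneSubT p.2), mul_assoc, ← mul_assoc (_ ^ _), oneSubT_pow_mul_invOneSubT,
        one_mul]
    · simp [h]
    · change LaurentPoly.evalOne (_ * _) = 0
      obtain ⟨k, hk⟩ := Nat.exists_eq_succ_of_ne_zero (hne p h)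
      rw [hk, pow_succ, LaurentPoly.evalOne_mul, LaurentPoly.evalOne_mul,
        LaurentPoly.evalOne_oneSub, mul_zero, mul_zero]
    · refine ⟨j, ?_, fun p' hp' hpn' => ?_⟩
      · have := hne p (hn p hp hpn)
        simp only [← hpn, Pi.add_apply, Pi.single_eq_same]
        omega
      · exact Dvd.dvd.mul_left (dvd_pow_self _ (hne p' (hn p' hp' hpn'))) _

theorem coeff_fractionSum_sum {d : ℕ} (L : Multiset ((Fin r → ℤ) × (Fin r → ℕ)))
    (N : (Fin r → ℤ) × (Fin r → ℕ) → Fin r → ℕ) (q : (Fin r → ℤ) × (Fin r → ℕ) → LaurentPoly r)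
    (h : ∀ p ∈ L, ∑ i, N p i = d ∧
        (q p).toSeries * invOneSubT (N p) = HahnSeries.single p.1 1 * invOneSubT p.2)
    (ν : Fin r → ℤ) :
    (fractionSum d fun n => (L.map fun p => if N p = n then q p else 0).sum).coeff ν =
      sumCoeff L ν := by
  induction L using Multiset.induction_on with
  | empty => simp [fractionSum]
  | cons p L ih =>
    obtain ⟨h1, h2⟩ := h p (Multiset.mem_cons_self p L)
    rw [sumCoeff_cons, Nat.cast_add, ← ih fun p' hp' => h p' (Multiset.mem_cons_of_mem hp'),
      ← coeff_single_mul_invOneSubT, ← h2, ← HahnSeries.coeff_add]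
    congr 1
    simp only [fractionSum, Multiset.map_cons, Multiset.sum_cons, LaurentPoly.toSeries_add,
      add_mul, Finset.sum_add_distrib]
    congr 1
    rw [Finset.sum_eq_single (N p)]
    · rw [if_pos rfl]
    · intro n _ hn
      rw [if_neg hn.symm, LaurentPoly.toSeries_zero, zero_mul]
    · intro hn
      exact absurd (natCast_mem_weightIndices.2 h1) hn

/-- A sum of fractions with maximal total pole order `d` has a decomposition with all total pole
orders equal to `d`.  The value at `1` of a numerator counts the fractions with that pole. -/
theorem exists_numerators {L : Multiset ((Fin r → ℤ) × (Fin r → ℕ))} {d : ℕ}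
    (hd : ∀ p ∈ L, ∑ i, p.2 i ≤ d) (hmax : ∃ p ∈ L, ∑ i, p.2 i = d) :
    ∃ Q : (Fin r → ℕ) → LaurentPoly r,
      (∀ ν, (fractionSum d Q).coeff ν = sumCoeff L ν) ∧
      (∀ n, ∑ i, n i = d → (Q n).evalOne = (L.countP fun p => p.2 = n : ℕ)) ∧
      (∀ n, ∑ i, n i = d → Q n ≠ 0 → (Q n).evalOne = 0 →
        ∃ i, n i ≠ 0 ∧ LaurentPoly.oneSub i ∣ Q n) := by
  obtain ⟨N, q, h1, h2, h3, h4⟩ := exists_expanded_fractions hd hmax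
  have heval : ∀ n, ∑ i, n i = d →
      ((L.map fun p => if N p = n then q p else 0).sum).evalOne =
        (L.countP fun p => p.2 = n : ℕ) := fun n hn => by
    have key : ∀ L' ≤ L, ((L'.map fun p => if N p = n then q p else 0).sum).evalOne =
        (L'.countP fun p => p.2 = n : ℕ) := by
      intro L'
      induction L' using Multiset.induction_on with
      | empty => simp
      | cons p L' ih =>
        intro hle
        have hp := Multiset.mem_of_le hle (Multiset.mem_cons_self p L')
        rw [Multiset.map_cons, Multiset.sum_cons, LaurentPoly.evalOne_add,
          ih ((Multiset.le_cons_self L' p).trans hle), Multiset.countP_cons, Nat.cast_add,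
          add_comm]
        congr 1
        by_cases hpn : p.2 = n
        · obtain ⟨h5, h6⟩ := h2 p hp (hpn ▸ hn)
          rw [if_pos hpn, if_pos (h5.trans hpn), h6, Nat.cast_one]
        · rw [if_neg hpn, Nat.cast_zero]
          split_ifs with hNp
          · exact h3 p hp fun h => hpn (h.trans hNp)
          · exact LaurentPoly.evalOne_zero
    exact key L le_rfl
  refine ⟨fun n => (L.map fun p => if N p = n then q p else 0).sum,
    coeff_fractionSum_sum L N q h1, heval, fun n hn hQ hQ0 => ?_⟩
  rw [heval n hn, Nat.cast_eq_zero, Multiset.countP_eq_zero] at hQ0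
  obtain ⟨i, hi, hdvd⟩ := h4 n (fun p hp hpn h => hQ0 p hp (h.trans hpn)) <| by
    by_contra! hno
    refine hQ (Multiset.sum_eq_zero fun x hx => ?_)
    obtain ⟨p, hp, rfl⟩ := Multiset.mem_map.1 hx
    exact if_neg (hno p hp)
  refine ⟨i, hi, Multiset.dvd_sum fun x hx => ?_⟩
  obtain ⟨p, hp, rfl⟩ := Multiset.mem_map.1 hx
  split_ifs with hpn
  · exact hdvd p hp hpn
  · exact dvd_zero _

end Numerators

/-! ### Polynomials in the binomial basis -/

section Binomials

variable {r : ℕ}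

/-- `a` is the coefficient of `X^n` in `p`, and `p` has no other terms of total degree at least
`|n|`. -/
def HasLeadingTerm (p : MvPolynomial (Fin r) ℚ) (n : Fin r →₀ ℕ) (a : ℚ) : Prop :=
  ∀ m : Fin r →₀ ℕ, n.degree ≤ m.degree → p.coeff m = if m = n then a else 0

theorem HasLeadingTerm.mul {p q : MvPolynomial (Fin r) ℚ} {m n : Fin r →₀ ℕ} {a b : ℚ}
    (hp : HasLeadingTerm p m a) (hq : HasLeadingTerm q n b) :
    HasLeadingTerm (p * q) (m + n) (a * b) := by
  classical
  intro l hl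
  rw [map_add] at hl
  rw [MvPolynomial.coeff_mul]
  have hzero : ∀ x ∈ Finset.HasAntidiagonal.antidiagonal l, x ≠ (m, n) →
      p.coeff x.1 * q.coeff x.2 = 0 := by
    rintro ⟨x, y⟩ hxy hne
    rw [Finset.HasAntidiagonal.mem_antidiagonal] at hxy
    have hdeg : x.degree + y.degree = l.degree := by rw [← map_add, hxy]
    rcases le_or_gt m.degree x.degree with h | h
    · by_cases hx : x = m
      · have hy : y ≠ n := fun hy => hne (by rw [hx, hy])
        rw [hq y (by rw [hx] at hdeg; omega), if_neg hy, mul_zero]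
      · rw [hp x h, if_neg hx, zero_mul]
    · rw [hq y (by omega), if_neg, mul_zero]
      rintro rfl
      omega
  split_ifs with h
  · rw [Finset.sum_eq_single (m, n) hzero, hp m le_rfl, hq n le_rfl, if_pos rfl, if_pos rfl]
    intro hmn
    exact absurd (Finset.HasAntidiagonal.mem_antidiagonal.2 h.symm) hmn
  · refine Finset.sum_eq_zero fun x hx => hzero x hx ?_
    rintro rfl
    exact h (Finset.HasAntidiagonal.mem_antidiagonal.1 hx).symm

theorem hasLeadingTerm_C (a : ℚ) : HasLeadingTerm (r := r) (MvPolynomial.C a) 0 a := by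
  classical
  intro m _
  rw [MvPolynomial.coeff_C]
  simp only [eq_comm]

theorem hasLeadingTerm_X_add_C (i : Fin r) (a : ℚ) :
    HasLeadingTerm (MvPolynomial.X i + MvPolynomial.C a) (Finsupp.single i 1) 1 := by
  classical
  intro m hm
  rw [Finsupp.degree_single] at hm
  have : m ≠ 0 := by rintro rfl; simp at hm
  rw [MvPolynomial.coeff_add, MvPolynomial.coeff_C, if_neg this.symm, add_zero,
    MvPolynomial.coeff_X]
  simp only [eq_comm]

theorem HasLeadingTerm.prod {ι : Type*} (s : Finset ι) {p : ι → MvPolynomial (Fin r) ℚ}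
    {n : ι → Fin r →₀ ℕ} {a : ι → ℚ} (h : ∀ j ∈ s, HasLeadingTerm (p j) (n j) (a j)) :
    HasLeadingTerm (∏ j ∈ s, p j) (∑ j ∈ s, n j) (∏ j ∈ s, a j) := by
  classical
  induction s using Finset.induction_on with
  | empty => simpa using hasLeadingTerm_C (r := r) 1
  | insert j s hj ih =>
    rw [Finset.prod_insert hj, Finset.sum_insert hj, Finset.prod_insert hj]
    exact (h j (Finset.mem_insert_self j s)).mul
      (ih fun l hl => h l (Finset.mem_insert_of_mem hl))

theorem hasLeadingTerm_binomialPoly (n : Fin r → ℕ) :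
    HasLeadingTerm (binomialPoly n) (Finsupp.equivFunOnFinite.symm n)
      ((∏ i, (n i).factorial : ℕ) : ℚ)⁻¹ := by
  have h := HasLeadingTerm.prod (Finset.univ : Finset (Fin r)) fun i _ =>
    (hasLeadingTerm_C (r := r) (((n i).factorial : ℚ)⁻¹)).mul
      (HasLeadingTerm.prod (Finset.range (n i)) fun j _ =>
        hasLeadingTerm_X_add_C i ((j : ℚ) + 1))
  have h1 : ∑ i, (0 + ∑ _j ∈ Finset.range (n i), Finsupp.single i 1) =
      Finsupp.equivFunOnFinite.symm n := by
    simp only [zero_add, Finset.sum_const, Finset.card_range, Finsupp.smul_single, smul_eq_mul,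
      mul_one]
    ext j
    simp [Finsupp.finsetSum_apply, Finsupp.single_apply]
  have h2 : ∏ i, (((n i).factorial : ℚ)⁻¹ * ∏ _j ∈ Finset.range (n i), (1 : ℚ)) =
      ((∏ i, (n i).factorial : ℕ) : ℚ)⁻¹ := by
    simp
  rw [h1, h2] at h
  exact h

theorem binomialSum_add (e e' : (Fin r → ℕ) →₀ ℤ) :
    binomialSum (e + e') = binomialSum e + binomialSum e' :=
  Finsupp.sum_add_index' (by simp) (by simp [add_mul])

@[simp]
theorem binomialSum_zero : binomialSum (0 : (Fin r → ℕ) →₀ ℤ) = 0 := Finsupp.sum_zero_index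

theorem coeff_binomialSum {e : (Fin r → ℕ) →₀ ℤ} {m : Fin r →₀ ℕ}
    (h : ∀ n, e n ≠ 0 → ∑ i, n i ≤ ∑ i, m i) :
    (binomialSum e).coeff m = (e m : ℚ) / ((∏ i, (m i).factorial : ℕ) : ℚ) := by
  rw [binomialSum, Finsupp.sum, MvPolynomial.coeff_sum]
  simp only [MvPolynomial.coeff_C_mul]
  rw [Finset.sum_eq_single (m : Fin r → ℕ)]
  · rw [hasLeadingTerm_binomialPoly m m (by simp), if_pos (by ext; simp), div_eq_mul_inv]
  · intro n hn hnm
    rw [hasLeadingTerm_binomialPoly n m, if_neg, mul_zero]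
    · rintro rfl
      exact hnm (by ext; simp)
    · simpa [Finsupp.degree_eq_sum] using h n (Finsupp.mem_support_iff.1 hn)
  · intro hm
    rw [Finsupp.notMem_support_iff.1 hm, Int.cast_zero, zero_mul]

theorem exists_max_weight {e : (Fin r → ℕ) →₀ ℤ} (he : e ≠ 0) :
    ∃ n, e n ≠ 0 ∧ ∀ m, e m ≠ 0 → ∑ i, m i ≤ ∑ i, n i := by
  obtain ⟨n, hn, hmax⟩ := Finset.exists_max_image e.support (fun n => ∑ i, n i)
    (Finsupp.support_nonempty_iff.2 he)
  exact ⟨n, Finsupp.mem_support_iff.1 hn, fun m hm => hmax m (Finsupp.mem_support_iff.2 hm)⟩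

theorem binomialSum_injective :
    Function.Injective (binomialSum : ((Fin r → ℕ) →₀ ℤ) → MvPolynomial (Fin r) ℚ) := by
  have key : ∀ e : (Fin r → ℕ) →₀ ℤ, binomialSum e = 0 → e = 0 := fun e h => by
    by_contra he
    obtain ⟨n, hn, hmax⟩ := exists_max_weight he
    have := coeff_binomialSum (e := e) (m := Finsupp.equivFunOnFinite.symm n)
      (by simpa using hmax)
    rw [h, MvPolynomial.coeff_zero, eq_comm, div_eq_zero_iff] at this
    rcases this with h0 | h0
    · exact hn (by simpa using h0)
    · exact Finset.prod_ne_zero_iff.2 (fun i _ => Nat.factorial_ne_zero _) (by exact_mod_cast h0)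
  intro e e' h
  refine sub_eq_zero.1 (key _ ?_)
  have := binomialSum_add (e - e') e'
  rw [sub_add_cancel, h] at this
  simpa using this.symm

theorem totalDeg_binomialSum {e : (Fin r → ℕ) →₀ ℤ} {k : ℕ} (h : ∀ n, e n ≠ 0 → ∑ i, n i ≤ k)
    (h' : ∃ n, e n ≠ 0 ∧ ∑ i, n i = k) : totalDeg (binomialSum e) = k := by
  apply le_antisymm
  · refine Finset.sup_le fun m hm => ?_
    by_contra! hlt
    have hlt' : k < ∑ i, m i := by exact_mod_cast hlt
    refine MvPolynomial.mem_support_iff.1 hm ?_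
    rw [coeff_binomialSum fun n hn => (h n hn).trans hlt'.le]
    have : e m = 0 := by
      by_contra h0
      exact absurd (h _ h0) (not_le.2 hlt')
    simp [this]
  · obtain ⟨n, hn, hnk⟩ := h'
    have hmem : Finsupp.equivFunOnFinite.symm n ∈ (binomialSum e).support := by
      rw [MvPolynomial.mem_support_iff, coeff_binomialSum (by simpa [hnk] using h)]
      refine div_ne_zero (by simpa using hn) ?_
      exact Nat.cast_ne_zero.2 (Finset.prod_ne_zero_iff.2 fun i _ => Nat.factorial_ne_zero _)
    refine le_trans (le_of_eq ?_) (Finset.le_sup hmem)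
    simp [← hnk]

theorem eq_of_eval_eq {P P' : MvPolynomial (Fin r) ℚ} {c : Fin r → ℤ}
    (h : ∀ ν, c ≤ ν → MvPolynomial.eval (fun i => (ν i : ℚ)) P =
      MvPolynomial.eval (fun i => (ν i : ℚ)) P') : P = P' := by
  refine MvPolynomial.funext_set (fun i => ((↑) : ℤ → ℚ) '' Set.Ici (c i))
    (fun i => (Set.Ici_infinite (c i)).image Int.cast_injective.injOn) fun x hx => ?_
  choose ν hν hx' using fun i => hx i (Set.mem_univ i)
  obtain rfl : (fun i => (ν i : ℚ)) = x := funext hx'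
  exact h ν hν

/-! ### The Hilbert polynomial of a sum of fractions -/

theorem eval_binomialPoly (n ν : Fin r → ℕ) :
    MvPolynomial.eval (fun i => (ν i : ℚ)) (binomialPoly n) =
      ((∏ i, poleCoeff (n i + 1) (ν i) : ℕ) : ℚ) := by
  rw [binomialPoly, map_prod, Nat.cast_prod]
  refine Finset.prod_congr rfl fun i _ => ?_
  simp only [map_mul, map_prod, map_add, MvPolynomial.eval_C, MvPolynomial.eval_X]
  rw [poleCoeff_natCast, Nat.multichoose_eq, show n i + 1 + ν i - 1 = ν i + n i by omega,
    Nat.choose_symm_add, inv_mul_eq_iff_eq_mul₀ (by exact_mod_cast Nat.factorial_ne_zero _),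
    ← Nat.cast_mul, ← Nat.ascFactorial_eq_factorial_mul_choose, Nat.ascFactorial_eq_prod_range,
    Nat.cast_prod]
  refine Finset.prod_congr rfl fun j _ => ?_
  push_cast
  ring

/-- Far out, the coefficients of `t^c / (1 - t)^{n+1}` are integral combinations of those of the
`1 / (1 - t)^{m+1}` with `m ≤ n`, and `m = n` enters with coefficient `1`. -/
theorem exists_poleCoeff_sub_eq_sum (c : ℤ) (n : ℕ) : ∃ (a : ℕ → ℤ) (b : ℤ), a n = 1 ∧
    (∀ m, n < m → a m = 0) ∧ ∀ s, b ≤ s → (poleCoeff (n + 1) (s - c) : ℤ) =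
      ∑ m ∈ Finset.range (n + 1), a m * poleCoeff (m + 1) s := by
  have hone : ∀ s : ℤ, 0 ≤ s → poleCoeff 1 s = 1 := fun s hs => by simp [poleCoeff, hs]
  induction n with
  | zero =>
    refine ⟨fun m => if m = 0 then 1 else 0, max 0 c, rfl, fun m hm => if_neg hm.ne',
      fun s hs => ?_⟩
    have h1 := (le_max_left _ _).trans hs
    have h2 := (le_max_right _ _).trans hs
    simp [hone s h1, hone (s - c) (by omega)]
  | succ n ih =>
    obtain ⟨a, b, h1, h2, h3⟩ := ih
    -- Both sides have the same differences, so they differ by a constant.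
    set g : ℤ → ℤ := fun s => (poleCoeff (n + 2) (s - c) : ℤ) -
      ∑ m ∈ Finset.range (n + 1), a m * poleCoeff (m + 2) s with hg
    have hconst : ∀ s, max 0 b ≤ s → g s = g (max 0 b) := fun s hs => by
      induction s, hs using Int.leInduction with
      | base => rfl
      | succ s hs ih =>
        rw [← ih]
        have h4 := h3 (s + 1) (((le_max_right _ _).trans hs).trans (by omega))
        have h5 : (poleCoeff (n + 2) (s + 1 - c) : ℤ) =
            poleCoeff (n + 2) (s - c) + poleCoeff (n + 1) (s + 1 - c) := by
          rw [poleCoeff_succ (n + 1) (s + 1 - c), show s + 1 - c - 1 = s - c by ring]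
          push_cast
          rfl
        have h6 : ∑ m ∈ Finset.range (n + 1), a m * (poleCoeff (m + 2) (s + 1) : ℤ) =
            ∑ m ∈ Finset.range (n + 1), a m * (poleCoeff (m + 2) s : ℤ) +
              ∑ m ∈ Finset.range (n + 1), a m * (poleCoeff (m + 1) (s + 1) : ℤ) := by
          rw [← Finset.sum_add_distrib]
          refine Finset.sum_congr rfl fun m _ => ?_
          rw [poleCoeff_succ (m + 1) (s + 1), show s + 1 - 1 = s by ring]
          push_cast
          ring
        simp only [hg]
        rw [h5, h6, h4]
        ring
    refine ⟨fun m => Nat.casesOn m (g (max 0 b)) a, max 0 b, h1, fun m hm => ?_,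
      fun s hs => ?_⟩
    · cases m with
      | zero => omega
      | succ m => exact h2 m (by omega)
    · rw [Finset.sum_range_succ']
      have := hconst s hs
      simp only [hg] at this ⊢
      rw [hone s ((le_max_left _ _).trans hs), ← this]
      push_cast
      rw [mul_one]
      exact (add_sub_cancel _ _).symm

theorem exists_binomialSum_eq_fracCoeff (c : Fin r → ℤ) (n : Fin r → ℕ) :
    ∃ e : (Fin r → ℕ) →₀ ℤ, e n = 1 ∧ (∀ m, e m ≠ 0 → m ≤ n) ∧
      ∃ b : ℤ, ∀ ν : Fin r → ℤ, (∀ i, b ≤ ν i) →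
        MvPolynomial.eval (fun i => (ν i : ℚ)) (binomialSum e) = fracCoeff (c, n + 1) ν := by
  classical
  choose a b h1 h2 h3 using fun i => exists_poleCoeff_sub_eq_sum (c i) (n i)
  obtain ⟨B, hB⟩ := exists_forall_le_natCast b
  have hle : ∀ m : Fin r → ℕ, ∏ i, a i (m i) ≠ 0 → m ≤ n := fun m hm i => by
    by_contra! hlt
    exact hm (Finset.prod_eq_zero (Finset.mem_univ i) (h2 i _ hlt))
  refine ⟨Finsupp.onFinset (Fintype.piFinset fun i => Finset.range (n i + 1))
    (fun m => ∏ i, a i (m i)) fun m hm => Fintype.mem_piFinset.2 fun i =>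
      Finset.mem_range.2 (Nat.lt_succ_of_le (hle m hm i)), ?_, hle, B, fun ν hν => ?_⟩
  · simp [h1]
  · have hν0 : ∀ i, 0 ≤ ν i := fun i => le_trans (by positivity) (hν i)
    obtain ⟨ν, rfl⟩ : ∃ ν' : Fin r → ℕ, ν = fun i => (ν' i : ℤ) :=
      ⟨fun i => (ν i).toNat, funext fun i => (Int.toNat_of_nonneg (hν0 i)).symm⟩
    rw [binomialSum, Finsupp.onFinset_sum _ (by simp), map_sum]
    simp only [map_mul, MvPolynomial.eval_C, Int.cast_natCast, eval_binomialPoly]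
    have : (fracCoeff (c, n + 1) (fun i => (ν i : ℤ)) : ℤ) =
        ∏ i, ∑ m ∈ Finset.range (n i + 1), a i m * (poleCoeff (m + 1) (ν i) : ℤ) := by
      rw [fracCoeff, Nat.cast_prod]
      refine Finset.prod_congr rfl fun i _ => ?_
      rw [← h3 i (ν i) ((le_abs_self _).trans ((hB i).trans (hν i)))]
      rfl
    rw [← Int.cast_natCast (fracCoeff _ _), this, Finset.prod_univ_sum, Int.cast_sum]
    refine Finset.sum_congr rfl fun m _ => ?_
    rw [Finset.prod_mul_distrib]
    push_cast
    rfl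

/-- Far out, the coefficients of a sum of fractions are given by a polynomial.  Its terms of
highest weight count the fractions with poles in all variables. -/
theorem exists_binomialSum_eq_sumCoeff (L : Multiset ((Fin r → ℤ) × (Fin r → ℕ))) :
    ∃ e : (Fin r → ℕ) →₀ ℤ,
      (∃ b : ℤ, ∀ ν : Fin r → ℤ, (∀ i, b ≤ ν i) →
        MvPolynomial.eval (fun i => (ν i : ℚ)) (binomialSum e) = sumCoeff L ν) ∧
      ∀ k : ℕ, (∀ p ∈ L, (∀ i, p.2 i ≠ 0) → ∑ i, p.2 i ≤ k + r) → ∀ n : Fin r → ℕ,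
        k ≤ ∑ i, n i → e n = (L.countP fun p => p.2 = n + 1 : ℕ) := by
  induction L using Multiset.induction_on with
  | empty => exact ⟨0, ⟨0, by simp⟩, by simp⟩
  | cons p L ih =>
    obtain ⟨e, ⟨b, hb⟩, he⟩ := ih
    by_cases hp : ∀ i, p.2 i ≠ 0
    · obtain ⟨n, hn⟩ : ∃ n : Fin r → ℕ, p.2 = n + 1 :=
        ⟨fun i => p.2 i - 1, funext fun i =>
          (Nat.sub_add_cancel (Nat.one_le_iff_ne_zero.2 (hp i))).symm⟩
      obtain ⟨e', h1, h2, b', h3⟩ := exists_binomialSum_eq_fracCoeff p.1 n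
      refine ⟨e + e', ⟨max b b', fun ν hν => ?_⟩, fun k hk m hm => ?_⟩
      · rw [binomialSum_add, map_add, hb ν fun i => (le_max_left _ _).trans (hν i),
          h3 ν fun i => (le_max_right _ _).trans (hν i), sumCoeff_cons, ← hn]
        push_cast
        ring
      · rw [Finsupp.add_apply, he k (fun q hq => hk q (Multiset.mem_cons_of_mem hq)) m hm,
          Multiset.countP_cons, Nat.cast_add]
        congr 1
        have hnk := hk p (Multiset.mem_cons_self p L) hp
        simp only [hn, Pi.add_apply, Pi.one_apply, Finset.sum_add_distrib, Finset.sum_const,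
          Finset.card_univ, Fintype.card_fin, smul_eq_mul, mul_one] at hnk
        rw [hn]
        by_cases hmn : m = n
        · rw [hmn, h1, if_pos rfl, Nat.cast_one]
        · rw [if_neg fun h => hmn (add_right_cancel h).symm, Nat.cast_zero]
          by_contra h0
          have hle := h2 m h0
          refine hmn (funext fun i => ?_)
          exact (Finset.sum_eq_sum_iff_of_le fun i _ => hle i).1
            (le_antisymm (Finset.sum_le_sum fun i _ => hle i) (by omega)) i (Finset.mem_univ i)
    · push Not at hp
      obtain ⟨b', hb'⟩ := exists_sumCoeff_eq_zero_of_forall (L := {p}) (by simpa using hp)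
      refine ⟨e, ⟨max b b', fun ν hν => ?_⟩, fun k hk m hm => ?_⟩
      · have := hb' ν fun i => (le_max_right _ _).trans (hν i)
        rw [hb ν fun i => (le_max_left _ _).trans (hν i), ← Multiset.singleton_add,
          sumCoeff_add, this, zero_add]
      · rw [he k (fun q hq => hk q (Multiset.mem_cons_of_mem hq)) m hm, Multiset.countP_cons,
          if_neg, add_zero]
        intro h
        obtain ⟨i, hi⟩ := hp
        simp [h] at hi

end Binomials

/-! ### Graded modules, submodules and quotients -/

section Internal

theorem isInternal_of_sum_eq_zero {ι A M : Type*} [DecidableEq ι] [CommRing A] [AddCommGroup M]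
    [Module A M] {𝓜 : ι → Submodule A M} (h : iSup 𝓜 = ⊤)
    (h' : ∀ (s : Finset ι) (y : ι → M), (∀ i, y i ∈ 𝓜 i) → ∑ i ∈ s, y i = 0 → ∀ i ∈ s, y i = 0) :
    DirectSum.IsInternal 𝓜 := by
  classical
  refine ⟨?_, fun x => ?_⟩
  · rw [injective_iff_map_eq_zero]
    intro f hf
    have hf' : ∑ i ∈ DFinsupp.support f, (f i : M) = 0 := by
      rw [← hf]
      exact (DirectSum.coeLinearMap_eq_dfinsuppSum 𝓜 f).symm
    ext i
    by_cases hi : i ∈ DFinsupp.support f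
    · simpa using h' _ (fun i => (f i : M)) (fun i => (f i).2) hf' i hi
    · simpa using hi
  · have : x ∈ LinearMap.range (DirectSum.coeLinearMap 𝓜) := by
      rw [DirectSum.range_coeLinearMap, h]
      trivial
    exact this

end Internal

section GradedModules

variable {r : ℕ} {A B M : Type*} [CommRing A] [CommRing B] [Algebra A B]
  [AddCommGroup M] [Module A M] [Module B M]
  {𝓑 : (Fin r → ℕ) → Submodule A B} {𝓜 : (Fin r → ℤ) → Submodule A M}

namespace IsGradedModule

/-- The projection of a graded module to its part of degree `ν`. -/
def component (h : IsGradedModule 𝓑 𝓜) (ν : Fin r → ℤ) : M →ₗ[A] M :=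
  (𝓜 ν).subtype ∘ₗ DirectSum.component A _ _ ν ∘ₗ
    (LinearEquiv.ofBijective (DirectSum.coeLinearMap 𝓜) h.isInternal).symm.toLinearMap

theorem component_mem (h : IsGradedModule 𝓑 𝓜) (ν : Fin r → ℤ) (x : M) :
    h.component ν x ∈ 𝓜 ν :=
  Subtype.prop ((DirectSum.component A _ _ ν ∘ₗ
    (LinearEquiv.ofBijective (DirectSum.coeLinearMap 𝓜) h.isInternal).symm.toLinearMap) x)

theorem component_of_mem (h : IsGradedModule 𝓑 𝓜) {ν : Fin r → ℤ} {x : M} (hx : x ∈ 𝓜 ν) :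
    h.component ν x = x :=
  congrArg Subtype.val (DirectSum.IsInternal.ofBijective_coeLinearMap_of_mem h.isInternal hx)

theorem component_of_mem_ne (h : IsGradedModule 𝓑 𝓜) {μ ν : Fin r → ℤ} (hne : μ ≠ ν) {x : M}
    (hx : x ∈ 𝓜 μ) : h.component ν x = 0 :=
  congrArg Subtype.val
    (DirectSum.IsInternal.ofBijective_coeLinearMap_of_mem_ne h.isInternal hne hx)

theorem iSup_eq_top (h : IsGradedModule 𝓑 𝓜) : iSup 𝓜 = ⊤ :=
  h.isInternal.submodule_iSup_eq_top

@[elab_as_elim]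
theorem induction (h : IsGradedModule 𝓑 𝓜) {motive : M → Prop} (x : M)
    (mem : ∀ ν, ∀ x ∈ 𝓜 ν, motive x) (zero : motive 0)
    (add : ∀ x y, motive x → motive y → motive (x + y)) : motive x :=
  Submodule.iSup_induction 𝓜 (motive := motive) (h.iSup_eq_top ▸ Submodule.mem_top) mem zero add

theorem exists_eq_sum (h : IsGradedModule 𝓑 𝓜) (x : M) :
    ∃ s : Finset (Fin r → ℤ), x = ∑ ν ∈ s, h.component ν x := by
  classical
  set f := (LinearEquiv.ofBijective (DirectSum.coeLinearMap 𝓜) h.isInternal).symm x with hf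
  refine ⟨DFinsupp.support f, ?_⟩
  have : DirectSum.coeLinearMap 𝓜 f = x :=
    (LinearEquiv.ofBijective (DirectSum.coeLinearMap 𝓜) h.isInternal).apply_symm_apply x
  rw [DirectSum.coeLinearMap_eq_dfinsuppSum] at this
  exact this.symm.trans rfl

theorem sum_component (h : IsGradedModule 𝓑 𝓜) {s : Finset (Fin r → ℤ)}
    {y : (Fin r → ℤ) → M} (hy : ∀ ν, y ν ∈ 𝓜 ν) {ν : Fin r → ℤ} (hν : ν ∈ s) :
    h.component ν (∑ κ ∈ s, y κ) = y ν := by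
  rw [map_sum, Finset.sum_eq_single ν (fun κ _ hκ => h.component_of_mem_ne hκ (hy κ))
    (fun hν' => absurd hν hν'), h.component_of_mem (hy ν)]

theorem component_smul (h : IsGradedModule 𝓑 𝓜) {μ : Fin r → ℕ} {b : B} (hb : b ∈ 𝓑 μ)
    (ν : Fin r → ℤ) (x : M) :
    h.component ((fun i => (μ i : ℤ)) + ν) (b • x) = b • h.component ν x := by
  induction x using h.induction with
  | mem κ x hx =>
    have hbx := h.smul_mem μ κ b x hb hx
    by_cases hκ : κ = ν
    · subst hκ
      rw [h.component_of_mem hx, h.component_of_mem hbx]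
    · rw [h.component_of_mem_ne hκ hx, h.component_of_mem_ne (fun h' => hκ (add_left_cancel h'))
        hbx, smul_zero]
  | zero => simp
  | add x y hx hy => rw [smul_add, map_add, hx, hy, map_add, smul_add]

theorem component_smul' (h : IsGradedModule 𝓑 𝓜) {μ : Fin r → ℕ} {b : B} (hb : b ∈ 𝓑 μ)
    (ν : Fin r → ℤ) (x : M) :
    h.component ν (b • x) = b • h.component (ν - fun i => (μ i : ℤ)) x := by
  rw [← h.component_smul hb, add_sub_cancel]

theorem component_smul_of_mem [GradedAlgebra 𝓑] (h : IsGradedModule 𝓑 𝓜) {κ : Fin r → ℤ} {x : M}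
    (hx : x ∈ 𝓜 κ) (b : B) (μ : Fin r → ℕ) :
    h.component ((fun i => (μ i : ℤ)) + κ) (b • x) = (DirectSum.decompose 𝓑 b μ : B) • x := by
  classical
  induction b using DirectSum.Decomposition.inductionOn 𝓑 with
  | zero => simp
  | @homogeneous ρ b =>
    have hbx := h.smul_mem ρ κ b x b.2 hx
    by_cases hρ : ρ = μ
    · subst hρ
      rw [h.component_of_mem hbx, DirectSum.decompose_of_mem_same 𝓑 b.2]
    · rw [h.component_of_mem_ne _ hbx, DirectSum.decompose_of_mem_ne 𝓑 b.2 hρ, zero_smul]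
      intro h'
      refine hρ (funext fun i => ?_)
      have := congrFun (add_right_cancel h') i
      exact_mod_cast this
  | add b b' hb hb' =>
    rw [add_smul, map_add, hb, hb', DirectSum.decompose_add, DirectSum.add_apply,
      Submodule.coe_add, add_smul]

theorem component_smul_eq_zero [GradedAlgebra 𝓑] (h : IsGradedModule 𝓑 𝓜) {κ ν : Fin r → ℤ}
    {x : M} (hx : x ∈ 𝓜 κ) (b : B) (hν : ¬ κ ≤ ν) : h.component ν (b • x) = 0 := by
  classical
  induction b using DirectSum.Decomposition.inductionOn 𝓑 with
  | zero => simp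
  | @homogeneous ρ b =>
    refine h.component_of_mem_ne (fun h' => hν fun i => ?_) (h.smul_mem ρ κ b x b.2 hx)
    rw [← h']
    simp
  | add b b' hb hb' => rw [add_smul, map_add, hb, hb', add_zero]

/-- A submodule is graded if it contains the homogeneous components of its elements. -/
def IsGradedSubmodule (h : IsGradedModule 𝓑 𝓜) (N : Submodule B M) : Prop :=
  ∀ (ν : Fin r → ℤ), ∀ x ∈ N, h.component ν x ∈ N

theorem isGradedSubmodule_torsionBy (h : IsGradedModule 𝓑 𝓜) {y : B} {μ : Fin r → ℕ}
    (hy : y ∈ 𝓑 μ) : h.IsGradedSubmodule (Submodule.torsionBy B M y) := by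
  intro ν x hx
  rw [Submodule.mem_torsionBy_iff] at hx ⊢
  rw [← h.component_smul hy, hx, map_zero]

open scoped Pointwise in
theorem isGradedSubmodule_smul_top (h : IsGradedModule 𝓑 𝓜) {y : B} {μ : Fin r → ℕ}
    (hy : y ∈ 𝓑 μ) : h.IsGradedSubmodule (y • (⊤ : Submodule B M)) := by
  intro ν x hx
  obtain ⟨z, -, rfl⟩ := (Submodule.mem_smul_pointwise_iff_exists _ _ _).1 hx
  rw [h.component_smul' hy]
  exact Submodule.smul_mem_pointwise_smul _ _ _ Submodule.mem_top

theorem smul_component_eq_zero [GradedAlgebra 𝓑] (h : IsGradedModule 𝓑 𝓜) {I : Ideal B}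
    (hI : I.IsHomogeneous 𝓑) {x : M} (hx : ∀ b ∈ I, b • x = 0) (ν : Fin r → ℤ) :
    ∀ b ∈ I, b • h.component ν x = 0 := by
  classical
  intro b hb
  rw [← DirectSum.sum_support_decompose 𝓑 b, Finset.sum_smul]
  refine Finset.sum_eq_zero fun μ _ => ?_
  rw [← h.component_smul (SetLike.coe_mem _), hx _ (hI μ hb), map_zero]

theorem isHomogeneous_annihilator [GradedAlgebra 𝓑] (h : IsGradedModule 𝓑 𝓜) :
    (Module.annihilator B M).IsHomogeneous 𝓑 := by
  intro μ b hb
  rw [Module.mem_annihilator] at hb ⊢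
  intro x
  induction x using h.induction with
  | mem κ x hx => rw [← h.component_smul_of_mem hx, hb, map_zero]
  | zero => exact smul_zero _
  | add x y hx hy => rw [smul_add, hx, hy, add_zero]

/-! ### Homogeneous generators -/

theorem exists_generators [Module.Finite B M] (h : IsGradedModule 𝓑 𝓜) :
    ∃ (G : Finset M) (δ : M → Fin r → ℤ), (∀ g ∈ G, g ∈ 𝓜 (δ g)) ∧
      Submodule.span B (G : Set M) = ⊤ := by
  have htop : Submodule.span B {x : M | ∃ ν, x ∈ 𝓜 ν} = ⊤ := by
    refine eq_top_iff.2 fun x _ => ?_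
    induction x using h.induction with
    | mem κ x hx => exact Submodule.subset_span ⟨κ, hx⟩
    | zero => exact Submodule.zero_mem _
    | add x y hx hy => exact Submodule.add_mem _ (hx trivial) (hy trivial)
  have hfg : (Submodule.span B {x : M | ∃ ν, x ∈ 𝓜 ν}).FG := htop ▸ Module.Finite.fg_top
  obtain ⟨G, hG, hspan⟩ := (Submodule.fg_span_iff_fg_span_finset_subset _).1 hfg
  choose! δ hδ using fun x (hx : x ∈ {x : M | ∃ ν, x ∈ 𝓜 ν}) => hx
  exact ⟨G, δ, fun g hg => hδ g (hG hg), hspan ▸ htop⟩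

theorem exists_eq_sum_smul [GradedAlgebra 𝓑] (h : IsGradedModule 𝓑 𝓜) {G : Finset M}
    {δ : M → Fin r → ℤ} (hδ : ∀ g ∈ G, g ∈ 𝓜 (δ g)) (hG : Submodule.span B (G : Set M) = ⊤)
    {ν : Fin r → ℤ} {x : M} (hx : x ∈ 𝓜 ν) :
    ∃ b : M → B, x = ∑ g ∈ G, b g • g ∧ ∀ g ∈ G,
      b g = 0 ∨ ∃ μ : Fin r → ℕ, b g ∈ 𝓑 μ ∧ (fun i => (μ i : ℤ)) + δ g = ν := by
  classical
  have hxG : x ∈ Submodule.span B (G : Set M) := hG ▸ Submodule.mem_top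
  obtain ⟨b, -, hb⟩ := Submodule.mem_span_finset.1 hxG
  refine ⟨fun g => if δ g ≤ ν then
    DirectSum.decompose 𝓑 (b g) (fun i => (ν i - δ g i).toNat) else 0, ?_, fun g _ => ?_⟩
  · conv_lhs => rw [← h.component_of_mem hx, ← hb, map_sum]
    refine Finset.sum_congr rfl fun g hg => ?_
    dsimp only
    split_ifs with hle
    · rw [← h.component_smul_of_mem (hδ g hg)]
      congr 1
      congr 1
      ext i
      have : δ g i ≤ ν i := hle i
      simp only [Pi.add_apply]
      omega
    · rw [h.component_smul_eq_zero (hδ g hg) _ hle, zero_smul]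
  · dsimp only
    split_ifs with hle
    · refine Or.inr ⟨_, SetLike.coe_mem _, funext fun i => ?_⟩
      have : δ g i ≤ ν i := hle i
      simp only [Pi.add_apply]
      omega
    · exact Or.inl rfl

theorem exists_eq_bot [GradedAlgebra 𝓑] [Module.Finite B M] (h : IsGradedModule 𝓑 𝓜) :
    ∃ c : ℤ, ∀ (ν : Fin r → ℤ) (i : Fin r), ν i < c → 𝓜 ν = ⊥ := by
  obtain ⟨G, δ, hδ, hG⟩ := h.exists_generators
  obtain ⟨E, hE⟩ : ∃ E : ℕ, ∀ g ∈ G, ∀ i, |δ g i| ≤ E := by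
    choose D hD using fun g => exists_forall_le_natCast (δ g)
    refine ⟨G.sup D, fun j hj i => (hD j i).trans ?_⟩
    exact_mod_cast Finset.le_sup hj
  refine ⟨-E, fun ν i hi => (Submodule.eq_bot_iff _).2 fun x hx => ?_⟩
  obtain ⟨b, hb, hb'⟩ := h.exists_eq_sum_smul hδ hG hx
  rw [hb]
  refine Finset.sum_eq_zero fun g hg => ?_
  rcases hb' g hg with h0 | ⟨μ, -, hμ⟩
  · rw [h0, zero_smul]
  · have h1 := congrFun hμ i
    have h2 := abs_le.1 (hE g hg i)
    simp only [Pi.add_apply] at h1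
    omega

end IsGradedModule

/-! ### Induced gradings and lengths -/

variable [IsScalarTower A B M]

/-- The grading induced on a submodule `N`: the part of degree `ν` is `N ∩ [M]_ν`. -/
def subGrading (N : Submodule B M) (𝓜 : (Fin r → ℤ) → Submodule A M) :
    (Fin r → ℤ) → Submodule A N :=
  fun ν => (𝓜 ν).comap (N.subtype.restrictScalars A)

theorem mem_quotientGrading {N : Submodule B M} {ν : Fin r → ℤ} {x : M ⧸ N} :
    x ∈ quotientGrading N 𝓜 ν ↔ ∃ y ∈ 𝓜 ν, N.mkQ y = x := Submodule.mem_map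

theorem length_eq_length_subGrading_add (N : Submodule B M) (ν : Fin r → ℤ) :
    Module.length A (𝓜 ν) =
      Module.length A (subGrading N 𝓜 ν) + Module.length A (quotientGrading N 𝓜 ν) := by
  refine Module.length_eq_add_of_exact
    (LinearMap.restrict (N.subtype.restrictScalars A) (p := subGrading N 𝓜 ν) (q := 𝓜 ν)
      fun x hx => hx)
    (LinearMap.restrict (N.mkQ.restrictScalars A) (p := 𝓜 ν) (q := quotientGrading N 𝓜 ν)
      fun x hx => Submodule.mem_map_of_mem hx) ?_ ?_ ?_
  · intro x y hxy
    exact Subtype.ext (Subtype.ext (congrArg (fun z : 𝓜 ν => (z : M)) hxy))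
  · rintro ⟨x, hx⟩
    obtain ⟨y, hy, rfl⟩ := mem_quotientGrading.1 hx
    exact ⟨⟨y, hy⟩, rfl⟩
  · rintro ⟨x, hx⟩
    rw [Subtype.ext_iff]
    constructor
    · intro h0
      exact ⟨⟨⟨x, (Submodule.Quotient.mk_eq_zero N).1 h0⟩, hx⟩, rfl⟩
    · rintro ⟨⟨⟨y, hyN⟩, hy⟩, hyx⟩
      have : y = x := congrArg Subtype.val hyx
      subst this
      exact (Submodule.Quotient.mk_eq_zero N).2 hyN

namespace IsGradedModule

theorem sub (h : IsGradedModule 𝓑 𝓜) {N : Submodule B M} (hN : h.IsGradedSubmodule N) :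
    IsGradedModule 𝓑 (subGrading N 𝓜) where
  isInternal := by
    refine isInternal_of_sum_eq_zero (eq_top_iff.2 fun x _ => ?_) fun s y hy h0 ν hν => ?_
    · obtain ⟨s, hs⟩ := h.exists_eq_sum (x : M)
      have : x = ∑ ν ∈ s, (⟨h.component ν x, hN ν x x.2⟩ : N) :=
        Subtype.ext (by rw [AddSubmonoidClass.coe_finsetSum]; exact hs)
      rw [this]
      exact Submodule.sum_mem _ fun ν _ => Submodule.mem_iSup_of_mem ν (h.component_mem ν x)
    · have h1 : ∑ ν ∈ s, ((y ν : N) : M) = 0 := by simpa using congrArg Subtype.val h0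
      have h2 := h.sum_component (y := fun ν => (y ν : M)) hy hν
      rw [h1, map_zero] at h2
      exact Subtype.ext h2.symm
  smul_mem μ ν b x hb hx := h.smul_mem μ ν b x hb hx

theorem quotient (h : IsGradedModule 𝓑 𝓜) {N : Submodule B M} (hN : h.IsGradedSubmodule N) :
    IsGradedModule 𝓑 (quotientGrading N 𝓜) where
  isInternal := by
    refine isInternal_of_sum_eq_zero (eq_top_iff.2 fun x _ => ?_) fun s y hy h0 ν hν => ?_
    · obtain ⟨x, rfl⟩ := N.mkQ_surjective x
      obtain ⟨s, hs⟩ := h.exists_eq_sum x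
      rw [hs, map_sum]
      exact Submodule.sum_mem _ fun ν _ => Submodule.mem_iSup_of_mem ν
        (mem_quotientGrading.2 ⟨_, h.component_mem ν x, rfl⟩)
    · choose z hz hzy using fun ν => mem_quotientGrading.1 (hy ν)
      have h1 : ∑ ν ∈ s, z ν ∈ N := by
        rw [← Submodule.ker_mkQ N, LinearMap.mem_ker, map_sum, ← h0]
        exact Finset.sum_congr rfl fun ν _ => hzy ν
      have h2 := hN ν _ h1
      rw [h.sum_component hz hν] at h2
      rw [← hzy ν]
      exact (Submodule.Quotient.mk_eq_zero N).2 h2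
  smul_mem μ ν b x hb hx := by
    obtain ⟨y, hy, rfl⟩ := mem_quotientGrading.1 hx
    exact mem_quotientGrading.2 ⟨b • y, h.smul_mem μ ν b y hb hy, map_smul _ _ _⟩

open scoped Pointwise in
theorem length_eq_add_of_isSMulRegular (h : IsGradedModule 𝓑 𝓜) {y : B} {μ : Fin r → ℕ}
    (hy : y ∈ 𝓑 μ) (hreg : IsSMulRegular M y) (ν : Fin r → ℤ) :
    Module.length A (𝓜 ν) = Module.length A (𝓜 (ν - fun i => (μ i : ℤ))) +
      Module.length A (quotientGrading (y • (⊤ : Submodule B M)) 𝓜 ν) := by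
  refine Module.length_eq_add_of_exact
    (LinearMap.restrict ((LinearMap.lsmul B M y).restrictScalars A)
      (p := 𝓜 (ν - fun i => (μ i : ℤ))) (q := 𝓜 ν) fun x hx => by
        simpa using h.smul_mem μ _ y x hy hx)
    (LinearMap.restrict ((y • (⊤ : Submodule B M)).mkQ.restrictScalars A) (p := 𝓜 ν)
      (q := quotientGrading _ 𝓜 ν) fun x hx => Submodule.mem_map_of_mem hx) ?_ ?_ ?_
  · intro x z hxz
    exact Subtype.ext (hreg (congrArg Subtype.val hxz))
  · rintro ⟨x, hx⟩
    obtain ⟨z, hz, rfl⟩ := mem_quotientGrading.1 hx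
    exact ⟨⟨z, hz⟩, rfl⟩
  · rintro ⟨x, hx⟩
    rw [Subtype.ext_iff]
    constructor
    · intro h0
      have h1 : x ∈ y • (⊤ : Submodule B M) := (Submodule.Quotient.mk_eq_zero _).1 h0
      obtain ⟨z, -, rfl⟩ := (Submodule.mem_smul_pointwise_iff_exists _ _ _).1 h1
      refine ⟨⟨h.component _ z, h.component_mem _ z⟩, Subtype.ext ?_⟩
      change y • h.component _ z = y • z
      rw [← h.component_smul' hy, h.component_of_mem hx]
    · rintro ⟨⟨z, hz⟩, hzx⟩
      have : y • z = x := congrArg Subtype.val hzx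
      subst this
      exact (Submodule.Quotient.mk_eq_zero _).2
        (Submodule.smul_mem_pointwise_smul _ _ _ Submodule.mem_top)

end IsGradedModule

end GradedModules

/-! ### Dévissage along homogeneous elements -/

section Devissage

universe u

variable {r : ℕ} {A B : Type*} [CommRing A] [CommRing B] [Algebra A B] [IsNoetherianRing B]
  {𝓑 : (Fin r → ℕ) → Submodule A B}

open scoped Pointwise in
/-- Induction principle for finitely generated graded modules.  Every such module is obtained by
extensions from modules killed by a given finite set `S` of homogeneous elements, by passing from
`M / yM` to `M` for `y ∈ S` a nonzerodivisor on `M`. -/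
theorem devissage [GradedAlgebra 𝓑]
    {motive : ∀ (M : Type u) [AddCommGroup M] [Module A M] [Module B M],
      ((Fin r → ℤ) → Submodule A M) → Prop}
    (S : Finset B) (hS : ∀ y ∈ S, ∃ μ, y ∈ 𝓑 μ)
    (ext : ∀ (M : Type u) [AddCommGroup M] [Module A M] [Module B M] [IsScalarTower A B M]
      [Module.Finite B M] (𝓜 : (Fin r → ℤ) → Submodule A M) (h : IsGradedModule 𝓑 𝓜)
      (N : Submodule B M), h.IsGradedSubmodule N → motive N (subGrading N 𝓜) →
        motive (M ⧸ N) (quotientGrading N 𝓜) → motive M 𝓜)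
    (killed : ∀ (M : Type u) [AddCommGroup M] [Module A M] [Module B M] [IsScalarTower A B M]
      [Module.Finite B M] (𝓜 : (Fin r → ℤ) → Submodule A M), IsGradedModule 𝓑 𝓜 →
        (∀ y ∈ S, ∀ x : M, y • x = 0) → motive M 𝓜)
    (regular : ∀ (M : Type u) [AddCommGroup M] [Module A M] [Module B M] [IsScalarTower A B M]
      [Module.Finite B M] (𝓜 : (Fin r → ℤ) → Submodule A M), IsGradedModule 𝓑 𝓜 →
        ∀ y ∈ S, IsSMulRegular M y →
          motive (M ⧸ (y • (⊤ : Submodule B M))) (quotientGrading (y • (⊤ : Submodule B M)) 𝓜) →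
            motive M 𝓜)
    (M : Type u) [AddCommGroup M] [Module A M] [Module B M] [IsScalarTower A B M]
    [Module.Finite B M] (𝓜 : (Fin r → ℤ) → Submodule A M) (h : IsGradedModule 𝓑 𝓜) :
    motive M 𝓜 := by
  classical
  suffices H : ∀ T : Finset B, T ⊆ S → ∀ (M : Type u) [AddCommGroup M] [Module A M] [Module B M]
      [IsScalarTower A B M] [Module.Finite B M] (𝓜 : (Fin r → ℤ) → Submodule A M),
      IsGradedModule 𝓑 𝓜 → (∀ y ∈ S, y ∉ T → ∀ x : M, y • x = 0) → motive M 𝓜 from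
    H S le_rfl M 𝓜 h fun y hy hy' => absurd hy hy'
  intro T
  induction T using Finset.induction_on with
  | empty =>
    intro _ M _ _ _ _ _ 𝓜 h hM
    exact killed M 𝓜 h fun y hy => hM y hy (Finset.notMem_empty y)
  | insert y T _ ih =>
    intro hT M _ _ _ _ _ 𝓜 h hM
    have hyS : y ∈ S := hT (Finset.mem_insert_self y T)
    have hTS : T ⊆ S := (Finset.subset_insert y T).trans hT
    obtain ⟨μ, hμ⟩ := hS y hyS
    -- Modules killed by a power of `y` are handled by the filtration by the kernels of powers.
    have hpow : ∀ (n : ℕ) (M : Type u) [AddCommGroup M] [Module A M] [Module B M]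
        [IsScalarTower A B M] [Module.Finite B M] (𝓜 : (Fin r → ℤ) → Submodule A M),
        IsGradedModule 𝓑 𝓜 → (∀ y' ∈ S, y' ∉ insert y T → ∀ x : M, y' • x = 0) →
        (∀ x : M, y ^ n • x = 0) → motive M 𝓜 := by
      intro n
      induction n with
      | zero =>
        intro M _ _ _ _ _ 𝓜 h _ h0
        refine killed M 𝓜 h fun y _ x => ?_
        have hx : x = 0 := by simpa using h0 x
        rw [hx, smul_zero]
      | succ n ihn =>
        intro M _ _ _ _ _ 𝓜 h hM hn
        have hgr := h.isGradedSubmodule_torsionBy hμ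
        refine ext M 𝓜 h (Submodule.torsionBy B M y) hgr ?_ ?_
        · refine ih hTS _ _ (h.sub hgr) fun y' hy' hy'T x => ?_
          by_cases hyy : y' = y
          · subst hyy
            exact Subtype.ext x.2
          · exact Subtype.ext (hM y' hy' (by simp [hyy, hy'T]) x)
        · refine ihn _ _ (h.quotient hgr) (fun y' hy' hy'T x => ?_) fun x => ?_
          · obtain ⟨x, rfl⟩ := Submodule.mkQ_surjective _ x
            rw [← map_smul, hM y' hy' hy'T, map_zero]
          · obtain ⟨x, rfl⟩ := Submodule.mkQ_surjective _ x
            rw [← map_smul]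
            refine (Submodule.Quotient.mk_eq_zero _).2 ?_
            rw [Submodule.mem_torsionBy_iff, smul_smul, ← pow_succ']
            exact hn x
    -- The kernels of the powers of `y` become stationary.
    obtain ⟨n, hn⟩ := monotone_stabilizes_iff_noetherian.2
      (inferInstance : IsNoetherian B M)
      ⟨fun n => Submodule.torsionBy B M (y ^ n), fun m n hmn x hx => by
        rw [Submodule.mem_torsionBy_iff] at hx ⊢
        obtain ⟨k, rfl⟩ := Nat.exists_eq_add_of_le hmn
        rw [pow_add, mul_comm, mul_smul, hx, smul_zero]⟩
    have hn1 : Submodule.torsionBy B M (y ^ n) = Submodule.torsionBy B M (y ^ (n + 1)) :=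
      hn (n + 1) (Nat.le_succ n)
    have hyn : y ^ n ∈ 𝓑 (n • μ) := SetLike.pow_mem_graded n hμ
    have hgr := h.isGradedSubmodule_torsionBy hyn
    refine ext M 𝓜 h (Submodule.torsionBy B M (y ^ n)) hgr ?_ ?_
    · exact hpow n _ _ (h.sub hgr) (fun y' hy' hy'T x => Subtype.ext (hM y' hy' hy'T x))
        fun x => Subtype.ext x.2
    · have hq := h.quotient hgr
      refine regular _ _ hq y hyS ?_ ?_
      · rw [isSMulRegular_iff_right_eq_zero_of_smul]
        intro x hx
        obtain ⟨x, rfl⟩ := Submodule.mkQ_surjective _ x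
        rw [← map_smul] at hx
        have hx' := (Submodule.Quotient.mk_eq_zero _).1 hx
        rw [Submodule.mem_torsionBy_iff, smul_smul, ← pow_succ, ← Submodule.mem_torsionBy_iff,
          ← hn1] at hx'
        exact (Submodule.Quotient.mk_eq_zero _).2 hx'
      · refine ih hTS _ _ (hq.quotient (hq.isGradedSubmodule_smul_top hμ))
          fun y' hy' hy'T x => ?_
        obtain ⟨x, rfl⟩ := Submodule.mkQ_surjective _ x
        rw [← map_smul]
        by_cases hyy : y' = y
        · subst hyy
          exact (Submodule.Quotient.mk_eq_zero _).2
            (Submodule.smul_mem_pointwise_smul _ _ _ Submodule.mem_top)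
        · obtain ⟨x, rfl⟩ := Submodule.mkQ_surjective _ x
          rw [← map_smul, hM y' hy' (by simp [hyy, hy'T]), map_zero, map_zero]

end Devissage

/-! ### Hilbert functions of modules over standard algebras -/

section Standard

variable {r : ℕ} {A B : Type*} [CommRing A] [CommRing B] [Algebra A B]
  {𝓑 : (Fin r → ℕ) → Submodule A B}

theorem IsStandard.isNoetherianRing [IsNoetherianRing A] (h𝓑 : IsStandard 𝓑) :
    IsNoetherianRing B := by
  obtain ⟨s, -, hs⟩ := h𝓑.generated
  have : Algebra.FiniteType A B := ⟨⟨s, hs⟩⟩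
  exact Algebra.FiniteType.isNoetherianRing A B

theorem sumCoeff_replicate (k : ℕ) (p : (Fin r → ℤ) × (Fin r → ℕ)) (ν : Fin r → ℤ) :
    sumCoeff (Multiset.replicate k p) ν = k * fracCoeff p ν := by
  simp [sumCoeff]

theorem sumCoeff_sum {ι : Type*} (s : Finset ι)
    (L : ι → Multiset ((Fin r → ℤ) × (Fin r → ℕ))) (ν : Fin r → ℤ) :
    sumCoeff (∑ j ∈ s, L j) ν = ∑ j ∈ s, sumCoeff (L j) ν := by
  classical
  induction s using Finset.induction_on with
  | empty => simp
  | insert j s hj ih => rw [Finset.sum_insert hj, sumCoeff_add, ih, Finset.sum_insert hj]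

variable (B) in
/-- The Hilbert series of `M` is a finite sum of fractions `t^c / (1 - t)^n` with
`|n| ≤ dim M`. -/
def HasFractionSum {M : Type*} [AddCommGroup M] [Module A M] [Module B M]
    (𝓜 : (Fin r → ℤ) → Submodule A M) : Prop :=
  ∃ L : Multiset ((Fin r → ℤ) × (Fin r → ℕ)),
    (∀ ν, Module.length A (𝓜 ν) = sumCoeff L ν) ∧
    ∀ p ∈ L, ((∑ i, p.2 i : ℕ) : WithBot ℕ∞) ≤ Module.supportDim B M

/-- A graded module killed by the generators of `B` is a finite module over `A`, and its Hilbert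
function has finite support. -/
theorem hasFractionSum_of_killed [IsArtinianRing A] {s : Finset B}
    (hs : Algebra.adjoin A (s : Set B) = ⊤) {M : Type*} [AddCommGroup M] [Module A M] [Module B M]
    [IsScalarTower A B M] [Module.Finite B M] {𝓜 : (Fin r → ℤ) → Submodule A M}
    (h : IsGradedModule 𝓑 𝓜) (hM : ∀ y ∈ s, ∀ x : M, y • x = 0) :
    HasFractionSum B 𝓜 := by
  classical
  have hact : ∀ b : B, ∃ a : A, ∀ x : M, b • x = a • x := fun b => by
    have hb : b ∈ Algebra.adjoin A (s : Set B) := hs ▸ Algebra.mem_top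
    induction hb using Algebra.adjoin_induction with
    | mem y hy => exact ⟨0, fun x => by rw [hM y hy, zero_smul]⟩
    | algebraMap a => exact ⟨a, fun x => algebraMap_smul B a x⟩
    | add b b' _ _ hb hb' =>
      obtain ⟨a, ha⟩ := hb
      obtain ⟨a', ha'⟩ := hb'
      exact ⟨a + a', fun x => by rw [add_smul, ha, ha', add_smul]⟩
    | mul b b' _ _ hb hb' =>
      obtain ⟨a, ha⟩ := hb
      obtain ⟨a', ha'⟩ := hb'
      exact ⟨a * a', fun x => by rw [mul_smul, ha', ha, mul_smul]⟩
  have hfin : Module.Finite A M := by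
    obtain ⟨G, hG⟩ := (Module.Finite.fg_top : (⊤ : Submodule B M).FG)
    refine ⟨⟨G, eq_top_iff.2 fun x _ => ?_⟩⟩
    have hx : x ∈ Submodule.span B (G : Set M) := hG ▸ Submodule.mem_top
    induction hx using Submodule.span_induction with
    | mem x hx => exact Submodule.subset_span hx
    | zero => exact Submodule.zero_mem _
    | add x y _ _ hx hy => exact Submodule.add_mem _ (hx trivial) (hy trivial)
    | smul b x _ hx =>
      obtain ⟨a, ha⟩ := hact b
      rw [ha]
      exact Submodule.smul_mem _ a (hx trivial)
  have hF : {ν | 𝓜 ν ≠ ⊥}.Finite :=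
    WellFoundedGT.finite_ne_bot_of_iSupIndep h.isInternal.submodule_iSupIndep
  refine ⟨∑ ν ∈ hF.toFinset, Multiset.replicate (Module.length A (𝓜 ν)).toNat (ν, 0),
    fun ν => ?_, fun p hp => ?_⟩
  · rw [sumCoeff_sum]
    simp only [sumCoeff_replicate, fracCoeff_zero, mul_ite, mul_one, mul_zero]
    rw [Finset.sum_ite_eq]
    split_ifs with hν
    · exact (ENat.natCast_toNat Module.length_ne_top).symm
    · rw [Set.Finite.mem_toFinset, Set.mem_ofPred_eq, not_not] at hν
      rw [hν]
      exact Module.length_bot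
  · obtain ⟨ν, hν, hp⟩ := Multiset.mem_sum.1 hp
    obtain rfl := Multiset.eq_of_mem_replicate hp
    have : Nontrivial M := by
      rw [Set.Finite.mem_toFinset, Set.mem_ofPred_eq, Submodule.ne_bot_iff] at hν
      obtain ⟨x, -, hx⟩ := hν
      exact ⟨x, 0, hx⟩
    have hne := Module.supportDim_ne_bot_of_nontrivial B M
    rw [Module.supportDim, Order.krullDim_ne_bot_iff] at hne
    simpa [Module.supportDim] using Order.krullDim_nonneg

theorem coe_single_one (i : Fin r) :
    (fun j => ((Pi.single i 1 : Fin r → ℕ) j : ℤ)) = Pi.single i 1 := by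
  ext j
  by_cases hj : j = i
  · subst hj
    simp
  · simp [Pi.single_eq_of_ne hj]

theorem eq_of_differences {f g : (Fin r → ℤ) → ℕ∞} {h : (Fin r → ℤ) → ℕ∞} (i : Fin r)
    (hf : ∀ ν, f ν = f (ν - Pi.single i 1) + h ν) (hg : ∀ ν, g ν = g (ν - Pi.single i 1) + h ν)
    {c : ℤ} (hc : ∀ ν, ν i < c → f ν = g ν) : f = g := by
  have key : ∀ (n : ℕ) (ν : Fin r → ℤ), ν i < c + n → f ν = g ν := by
    intro n
    induction n with
    | zero => intro ν hν; exact hc ν (by simpa using hν)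
    | succ n ih =>
      intro ν hν
      rw [hf, hg, ih]
      simp only [Pi.sub_apply, Pi.single_eq_same]
      push_cast at hν
      omega
  exact funext fun ν => key (ν i + 1 - c).toNat ν (by omega)

theorem HasFractionSum.extension {M : Type*} [AddCommGroup M] [Module A M] [Module B M]
    [IsScalarTower A B M] {𝓜 : (Fin r → ℤ) → Submodule A M} {N : Submodule B M}
    (hN : HasFractionSum B (subGrading N 𝓜)) (hQ : HasFractionSum B (quotientGrading N 𝓜)) :
    HasFractionSum B 𝓜 := by
  obtain ⟨L, h1, h2⟩ := hN
  obtain ⟨L', h1', h2'⟩ := hQ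
  refine ⟨L + L', fun ν => ?_, fun p hp => ?_⟩
  · rw [length_eq_length_subGrading_add N, h1, h1', sumCoeff_add, Nat.cast_add]
  · rcases Multiset.mem_add.1 hp with hp | hp
    · exact (h2 p hp).trans (Module.supportDim_le_of_injective _ N.subtype_injective)
    · exact (h2' p hp).trans (Module.supportDim_le_of_surjective _ N.mkQ_surjective)

open scoped Pointwise in
/-- For a nonzerodivisor `y` of degree `e_i`, the Hilbert series of `M` is that of `M / yM` divided
by `1 - t_i`, and `dim M ≥ dim (M / yM) + 1`. -/
theorem HasFractionSum.of_isSMulRegular [GradedAlgebra 𝓑] [IsNoetherianRing B]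
    {M : Type*} [AddCommGroup M] [Module A M] [Module B M] [IsScalarTower A B M]
    [Module.Finite B M] {𝓜 : (Fin r → ℤ) → Submodule A M} (h : IsGradedModule 𝓑 𝓜) {y : B}
    {i : Fin r} (hi : y ∈ 𝓑 (Pi.single i 1)) (hreg : IsSMulRegular M y)
    (hQ : HasFractionSum B (quotientGrading (y • (⊤ : Submodule B M)) 𝓜)) :
    HasFractionSum B 𝓜 := by
  obtain ⟨L, h1, h2⟩ := hQ
  refine ⟨L.map fun p => (p.1, p.2 + Pi.single i 1), fun ν => ?_, fun p hp => ?_⟩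
  · obtain ⟨c, hc⟩ := h.exists_eq_bot
    obtain ⟨c', hc'⟩ := exists_sumCoeff_eq_zero (L.map fun p => (p.1, p.2 + Pi.single i 1))
    refine congrFun (eq_of_differences (f := fun ν => Module.length A (𝓜 ν))
      (g := fun ν => (sumCoeff (L.map fun p => (p.1, p.2 + Pi.single i 1)) ν : ℕ∞))
      (h := fun ν => (sumCoeff L ν : ℕ∞)) i (fun ν => ?_) (fun ν => ?_) (c := min c c')
      fun ν hν => ?_) ν
    · rw [← h1, ← coe_single_one]
      exact h.length_eq_add_of_isSMulRegular hi hreg ν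
    · exact_mod_cast sumCoeff_map_add_single L i ν
    · rw [hc ν i (hν.trans_le (min_le_left _ _)), hc' ν i (hν.trans_le (min_le_right _ _))]
      exact Module.length_bot
  · obtain ⟨q, hq, rfl⟩ := Multiset.mem_map.1 hp
    have hsum : ∑ j, (q.2 + Pi.single i 1 : Fin r → ℕ) j = ∑ j, q.2 j + 1 := by
      simp [Finset.sum_add_distrib]
    rw [hsum, Nat.cast_add, Nat.cast_one]
    refine (add_le_add_left (h2 q hq) 1).trans ?_
    exact Module.supportDim_quotSMulTop_succ_le_of_notMem_minimalPrimes
      fun _ => hreg.notMem_of_mem_minimalPrimes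

/-- The Hilbert series of a finitely generated graded module is a finite sum of fractions
`t^c / (1 - t)^n` with `|n| ≤ dim M`. -/
theorem IsGradedModule.hasFractionSum [IsArtinianRing A] [GradedAlgebra 𝓑]
    (h𝓑 : IsStandard 𝓑) {M : Type*} [AddCommGroup M] [Module A M] [Module B M]
    [IsScalarTower A B M] [Module.Finite B M] {𝓜 : (Fin r → ℤ) → Submodule A M}
    (h : IsGradedModule 𝓑 𝓜) : HasFractionSum B 𝓜 := by
  have := h𝓑.isNoetherianRing
  obtain ⟨s, hs1, hs⟩ := h𝓑.generated
  exact @devissage r A B _ _ _ _ 𝓑 _ (fun M _ _ _ 𝓜 => HasFractionSum B 𝓜) s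
    (fun y hy => ⟨_, (hs1 y hy).choose_spec⟩)
    (fun M _ _ _ _ _ 𝓜 _ N _ hN hQ => hN.extension hQ)
    (fun M _ _ _ _ _ 𝓜 h hM => hasFractionSum_of_killed hs h hM)
    (fun M _ _ _ _ _ 𝓜 h y hy hreg hQ =>
      hQ.of_isSMulRegular h (hs1 y hy).choose_spec hreg) M _ _ _ _ _ 𝓜 h

/-! ### Products of homogeneous parts and the irrelevant ideal -/

theorem IsStandard.le_mul [GradedAlgebra 𝓑] (h𝓑 : IsStandard 𝓑) (μ ρ : Fin r → ℕ) :
    𝓑 (μ + ρ) ≤ 𝓑 μ * 𝓑 ρ := by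
  classical
  obtain ⟨s, hs1, hs⟩ := h𝓑.generated
  have hmon : ∀ m ∈ Submonoid.closure (s : Set B), ∃ κ, m ∈ 𝓑 κ ∧
      ∀ μ ρ, κ = μ + ρ → m ∈ 𝓑 μ * 𝓑 ρ := fun m hm => by
    induction hm using Submonoid.closure_induction_left with
    | one =>
      refine ⟨0, SetLike.one_mem_graded 𝓑, fun μ ρ h => ?_⟩
      have h0 : ∀ i, 0 = μ i + ρ i := fun i => congrFun h i
      have hμ : μ = 0 := funext fun i => by simpa using (Nat.add_eq_zero_iff.1 (h0 i).symm).1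
      have hρ : ρ = 0 := funext fun i => by simpa using (Nat.add_eq_zero_iff.1 (h0 i).symm).2
      subst hμ hρ
      simpa using Submodule.mul_mem_mul (SetLike.one_mem_graded 𝓑) (SetLike.one_mem_graded 𝓑)
    | mul_left x hx m _ ih =>
      obtain ⟨κ, hm, hκ⟩ := ih
      obtain ⟨i, hi⟩ := hs1 x hx
      refine ⟨Pi.single i 1 + κ, SetLike.mul_mem_graded hi hm, fun μ ρ h => ?_⟩
      have hcancel : ∀ μ : Fin r → ℕ, μ i ≠ 0 → ∃ μ' : Fin r → ℕ,
          μ = Pi.single i 1 + μ' := fun μ hμ => by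
        suffices hle : (Pi.single i 1 : Fin r → ℕ) ≤ μ from
          ⟨μ - Pi.single i 1, (add_tsub_cancel_of_le hle).symm⟩
        intro j
        rcases eq_or_ne j i with rfl | hj
        · simpa using Nat.one_le_iff_ne_zero.2 hμ
        · simp [Pi.single_eq_of_ne hj]
      by_cases hμ : μ i = 0
      · have hρ : ρ i ≠ 0 := by
          have := congrFun h i
          simp only [Pi.add_apply, Pi.single_eq_same] at this
          omega
        obtain ⟨ρ', rfl⟩ := hcancel ρ hρ
        have h' : κ = μ + ρ' := by
          rw [add_left_comm] at h
          exact add_left_cancel h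
        rw [mul_comm x m]
        have hle : 𝓑 μ * 𝓑 ρ' * 𝓑 (Pi.single i 1) ≤ 𝓑 μ * 𝓑 (Pi.single i 1 + ρ') := by
          rw [mul_assoc, mul_comm (𝓑 ρ')]
          exact mul_le_mul' le_rfl (Submodule.mul_le.2 fun a ha b hb =>
            SetLike.mul_mem_graded ha hb)
        exact hle (Submodule.mul_mem_mul (hκ μ ρ' h') hi)
      · obtain ⟨μ', rfl⟩ := hcancel μ hμ
        have h' : κ = μ' + ρ := by
          rw [add_assoc] at h
          exact add_left_cancel h
        have hle : 𝓑 (Pi.single i 1) * (𝓑 μ' * 𝓑 ρ) ≤ 𝓑 (Pi.single i 1 + μ') * 𝓑 ρ := by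
          rw [← mul_assoc]
          exact mul_le_mul' (Submodule.mul_le.2 fun a ha b hb =>
            SetLike.mul_mem_graded ha hb) le_rfl
        exact hle (Submodule.mul_mem_mul hi (hκ μ' ρ h'))
  intro b hb
  have hspan : b ∈ Submodule.span A (Submonoid.closure (s : Set B) : Set B) := by
    rw [← Algebra.adjoin_eq_span, hs]
    trivial
  have key : ∀ b ∈ Submodule.span A (Submonoid.closure (s : Set B) : Set B),
      (DirectSum.decompose 𝓑 b (μ + ρ) : B) ∈ 𝓑 μ * 𝓑 ρ := fun b hb => by
    induction hb using Submodule.span_induction with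
    | mem m hm =>
      obtain ⟨κ, hm, hκ⟩ := hmon m hm
      by_cases h : κ = μ + ρ
      · subst h
        rw [DirectSum.decompose_of_mem_same 𝓑 hm]
        exact hκ μ ρ rfl
      · rw [DirectSum.decompose_of_mem_ne 𝓑 hm h]
        exact Submodule.zero_mem _
    | zero => simp
    | add x y _ _ hx hy =>
      rw [DirectSum.decompose_add, DirectSum.add_apply, Submodule.coe_add]
      exact Submodule.add_mem _ hx hy
    | smul a x _ hx =>
      rw [DirectSum.decompose_smul, DirectSum.smul_apply, Submodule.coe_smul]
      exact Submodule.smul_mem _ a hx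
  rw [← DirectSum.decompose_of_mem_same 𝓑 hb]
  exact key b hspan

theorem IsStandard.irrelevantIdeal_eq [GradedAlgebra 𝓑] (h𝓑 : IsStandard 𝓑) :
    irrelevantIdeal 𝓑 = Ideal.span (𝓑 1 : Set B) := by
  apply le_antisymm
  · refine Ideal.span_le.2 ?_
    rintro b ⟨ν, hν, hb⟩
    have h1 : 𝓑 1 * 𝓑 (ν - 1) ≤ (Ideal.span (𝓑 1 : Set B)).restrictScalars A :=
      Submodule.mul_le.2 fun x hx y _ => Ideal.mul_mem_right _ _ (Ideal.subset_span hx)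
    have h2 : (1 : Fin r → ℕ) + (ν - 1) = ν := add_tsub_cancel_of_le fun i => hν i
    rw [← h2] at hb
    exact h1 (h𝓑.le_mul _ _ hb)
  · exact Ideal.span_mono fun b hb => ⟨1, fun i => Nat.one_pos, hb⟩

theorem IsStandard.mem_irrelevantIdeal_pow [GradedAlgebra 𝓑] (h𝓑 : IsStandard 𝓑) (k : ℕ)
    {μ : Fin r → ℕ} (hμ : ∀ i, k ≤ μ i) {b : B} (hb : b ∈ 𝓑 μ) : b ∈ irrelevantIdeal 𝓑 ^ k := by
  induction k generalizing μ b with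
  | zero => simp
  | succ k ih =>
    have h1 : 𝓑 1 * 𝓑 (μ - 1) ≤ (irrelevantIdeal 𝓑 ^ (k + 1)).restrictScalars A := by
      refine Submodule.mul_le.2 fun x hx y hy => ?_
      rw [pow_succ', Submodule.restrictScalars_mem]
      refine Ideal.mul_mem_mul ?_ (ih (fun i => ?_) hy)
      · rw [h𝓑.irrelevantIdeal_eq]
        exact Ideal.subset_span hx
      · have := hμ i
        simp only [Pi.sub_apply, Pi.one_apply]
        omega
    have h2 : (1 : Fin r → ℕ) + (μ - 1) = μ := add_tsub_cancel_of_le fun i => by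
      have := hμ i
      simp only [Pi.one_apply]
      omega
    rw [← h2] at hb
    exact h1 (h𝓑.le_mul _ _ hb)

theorem IsStandard.exists_generators_irrelevantIdeal [GradedAlgebra 𝓑] [IsNoetherianRing A]
    (h𝓑 : IsStandard 𝓑) :
    ∃ S : Finset B, (∀ y ∈ S, y ∈ 𝓑 1) ∧ Ideal.span (S : Set B) = irrelevantIdeal 𝓑 := by
  have := h𝓑.isNoetherianRing
  have hfg : (Submodule.span B (𝓑 1 : Set B)).FG := IsNoetherian.noetherian _
  obtain ⟨S, hS, hspan⟩ := (Submodule.fg_span_iff_fg_span_finset_subset _).1 hfg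
  exact ⟨S, fun y hy => hS hy, hspan.symm.trans h𝓑.irrelevantIdeal_eq.symm⟩

theorem isHomogeneous_irrelevantIdeal [GradedAlgebra 𝓑] :
    (irrelevantIdeal 𝓑).IsHomogeneous 𝓑 :=
  Ideal.homogeneous_span 𝓑 _ fun _ ⟨ν, _, hb⟩ => ⟨ν, hb⟩

theorem isHomogeneous_irrelevantIdeal_pow [GradedAlgebra 𝓑] (k : ℕ) :
    (irrelevantIdeal 𝓑 ^ k).IsHomogeneous 𝓑 := by
  induction k with
  | zero => rw [pow_zero, Ideal.one_eq_top]; exact Ideal.IsHomogeneous.top 𝓑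
  | succ k ih => rw [pow_succ]; exact ih.mul isHomogeneous_irrelevantIdeal

/-- A finitely generated graded module which is killed by a power of the irrelevant ideal vanishes
in all large degrees. -/
theorem IsGradedModule.exists_eq_bot_of_killed [GradedAlgebra 𝓑] (h𝓑 : IsStandard 𝓑)
    {M : Type*} [AddCommGroup M] [Module A M] [Module B M]
    [Module.Finite B M] {𝓜 : (Fin r → ℤ) → Submodule A M} (h : IsGradedModule 𝓑 𝓜) {k : ℕ}
    (hk : ∀ b ∈ irrelevantIdeal 𝓑 ^ k, ∀ x : M, b • x = 0) :
    ∃ c : ℤ, ∀ ν : Fin r → ℤ, (∀ i, c ≤ ν i) → 𝓜 ν = ⊥ := by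
  obtain ⟨G, δ, hδ, hG⟩ := h.exists_generators
  obtain ⟨E, hE⟩ : ∃ E : ℕ, ∀ g ∈ G, ∀ i, |δ g i| ≤ E := by
    choose D hD using fun g => exists_forall_le_natCast (δ g)
    refine ⟨G.sup D, fun j hj i => (hD j i).trans ?_⟩
    exact_mod_cast Finset.le_sup hj
  refine ⟨E + k, fun ν hν => (Submodule.eq_bot_iff _).2 fun x hx => ?_⟩
  obtain ⟨b, hb, hb'⟩ := h.exists_eq_sum_smul hδ hG hx
  rw [hb]
  refine Finset.sum_eq_zero fun g hg => ?_
  rcases hb' g hg with h0 | ⟨μ, hbμ, hμ⟩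
  · rw [h0, zero_smul]
  · refine hk _ (h𝓑.mem_irrelevantIdeal_pow k (fun i => ?_) hbμ) g
    have h1 := congrFun hμ i
    have h2 := abs_le.1 (hE g hg i)
    have h3 := hν i
    simp only [Pi.add_apply] at h1
    omega

end Standard

/-! ### Chains of primes and growth of lengths -/

section Growth

theorem add_pow_succ_le (a m k : ℕ) :
    (a + m) ^ (k + 1) ≤ a ^ (k + 1) + m * (k + 1) * (a + m) ^ k := by
  induction k with
  | zero => simp
  | succ k ih =>
    calc (a + m) ^ (k + 2) = (a + m) ^ (k + 1) * a + (a + m) ^ (k + 1) * m := by ring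
      _ ≤ (a ^ (k + 1) + m * (k + 1) * (a + m) ^ k) * a + (a + m) ^ (k + 1) * m := by gcongr
      _ ≤ a ^ (k + 2) + m * (k + 1) * ((a + m) ^ k * (a + m)) + (a + m) ^ (k + 1) * m := by
          rw [add_mul, ← pow_succ, mul_assoc (m * (k + 1))]
          gcongr
          exact Nat.le_add_right a m
      _ = a ^ (k + 2) + m * (k + 1 + 1) * (a + m) ^ (k + 1) := by ring

/-- A function whose differences over steps of size `m + 1` grow at least like `n^k` grows at least
like `n^(k + 1)`. -/
theorem pow_succ_le_of_differences {f g : ℕ → ℕ∞} {C k m : ℕ}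
    (hg : ∀ n : ℕ, (((n + 1) ^ k : ℕ) : ℕ∞) ≤ C * g n) (hgf : ∀ n, g n ≤ f n)
    (hf : ∀ n, f n + g (n + (m + 1)) ≤ f (n + (m + 1))) (n : ℕ) :
    (((n + 1) ^ (k + 1) : ℕ) : ℕ∞) ≤ ((m + 1) * (k + 1) * C : ℕ) * f n := by
  induction n using Nat.strong_induction_on with
  | _ n ih =>
    rcases lt_or_ge n (m + 1) with hn | hn
    · calc (((n + 1) ^ (k + 1) : ℕ) : ℕ∞) ≤ (((m + 1) * (k + 1) * (n + 1) ^ k : ℕ) : ℕ∞) := by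
            refine Nat.cast_le.2 ?_
            rw [pow_succ, mul_comm]
            exact Nat.mul_le_mul_right _ (by nlinarith)
        _ = ((m + 1) * (k + 1) : ℕ) * (((n + 1) ^ k : ℕ) : ℕ∞) := Nat.cast_mul _ _
        _ ≤ ((m + 1) * (k + 1) : ℕ) * (C * f n) := by
            gcongr
            exact (hg n).trans (by gcongr; exact hgf n)
        _ = _ := by rw [← mul_assoc, ← Nat.cast_mul]
    · obtain ⟨a, rfl⟩ := Nat.exists_eq_add_of_le' hn
      have h1 := add_pow_succ_le (a + 1) (m + 1) k
      rw [show a + 1 + (m + 1) = a + (m + 1) + 1 by ring] at h1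
      calc (((a + (m + 1) + 1) ^ (k + 1) : ℕ) : ℕ∞)
          ≤ (((a + 1) ^ (k + 1) + (m + 1) * (k + 1) * (a + (m + 1) + 1) ^ k : ℕ) : ℕ∞) :=
            Nat.cast_le.2 h1
        _ = (((a + 1) ^ (k + 1) : ℕ) : ℕ∞) +
            ((m + 1) * (k + 1) : ℕ) * (((a + (m + 1) + 1) ^ k : ℕ) : ℕ∞) := by
            rw [Nat.cast_add, Nat.cast_mul ((m + 1) * (k + 1))]
        _ ≤ ((m + 1) * (k + 1) * C : ℕ) * f a +
            ((m + 1) * (k + 1) : ℕ) * (C * g (a + (m + 1))) := by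
            gcongr
            · exact ih a (by omega)
            · exact hg _
        _ = ((m + 1) * (k + 1) * C : ℕ) * (f a + g (a + (m + 1))) := by
            rw [mul_add (((m + 1) * (k + 1) * C : ℕ) : ℕ∞), ← mul_assoc, ← Nat.cast_mul]
        _ ≤ _ := by
            gcongr
            exact hf a

variable {A B : Type*} [CommRing A] [CommRing B] [Algebra A B]

/-- The image of an `A`-submodule of `B` in the residue ring of an ideal. -/
def residueImage (p : Ideal B) (V : Submodule A B) : Submodule A (B ⧸ p) :=
  V.map (Ideal.Quotient.mkₐ A p).toLinearMap

theorem mem_residueImage {p : Ideal B} {V : Submodule A B} {x : B ⧸ p} :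
    x ∈ residueImage p V ↔ ∃ y ∈ V, Ideal.Quotient.mk p y = x := Submodule.mem_map

theorem length_residueImage_le {p q : Ideal B} (hpq : p ≤ q) (V : Submodule A B) :
    Module.length A (residueImage q V) ≤ Module.length A (residueImage p V) := by
  refine Module.length_le_of_surjective
    (LinearMap.restrict (Ideal.Quotient.factorₐ A hpq).toLinearMap (p := residueImage p V)
      (q := residueImage q V) ?_) ?_
  · intro x hx
    obtain ⟨y, hy, rfl⟩ := mem_residueImage.1 hx
    exact mem_residueImage.2 ⟨y, hy, rfl⟩
  · rintro ⟨x, hx⟩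
    obtain ⟨y, hy, rfl⟩ := mem_residueImage.1 hx
    exact ⟨⟨_, mem_residueImage.2 ⟨y, hy, rfl⟩⟩, rfl⟩

/-- Multiplication by `x ∈ q` embeds `V` modulo the prime `p` into the kernel of the map from `V'`
modulo `p` to `V'` modulo `q`. -/
theorem length_residueImage_add_le {p q : Ideal B} [p.IsPrime] (hpq : p ≤ q)
    {V V' : Submodule A B} {x : B} (hxq : x ∈ q) (hxp : x ∉ p) (hx : ∀ y ∈ V, x * y ∈ V') :
    Module.length A (residueImage p V) + Module.length A (residueImage q V') ≤
      Module.length A (residueImage p V') := by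
  have hmaps : ∀ z ∈ residueImage p V', (Ideal.Quotient.factorₐ A hpq).toLinearMap z ∈
      residueImage q V' := fun z hz => by
    obtain ⟨y, hy, rfl⟩ := mem_residueImage.1 hz
    exact mem_residueImage.2 ⟨y, hy, rfl⟩
  set φ := LinearMap.restrict (Ideal.Quotient.factorₐ A hpq).toLinearMap hmaps with hφ
  have hsurj : Function.Surjective φ := by
    rintro ⟨z, hz⟩
    obtain ⟨y, hy, rfl⟩ := mem_residueImage.1 hz
    exact ⟨⟨_, mem_residueImage.2 ⟨y, hy, rfl⟩⟩, rfl⟩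
  have hexact : Function.Exact (LinearMap.ker φ).subtype φ := fun z =>
    ⟨fun hz => ⟨⟨z, hz⟩, rfl⟩, fun ⟨w, hw⟩ => hw ▸ w.2⟩
  have hlength : Module.length A (residueImage p V') =
      Module.length A (LinearMap.ker φ) + Module.length A (residueImage q V') :=
    Module.length_eq_add_of_exact (M := residueImage p V') (N := LinearMap.ker φ)
      (P := residueImage q V') (LinearMap.ker φ).subtype φ
      (LinearMap.ker φ).subtype_injective hsurj hexact
  rw [hlength]
  gcongr
  have hmul : ∀ z ∈ residueImage p V,
      LinearMap.mulLeft A (Ideal.Quotient.mk p x) z ∈ residueImage p V' := fun z hz => by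
    obtain ⟨y, hy, rfl⟩ := mem_residueImage.1 hz
    exact mem_residueImage.2 ⟨x * y, hx y hy, map_mul _ _ _⟩
  refine Module.length_le_of_injective (LinearMap.codRestrict (LinearMap.ker φ)
    (LinearMap.restrict (LinearMap.mulLeft A (Ideal.Quotient.mk p x)) hmul) ?_) ?_
  · rintro ⟨z, hz⟩
    obtain ⟨y, hy, rfl⟩ := mem_residueImage.1 hz
    rw [LinearMap.mem_ker]
    refine Subtype.ext ?_
    change Ideal.Quotient.mk q (x * y) = 0
    exact Ideal.Quotient.eq_zero_iff_mem.2 (Ideal.mul_mem_right _ _ hxq)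
  · intro z w hzw
    have h1 : Ideal.Quotient.mk p x * (z : B ⧸ p) = Ideal.Quotient.mk p x * (w : B ⧸ p) :=
      congrArg (fun u : LinearMap.ker φ => ((u : residueImage p V') : B ⧸ p)) hzw
    have h2 : Ideal.Quotient.mk p x ≠ 0 := fun h0 => hxp (Ideal.Quotient.eq_zero_iff_mem.1 h0)
    exact Subtype.ext (mul_left_cancel₀ h2 h1)

/-- If a multiplicative sequence of submodules `U_n` separates the members of a chain of primes of
length `k`, then the lengths of the images of the `U_n` modulo the smallest prime grow at least
like `n^k`: multiplication by an element `x ∈ U_m` of the second prime outside of the first one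
shows that these lengths increase in each step of size `m` by the corresponding length modulo the
second prime. -/
theorem exists_pow_le_mul_length {U : ℕ → Submodule A B}
    (hU : ∀ m n, ∀ x ∈ U m, ∀ y ∈ U n, x * y ∈ U (m + n)) (k : ℕ) (p : ℕ → PrimeSpectrum B)
    (hp : ∀ i ≤ k, ∀ n, ∃ u ∈ U n, u ∉ (p i).asIdeal)
    (hlt : ∀ i < k, p i ≤ p (i + 1) ∧
      ∃ m, ∃ x ∈ U (m + 1), x ∈ (p (i + 1)).asIdeal ∧ x ∉ (p i).asIdeal) :
    ∃ C : ℕ, ∀ n : ℕ, (((n + 1) ^ k : ℕ) : ℕ∞) ≤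
      C * Module.length A (residueImage (p 0).asIdeal (U n)) := by
  induction k generalizing p with
  | zero =>
    refine ⟨1, fun n => ?_⟩
    obtain ⟨u, hu, hup⟩ := hp 0 le_rfl n
    have : Nontrivial (residueImage (p 0).asIdeal (U n)) :=
      ⟨⟨_, mem_residueImage.2 ⟨u, hu, rfl⟩⟩, 0, fun h0 =>
        hup (Ideal.Quotient.eq_zero_iff_mem.1 (congrArg Subtype.val h0))⟩
    rw [pow_zero, Nat.cast_one, one_mul]
    exact Order.one_le_iff_pos.2 Module.length_pos
  | succ k ih =>
    obtain ⟨C, hC⟩ := ih (fun i => p (i + 1)) (fun i hi n => hp (i + 1) (by omega) n)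
      fun i hi => hlt (i + 1) (by omega)
    obtain ⟨hle, m, x, hxU, hxq, hxp⟩ := hlt 0 (by omega)
    exact ⟨_, pow_succ_le_of_differences hC (fun n => length_residueImage_le hle (U n))
      fun n => length_residueImage_add_le hle hxq hxp fun y hy => by
        rw [add_comm]
        exact hU _ _ x hxU y hy⟩

theorem length_le_of_ker_le {N P Q : Type*} [AddCommGroup N] [AddCommGroup P] [AddCommGroup Q]
    [Module A N] [Module A P] [Module A Q] (φ : N →ₗ[A] P) (ψ : N →ₗ[A] Q)
    (h : LinearMap.ker φ ≤ LinearMap.ker ψ) :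
    Module.length A (LinearMap.range ψ) ≤ Module.length A P := by
  calc Module.length A (LinearMap.range ψ) = Module.length A (N ⧸ LinearMap.ker ψ) :=
        ψ.quotKerEquivRange.symm.length_eq
    _ ≤ Module.length A (N ⧸ LinearMap.ker φ) :=
        Module.length_le_of_surjective (Submodule.factor h) (Submodule.factor_surjective h)
    _ = Module.length A (LinearMap.range φ) := φ.quotKerEquivRange.length_eq
    _ ≤ Module.length A P :=
        Module.length_le_of_injective _ (LinearMap.range φ).subtype_injective

theorem length_biSup_le {ι N : Type*} [AddCommGroup N] [Module A N] (s : Finset ι)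
    (V : ι → Submodule A N) :
    Module.length A (⨆ j ∈ s, V j : Submodule A N) ≤ ∑ j ∈ s, Module.length A (V j) := by
  classical
  induction s using Finset.induction_on with
  | empty =>
    have : (⨆ j ∈ (∅ : Finset ι), V j) = ⊥ := by simp
    rw [this, Module.length_bot]
    exact bot_le
  | insert i s hi ih =>
    rw [Finset.iSup_insert, Finset.sum_insert hi]
    refine le_trans ?_ (add_le_add le_rfl ih)
    rw [← Module.length_prod]
    refine Module.length_le_of_surjective
      (LinearMap.codRestrict (V i ⊔ ⨆ j ∈ s, V j)
        ((V i).subtype.coprod (⨆ j ∈ s, V j).subtype) fun x =>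
          Submodule.add_mem_sup x.1.2 x.2.2) ?_
    rintro ⟨x, hx⟩
    obtain ⟨y, hy, z, hz, rfl⟩ := Submodule.mem_sup.1 hx
    exact ⟨(⟨y, hy⟩, ⟨z, hz⟩), Subtype.ext rfl⟩

end Growth

section Dimension

variable {r : ℕ} {A B M : Type*} [CommRing A] [CommRing B] [Algebra A B]
  {𝓑 : (Fin r → ℕ) → Submodule A B}
  [AddCommGroup M] [Module A M] [Module B M] [IsScalarTower A B M]
  {𝓜 : (Fin r → ℤ) → Submodule A M}

/-- An element of `[B]_μ` that kills the generators of `M` lies in the annihilator, hence in `p`, so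
that `[B]_μ` modulo `p` is a subquotient of the sum of the corresponding parts of `M`. -/
theorem IsGradedModule.length_residueImage_le (h : IsGradedModule 𝓑 𝓜) {G : Finset M}
    {δ : M → Fin r → ℤ} (hδ : ∀ g ∈ G, g ∈ 𝓜 (δ g)) (hG : Submodule.span B (G : Set M) = ⊤)
    {p : Ideal B} (hp : Module.annihilator B M ≤ p) (μ : Fin r → ℕ) :
    Module.length A (residueImage p (𝓑 μ)) ≤
      ∑ g ∈ G, Module.length A (𝓜 ((fun i => (μ i : ℤ)) + δ g)) := by
  set φ : 𝓑 μ →ₗ[A] ∀ g : G, 𝓜 ((fun i => (μ i : ℤ)) + δ g) :=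
    LinearMap.pi fun g => LinearMap.codRestrict _
      ((LinearMap.toSpanSingleton B M (g : M)).restrictScalars A ∘ₗ (𝓑 μ).subtype)
      fun b => h.smul_mem μ (δ g) b g b.2 (hδ g g.2) with hφ
  set ψ : 𝓑 μ →ₗ[A] B ⧸ p := (Ideal.Quotient.mkₐ A p).toLinearMap ∘ₗ (𝓑 μ).subtype with hψ
  have hrange : residueImage p (𝓑 μ) = LinearMap.range ψ := by
    rw [hψ, LinearMap.range_comp, Submodule.range_subtype]
    rfl
  rw [hrange]
  refine (length_le_of_ker_le φ ψ fun b hb => ?_).trans (le_of_eq ?_)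
  · rw [LinearMap.mem_ker] at hb ⊢
    refine Ideal.Quotient.eq_zero_iff_mem.2 (hp (Module.mem_annihilator.2 fun x => ?_))
    have hx : x ∈ Submodule.span B (G : Set M) := hG ▸ Submodule.mem_top
    induction hx using Submodule.span_induction with
    | mem x hx => exact congrArg Subtype.val (congrFun hb ⟨x, hx⟩)
    | zero => exact smul_zero _
    | add x y _ _ hx hy => rw [smul_add, hx, hy, add_zero]
    | smul c x _ hx => rw [smul_comm, hx, smul_zero]
  · rw [Module.length_pi_of_fintype, ← Finset.sum_coe_sort G]

/-- The sum of the homogeneous parts of `B` with degrees in the box `[0, n]^r`. -/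
def boxPart (𝓑 : (Fin r → ℕ) → Submodule A B) (n : ℕ) : Submodule A B :=
  ⨆ μ ∈ Fintype.piFinset fun _ : Fin r => Finset.range (n + 1), 𝓑 μ

theorem le_boxPart {n : ℕ} {μ : Fin r → ℕ} (hμ : ∀ i, μ i ≤ n) : 𝓑 μ ≤ boxPart 𝓑 n :=
  le_biSup 𝓑 (Fintype.mem_piFinset.2 fun i => Finset.mem_range.2 (Nat.lt_succ_of_le (hμ i)))

theorem boxPart_mono : Monotone (boxPart 𝓑) := fun _ _ hmn =>
  iSup₂_le fun _ hμ => le_boxPart fun i =>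
    (Nat.lt_succ_iff.1 (Finset.mem_range.1 (Fintype.mem_piFinset.1 hμ i))).trans hmn

variable [GradedAlgebra 𝓑]

theorem mul_mem_boxPart (m n : ℕ) : ∀ x ∈ boxPart 𝓑 m, ∀ y ∈ boxPart 𝓑 n,
    x * y ∈ boxPart 𝓑 (m + n) := by
  intro x hx y hy
  have : boxPart 𝓑 m * boxPart 𝓑 n ≤ boxPart 𝓑 (m + n) := by
    rw [boxPart, boxPart]
    simp only [Submodule.iSup_mul, Submodule.mul_iSup]
    refine iSup₂_le fun μ hμ => iSup₂_le fun ρ hρ => ?_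
    refine le_trans (Submodule.mul_le.2 fun a ha b hb => SetLike.mul_mem_graded ha hb)
      (le_boxPart fun i => ?_)
    have h1 := Finset.mem_range.1 (Fintype.mem_piFinset.1 hμ i)
    have h2 := Finset.mem_range.1 (Fintype.mem_piFinset.1 hρ i)
    simp only [Pi.add_apply]
    omega
  exact this (Submodule.mul_mem_mul hx hy)

theorem exists_mem_boxPart (x : B) : ∃ n, x ∈ boxPart 𝓑 n := by
  classical
  refine ⟨(DirectSum.decompose 𝓑 x).support.sup fun μ => ∑ i, μ i, ?_⟩
  rw [← DirectSum.sum_support_decompose 𝓑 x]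
  refine Submodule.sum_mem _ fun μ hμ => le_boxPart (fun i => ?_) (SetLike.coe_mem _)
  rw [DirectSum.sum_support_decompose 𝓑 x]
  exact (Finset.single_le_sum (fun j _ => Nat.zero_le (μ j)) (Finset.mem_univ i)).trans
    (Finset.le_sup (f := fun μ : Fin r → ℕ => ∑ i, μ i) hμ)

theorem exists_nat_fun {α : Type*} [Preorder α] (s : LTSeries α) :
    ∃ p : ℕ → α, p 0 = s.head ∧ ∀ i < s.length, p i < p (i + 1) := by
  refine ⟨fun i => s.toFun ⟨min i s.length, by omega⟩, rfl, fun i hi => ?_⟩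
  refine s.strictMono (Fin.mk_lt_mk.2 ?_)
  omega

/-- The dimension of `M` is at most the maximal total pole order of its Hilbert series. -/
theorem IsGradedModule.exists_length_le [Module.Finite B M] (h : IsGradedModule 𝓑 𝓜)
    {L : Multiset ((Fin r → ℤ) × (Fin r → ℕ))} (hL : ∀ ν, Module.length A (𝓜 ν) = sumCoeff L ν)
    (s : LTSeries (Module.support B M)) : ∃ p ∈ L, s.length ≤ ∑ i, p.2 i := by
  obtain ⟨G, δ, hδ, hG⟩ := h.exists_generators
  obtain ⟨E, hE⟩ : ∃ E : ℕ, ∀ g ∈ G, ∀ i, |δ g i| ≤ E := by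
    choose D hD using fun g => exists_forall_le_natCast (δ g)
    refine ⟨G.sup D, fun j hj i => (hD j i).trans ?_⟩
    exact_mod_cast Finset.le_sup hj
  obtain ⟨p, -, hps⟩ := exists_nat_fun s
  obtain ⟨C, hC⟩ := exists_pow_le_mul_length (mul_mem_boxPart (𝓑 := 𝓑)) s.length
    (fun i => (p i : PrimeSpectrum B)) (fun i _ n => ⟨1, le_boxPart (fun _ => Nat.zero_le n)
      (SetLike.one_mem_graded 𝓑), (Ideal.ne_top_iff_one _).1 (p i).1.isPrime.ne_top⟩)
    fun i hi => by
      have hlt : (p i : PrimeSpectrum B) < p (i + 1) := hps i hi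
      obtain ⟨x, hx, hx'⟩ := SetLike.exists_of_lt
        (show (p i : PrimeSpectrum B).asIdeal < (p (i + 1) : PrimeSpectrum B).asIdeal from hlt)
      obtain ⟨m, hm⟩ := exists_mem_boxPart (𝓑 := 𝓑) x
      exact ⟨hlt.le, m, x, boxPart_mono (Nat.le_succ m) hm, hx, hx'⟩
  have hann := Module.annihilator_le_of_mem_support (p 0).2
  refine exists_le_of_pow_le_sum (C := C * G.card) (E := E)
    (fun N _ => Finset.Icc (-(E : ℤ)) (N + E))
    (fun N i t ht => (Finset.mem_Icc.1 ht).2) fun N => ?_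
  have h1 : Module.length A (residueImage (p 0 : PrimeSpectrum B).asIdeal (boxPart 𝓑 N)) ≤
      ((G.card * ∑ ν ∈ Fintype.piFinset fun _ : Fin r => Finset.Icc (-(E : ℤ)) (N + E),
        sumCoeff L ν : ℕ) : ℕ∞) := by
    have h2 : residueImage (p 0 : PrimeSpectrum B).asIdeal (boxPart 𝓑 N) =
        ⨆ μ ∈ Fintype.piFinset fun _ : Fin r => Finset.range (N + 1),
          residueImage (p 0 : PrimeSpectrum B).asIdeal (𝓑 μ) := by
      simp only [residueImage, boxPart, Submodule.map_iSup]
    rw [h2]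
    refine (length_biSup_le _ _).trans ((Finset.sum_le_sum fun μ _ =>
      h.length_residueImage_le hδ hG hann μ).trans ?_)
    rw [Finset.sum_comm]
    simp only [hL]
    rw [Nat.cast_mul, ← nsmul_eq_mul]
    refine Finset.sum_le_card_nsmul _ _ _ fun g hg => ?_
    rw [← Nat.cast_sum]
    refine Nat.cast_le.2 ?_
    rw [← Finset.sum_image (f := fun ν => sumCoeff L ν)
      (g := fun (μ : Fin r → ℕ) => (fun i => (μ i : ℤ)) + δ g)]
    · refine Finset.sum_le_sum_of_subset fun ν hν => ?_
      obtain ⟨μ, hμ, rfl⟩ := Finset.mem_image.1 hν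
      refine Fintype.mem_piFinset.2 fun i => Finset.mem_Icc.2 ?_
      have h3 := Finset.mem_range.1 (Fintype.mem_piFinset.1 hμ i)
      have h4 := abs_le.1 (hE g hg i)
      simp only [Pi.add_apply]
      omega
    · intro μ _ ρ _ hμρ
      ext i
      have := congrFun (add_right_cancel hμρ) i
      exact_mod_cast this
  have h2 := (hC N).trans (mul_le_mul_right h1 _)
  rw [← Nat.cast_mul] at h2
  rw [mul_assoc]
  exact_mod_cast h2

/-- The analogous bound for chains in the relevant support, by the growth along the diagonal. -/
theorem IsGradedModule.exists_length_add_le [Module.Finite B M] (h𝓑 : IsStandard 𝓑)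
    (h : IsGradedModule 𝓑 𝓜) {L : Multiset ((Fin r → ℤ) × (Fin r → ℕ))}
    (hL : ∀ ν, Module.length A (𝓜 ν) = sumCoeff L ν) (s : LTSeries (relevantSupport 𝓑 M)) :
    ∃ p ∈ L, (∀ i, p.2 i ≠ 0) ∧ s.length + r ≤ ∑ i, p.2 i := by
  classical
  obtain ⟨G, δ, hδ, hG⟩ := h.exists_generators
  obtain ⟨p, -, hps⟩ := exists_nat_fun s
  have hone : ∀ q ∈ relevantSupport 𝓑 M, ∀ n : ℕ,
      ∃ u ∈ 𝓑 (fun _ => n), u ∉ q.asIdeal := fun q hq n => by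
    have := hq.2.1
    rw [h𝓑.irrelevantIdeal_eq, Ideal.span_le, Set.not_subset] at this
    obtain ⟨u, hu, hup⟩ := this
    have hu' := SetLike.pow_mem_graded n (A := 𝓑) hu
    refine ⟨u ^ n, ?_, fun hn => hup (q.isPrime.mem_of_pow_mem n hn)⟩
    convert hu' using 1
    congr 1
    ext i
    simp
  obtain ⟨C, hC⟩ := exists_pow_le_mul_length (U := fun n => 𝓑 fun _ => n)
    (fun m n x hx y hy => SetLike.mul_mem_graded hx hy) s.length
    (fun i => (p i : PrimeSpectrum B)) (fun i _ n => hone _ (p i).2 n) fun i hi => by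
      have hlt : (p i : PrimeSpectrum B) < p (i + 1) := hps i hi
      refine ⟨hlt.le, ?_⟩
      obtain ⟨x, hx, hx'⟩ := SetLike.exists_of_lt
        (show (p i : PrimeSpectrum B).asIdeal < (p (i + 1) : PrimeSpectrum B).asIdeal from hlt)
      obtain ⟨μ, hμ⟩ : ∃ μ, (DirectSum.decompose 𝓑 x μ : B) ∉ (p i : PrimeSpectrum B).asIdeal := by
        by_contra! hall
        refine hx' ?_
        rw [← DirectSum.sum_support_decompose 𝓑 x]
        exact Ideal.sum_mem _ fun μ _ => hall μ
      -- A homogeneous element separating the primes is moved to the diagonal.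
      obtain ⟨w, hw, hwp⟩ : ∃ w ∈ 𝓑 fun i => ∑ j, μ j + 1 - μ i,
          w ∉ (p i : PrimeSpectrum B).asIdeal := by
        by_contra! hall
        obtain ⟨u, hu, hup⟩ := hone _ (p i).2 (∑ j, μ j + 1)
        have hle := h𝓑.le_mul μ fun i => ∑ j, μ j + 1 - μ i
        have heq : (μ + fun i => ∑ j, μ j + 1 - μ i) = fun _ => ∑ j, μ j + 1 := by
          ext i
          have := Finset.single_le_sum (fun j _ => Nat.zero_le (μ j)) (Finset.mem_univ i)
          simp only [Pi.add_apply]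
          omega
        rw [heq] at hle
        have hle' : 𝓑 μ * 𝓑 (fun i => ∑ j, μ j + 1 - μ i) ≤
            (p i : PrimeSpectrum B).asIdeal.restrictScalars A :=
          Submodule.mul_le.2 fun a _ b hb => Ideal.mul_mem_left _ _ (hall b hb)
        exact hup (hle' (hle hu))
      refine ⟨∑ j, μ j, DirectSum.decompose 𝓑 x μ * w, ?_, ?_, ?_⟩
      · have := SetLike.mul_mem_graded (A := 𝓑) (SetLike.coe_mem (DirectSum.decompose 𝓑 x μ)) hw
        convert this using 1
        congr 1
        ext i
        have := Finset.single_le_sum (fun j _ => Nat.zero_le (μ j)) (Finset.mem_univ i)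
        simp only [Pi.add_apply]
        omega
      · exact Ideal.mul_mem_right _ _ ((p (i + 1)).2.1 μ hx)
      · intro hmem
        rcases (p i).1.isPrime.mem_or_mem hmem with h' | h'
        exacts [hμ h', hwp h']
  have hann := Module.annihilator_le_of_mem_support (p 0).2.2.2
  refine exists_full_of_pow_le (C := C) G δ fun n => ?_
  have h2 := (hC n).trans (mul_le_mul_right (h.length_residueImage_le hδ hG hann fun _ => n) _)
  simp only [hL] at h2
  exact_mod_cast h2

end Dimension

/-! ### The relevant support -/

section RelevantSupport

variable {r : ℕ} {A B M : Type*} [CommRing A] [CommRing B] [Algebra A B]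
  {𝓑 : (Fin r → ℕ) → Submodule A B} [GradedAlgebra 𝓑]
  [AddCommGroup M] [Module B M]

/-- The dimension of a subspace of the spectrum is the supremum of the lengths of its chains of
primes, provided that the subspace contains the generic points of its irreducible subsets. -/
theorem topologicalKrullDim_eq_krullDim {R : Type*} [CommRing R] {T : Set (PrimeSpectrum R)}
    (hT : ∀ S : Set (PrimeSpectrum R), S ⊆ T → S.Nonempty → ∀ p : PrimeSpectrum R,
      p.asIdeal = PrimeSpectrum.vanishingIdeal S → p ∈ T) :
    topologicalKrullDim T = Order.krullDim T := by
  have hsober : QuasiSober T := by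
    refine ⟨fun {S} hS hS' => ?_⟩
    have himage := hS.image (Subtype.val : T → PrimeSpectrum R) continuous_subtype_val.continuousOn
    obtain ⟨p, hp⟩ := QuasiSober.sober himage.closure isClosed_closure
    have hpT : p ∈ T := by
      refine hT (Subtype.val '' S) (fun _ ⟨q, _, h⟩ => h ▸ q.2) himage.nonempty p ?_
      rw [← PrimeSpectrum.vanishingIdeal_closure, ← hp.def, PrimeSpectrum.vanishingIdeal_closure,
        PrimeSpectrum.vanishingIdeal_singleton]
    refine ⟨⟨p, hpT⟩, ?_⟩
    rw [isGenericPoint_def, Topology.IsInducing.subtypeVal.closure_eq_preimage_closure_image,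
      Set.image_singleton, hp.def,
      ← Topology.IsInducing.subtypeVal.closure_eq_preimage_closure_image,
      hS'.closure_eq]
  let e : T ≃o (TopologicalSpace.IrreducibleCloseds T)ᵒᵈ :=
    { toEquiv := irreducibleSetEquivPoints.toEquiv.symm.trans OrderDual.toDual
      map_rel_iff' := fun {p q} => (RelIso.symm irreducibleSetEquivPoints).map_rel_iff.trans <| by
        change p ⤳ q ↔ _
        rw [subtype_specializes_iff, ← PrimeSpectrum.le_iff_specializes]
        rfl }
  rw [topologicalKrullDim, ← Order.krullDim_orderDual, Order.krullDim_eq_of_orderIso e]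

theorem relevantDim_eq_krullDim [Module.Finite B M] :
    relevantDim 𝓑 M = Order.krullDim (relevantSupport 𝓑 M) := by
  refine topologicalKrullDim_eq_krullDim fun S hS ⟨q, hq⟩ p hp => ⟨?_, fun hN => ?_, ?_⟩
  · rw [hp, PrimeSpectrum.vanishingIdeal]
    exact Ideal.IsHomogeneous.iInf₂ fun q hq => (hS hq).1
  · refine (hS hq).2.1 (hN.trans (hp.trans_le ?_))
    exact iInf₂_le q hq
  · rw [Module.mem_support_iff_of_finite, hp]
    exact le_iInf₂ fun q hq => Module.annihilator_le_of_mem_support (hS hq).2.2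

/-- The homogeneous core of a prime ideal is prime: one may order the
degrees lexicographically, and for linearly ordered degrees leading components multiply. -/
theorem isPrime_homogeneousCore {p : Ideal B} (hp : p.IsPrime) :
    (p.homogeneousCore 𝓑).toIdeal.IsPrime := by
  let 𝓒 : Lex (Fin r → ℕ) → Submodule A B := 𝓑
  have hgraded : Nonempty (GradedAlgebra 𝓑) := ⟨inferInstance⟩
  have key : ∀ d : DecidableEq (Fin r → ℕ), Nonempty (@GradedAlgebra _ A B d _ _ _ _ 𝓑) :=
    fun d => by convert hgraded
  let order : LinearOrder (Lex (Fin r → ℕ)) := inferInstance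
  let := (key order.toDecidableEq).some
  exact @Ideal.IsPrime.homogeneousCore (Lex (Fin r → ℕ)) _ B _ _ _ _ _ _ 𝓒 this p hp

theorem le_homogeneousCore {I p : Ideal B} (hI : I.IsHomogeneous 𝓑)
    (h : I ≤ p) : I ≤ (p.homogeneousCore 𝓑).toIdeal := by
  rw [← hI.toIdeal_homogeneousCore_eq_self]
  exact Ideal.homogeneousCore_mono 𝓑 h

theorem relevantSupport_subset {M' : Type*} [AddCommGroup M'] [Module B M']
    (h : Module.support B M' ⊆ Module.support B M) :
    relevantSupport 𝓑 M' ⊆ relevantSupport 𝓑 M := fun _ hp => ⟨hp.1, hp.2.1, h hp.2.2⟩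

variable [Module A M] {𝓜 : (Fin r → ℤ) → Submodule A M}

/-- If the relevant support of `M` is empty, then a power of the irrelevant ideal kills `M`. -/
theorem IsGradedModule.exists_pow_le_annihilator [Module.Finite B M] [IsNoetherianRing B]
    (h : IsGradedModule 𝓑 𝓜) (hM : IsEmpty (relevantSupport 𝓑 M)) :
    ∃ k, irrelevantIdeal 𝓑 ^ k ≤ Module.annihilator B M := by
  refine Ideal.exists_pow_le_of_le_radical_of_fg ?_ (IsNoetherian.noetherian _)
  rw [Ideal.radical_eq_sInf]
  refine le_sInf fun p ⟨hp, hprime⟩ => ?_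
  by_contra hN
  refine hM.elim ⟨⟨_, isPrime_homogeneousCore (𝓑 := 𝓑) hprime⟩, HomogeneousIdeal.isHomogeneous _,
    fun hle => hN (hle.trans (Ideal.toIdeal_homogeneousCore_le 𝓑 p)), ?_⟩
  rw [Module.mem_support_iff_of_finite]
  exact le_homogeneousCore h.isHomogeneous_annihilator hp

theorem inclusion_strictMono {T T' : Set (PrimeSpectrum B)} (h : T ⊆ T') :
    StrictMono (Set.inclusion h) := fun _ _ hpq => hpq

open scoped Pointwise in
/-- A chain in the relevant support of `M / yM`, for `y` homogeneous and a nonzerodivisor on `M`,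
can be prolonged in the relevant support of `M`: below the smallest prime there is a minimal prime
of `M`, which does not contain `y`, and its homogeneous core. -/
theorem IsGradedModule.exists_length_eq_add_one [Module.Finite B M] (h : IsGradedModule 𝓑 𝓜)
    {y : B} (hreg : IsSMulRegular M y)
    (s : LTSeries (relevantSupport 𝓑 (M ⧸ (y • (⊤ : Submodule B M))))) :
    ∃ s' : LTSeries (relevantSupport 𝓑 M), s'.length = s.length + 1 := by
  have hsub : relevantSupport 𝓑 (M ⧸ (y • (⊤ : Submodule B M))) ⊆ relevantSupport 𝓑 M :=
    relevantSupport_subset (Module.support_subset_of_surjective _ (Submodule.mkQ_surjective _))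
  set p : PrimeSpectrum B := (s.head : PrimeSpectrum B)
  have hy : y ∈ p.asIdeal := by
    refine Module.annihilator_le_of_mem_support s.head.2.2.2 (Module.mem_annihilator.2 fun x => ?_)
    obtain ⟨x, rfl⟩ := Submodule.mkQ_surjective _ x
    rw [← map_smul]
    exact (Submodule.Quotient.mk_eq_zero _).2
      (Submodule.smul_mem_pointwise_smul _ _ _ Submodule.mem_top)
  obtain ⟨q, hq, hqp⟩ := Ideal.exists_minimalPrimes_le
    (Module.annihilator_le_of_mem_support (hsub s.head.2).2.2)
  have hprime : q.IsPrime := hq.1.1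
  have hann : Module.annihilator B M ≤ q := hq.1.2
  have hle := Ideal.toIdeal_homogeneousCore_le 𝓑 q
  have hq' : (⟨_, isPrime_homogeneousCore (𝓑 := 𝓑) hprime⟩ : PrimeSpectrum B) ∈
      relevantSupport 𝓑 M := by
    refine ⟨HomogeneousIdeal.isHomogeneous _,
      fun hN => s.head.2.2.1 (hN.trans (hle.trans hqp)), ?_⟩
    rw [Module.mem_support_iff_of_finite]
    exact le_homogeneousCore h.isHomogeneous_annihilator hann
  refine ⟨(s.map _ (inclusion_strictMono hsub)).cons ⟨_, hq'⟩ ?_, ?_⟩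
  · refine lt_of_le_of_ne (hle.trans hqp) fun heq => ?_
    refine hreg.notMem_of_mem_minimalPrimes hq (hle ?_)
    exact heq.ge hy
  · exact RelSeries.cons_length _ _ _

/-- The length of `[M]_ν` along the diagonal is bounded by a polynomial of degree `k`, for each
bound `k` of the lengths of the chains in the relevant support. -/
def HasDiagonalBound (𝓑 : (Fin r → ℕ) → Submodule A B) [GradedAlgebra 𝓑]
    (𝓜 : (Fin r → ℤ) → Submodule A M) : Prop :=
  ∀ k : ℕ, (∀ s : LTSeries (relevantSupport 𝓑 M), s.length ≤ k) →
    ∃ C n₀ : ℕ, ∀ n : ℕ, n₀ ≤ n → Module.length A (𝓜 fun _ => (n : ℤ)) ≤ (C * (n + 1) ^ k : ℕ)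

theorem HasDiagonalBound.extension [IsScalarTower A B M] {N : Submodule B M}
    (hN : HasDiagonalBound 𝓑 (subGrading N 𝓜)) (hQ : HasDiagonalBound 𝓑 (quotientGrading N 𝓜)) :
    HasDiagonalBound 𝓑 𝓜 := by
  intro k hk
  have hsub := relevantSupport_subset (𝓑 := 𝓑)
    (Module.support_subset_of_injective N.subtype N.subtype_injective)
  have hsub' := relevantSupport_subset (𝓑 := 𝓑)
    (Module.support_subset_of_surjective N.mkQ N.mkQ_surjective)
  obtain ⟨C, n₀, hC⟩ := hN k fun s => hk (s.map _ (inclusion_strictMono hsub))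
  obtain ⟨C', n₀', hC'⟩ := hQ k fun s => hk (s.map _ (inclusion_strictMono hsub'))
  refine ⟨C + C', max n₀ n₀', fun n hn => ?_⟩
  rw [length_eq_length_subGrading_add N, add_mul, Nat.cast_add]
  exact add_le_add (hC n ((le_max_left _ _).trans hn)) (hC' n ((le_max_right _ _).trans hn))

theorem exists_le_mul_pow_of_differences {f : ℕ → ℕ∞} {n₀ C k : ℕ} (h₀ : f n₀ ≠ ⊤)
    (h : ∀ n, n₀ ≤ n → f (n + 1) ≤ f n + (C * (n + 1 + 1) ^ k : ℕ)) :
    ∃ D : ℕ, ∀ n, n₀ ≤ n → f n ≤ (D * (n + 1) ^ (k + 1) : ℕ) := by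
  refine ⟨(f n₀).toNat + C, fun n hn => ?_⟩
  induction n, hn using Nat.le_induction with
  | base =>
    rw [← ENat.natCast_toNat h₀]
    refine Nat.cast_le.2 ?_
    rw [ENat.toNat_natCast]
    exact (Nat.le_add_right _ _).trans (Nat.le_mul_of_pos_right _ (by positivity))
  | succ n hn ih =>
    refine (h n hn).trans ((add_le_add ih le_rfl).trans ?_)
    rw [← Nat.cast_add]
    refine Nat.cast_le.2 ?_
    have h1 : (n + 1) ^ (k + 1) + (n + 2) ^ k ≤ (n + 2) ^ (k + 1) := by
      rw [show n + 2 = n + 1 + 1 from rfl, pow_succ (n + 1 + 1), pow_succ (n + 1),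
        mul_add_one _ (n + 1)]
      have : (n + 1) ^ k ≤ (n + 1 + 1) ^ k := Nat.pow_le_pow_left (by omega) k
      exact Nat.add_le_add_right (Nat.mul_le_mul_right _ this) _
    calc ((f n₀).toNat + C) * (n + 1) ^ (k + 1) + C * (n + 1 + 1) ^ k
        ≤ ((f n₀).toNat + C) * ((n + 1) ^ (k + 1) + (n + 2) ^ k) := by
          rw [mul_add]
          exact Nat.add_le_add_left (Nat.mul_le_mul_right _ (Nat.le_add_left _ _)) _
      _ ≤ _ := Nat.mul_le_mul_left _ h1

/-- A graded module with empty relevant support vanishes in all large degrees. -/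
theorem IsGradedModule.exists_eq_bot_of_isEmpty [Module.Finite B M] [IsNoetherianRing A]
    (h𝓑 : IsStandard 𝓑) (h : IsGradedModule 𝓑 𝓜) (hM : IsEmpty (relevantSupport 𝓑 M)) :
    ∃ c : ℤ, ∀ ν : Fin r → ℤ, (∀ i, c ≤ ν i) → 𝓜 ν = ⊥ := by
  have := h𝓑.isNoetherianRing
  obtain ⟨k, hk⟩ := h.exists_pow_le_annihilator hM
  exact h.exists_eq_bot_of_killed h𝓑 fun b hb x => Module.mem_annihilator.1 (hk hb) x

open scoped Pointwise in
theorem HasDiagonalBound.of_isSMulRegular [IsScalarTower A B M] [Module.Finite B M]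
    [IsNoetherianRing A] (h𝓑 : IsStandard 𝓑) (h : IsGradedModule 𝓑 𝓜)
    (hfin : ∀ ν, Module.length A (𝓜 ν) ≠ ⊤) {y : B} (hy : y ∈ 𝓑 1) (hreg : IsSMulRegular M y)
    (hQ : HasDiagonalBound 𝓑 (quotientGrading (y • (⊤ : Submodule B M)) 𝓜)) :
    HasDiagonalBound 𝓑 𝓜 := by
  intro k hk
  have hdiff : ∀ n : ℕ, Module.length A (𝓜 fun _ => ((n + 1 : ℕ) : ℤ)) =
      Module.length A (𝓜 fun _ => (n : ℤ)) + Module.length A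
        (quotientGrading (y • (⊤ : Submodule B M)) 𝓜 fun _ => ((n + 1 : ℕ) : ℤ)) := fun n => by
    have hshift : ((fun _ => ((n + 1 : ℕ) : ℤ)) - fun i => (((1 : Fin r → ℕ) i : ℕ) : ℤ)) =
        fun _ => (n : ℤ) := by
      ext i
      simp
    rw [h.length_eq_add_of_isSMulRegular hy hreg, hshift]
  cases k with
  | zero =>
    have hempty : IsEmpty (relevantSupport 𝓑 (M ⧸ (y • (⊤ : Submodule B M)))) := by
      refine ⟨fun p => ?_⟩
      obtain ⟨s, hs⟩ := h.exists_length_eq_add_one hreg (RelSeries.singleton _ p)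
      have := hk s
      omega
    obtain ⟨c, hc⟩ := (h.quotient (h.isGradedSubmodule_smul_top hy)).exists_eq_bot_of_isEmpty
      h𝓑 hempty
    refine ⟨(Module.length A (𝓜 fun _ => (c.toNat : ℤ))).toNat, c.toNat, fun n hn => ?_⟩
    rw [pow_zero, mul_one, ENat.natCast_toNat (hfin _)]
    induction n, hn using Nat.le_induction with
    | base => exact le_rfl
    | succ n hn ih =>
      rw [hdiff, hc _ fun _ => by omega, Module.length_bot, add_zero]
      exact ih
  | succ k =>
    obtain ⟨C, n₀, hC⟩ := hQ k fun s => by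
      obtain ⟨s', hs'⟩ := h.exists_length_eq_add_one hreg s
      have := hk s'
      omega
    obtain ⟨D, hD⟩ := exists_le_mul_pow_of_differences
      (f := fun n : ℕ => Module.length A (𝓜 fun _ => (n : ℤ))) (n₀ := n₀) (C := C) (k := k)
      (hfin _) fun n hn => by
        rw [hdiff]
        exact add_le_add le_rfl (by simpa using hC (n + 1) (by omega))
    exact ⟨D, n₀, hD⟩

/-- Dévissage along generators of the irrelevant ideal of degree `(1, …, 1)`; multiplication by such
a generator moves along the diagonal. -/
theorem IsGradedModule.hasDiagonalBound [IsArtinianRing A] (h𝓑 : IsStandard 𝓑)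
    [IsScalarTower A B M] [Module.Finite B M] (h : IsGradedModule 𝓑 𝓜) :
    HasDiagonalBound 𝓑 𝓜 := by
  have := h𝓑.isNoetherianRing
  obtain ⟨S, hS, hspan⟩ := h𝓑.exists_generators_irrelevantIdeal
  exact @devissage r A B _ _ _ _ 𝓑 _ (fun M _ _ _ 𝓜 => HasDiagonalBound 𝓑 𝓜) S
    (fun y hy => ⟨1, hS y hy⟩)
    (fun M _ _ _ _ _ 𝓜 _ N _ hN hQ => hN.extension hQ)
    (fun M _ _ _ _ _ 𝓜 h hM k _ => by
      obtain ⟨c, hc⟩ := h.exists_eq_bot_of_killed h𝓑 (k := 1) fun b hb x => by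
        rw [pow_one, ← hspan] at hb
        induction hb using Submodule.span_induction with
        | mem y hy => exact hM y hy x
        | zero => exact zero_smul _ _
        | add a b _ _ ha hb => rw [add_smul, ha, hb, add_zero]
        | smul a b _ hb => rw [smul_assoc, hb, smul_zero]
      refine ⟨0, c.toNat, fun n hn => ?_⟩
      rw [hc _ fun _ => by omega, Module.length_bot]
      exact bot_le)
    (fun M _ _ _ _ _ 𝓜 h y hy hreg hQ => by
      obtain ⟨L, hL, -⟩ := h.hasFractionSum h𝓑
      exact hQ.of_isSMulRegular h𝓑 h (fun ν => by rw [hL]; exact ENat.natCast_ne_top _)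
        (hS y hy) hreg) M _ _ _ _ _ 𝓜 h

end RelevantSupport

/-! ### Dimensions and pole orders -/

section PoleOrders

variable {r : ℕ} {A B M : Type*} [CommRing A] [CommRing B] [Algebra A B]
  {𝓑 : (Fin r → ℕ) → Submodule A B} [GradedAlgebra 𝓑]
  [AddCommGroup M] [Module A M] [Module B M] [IsScalarTower A B M] [Module.Finite B M]
  {𝓜 : (Fin r → ℤ) → Submodule A M} {L : Multiset ((Fin r → ℤ) × (Fin r → ℕ))}

/-- The dimension of `M` is the maximal total pole order of its Hilbert series. -/
theorem IsGradedModule.supportDim_eq (h : IsGradedModule 𝓑 𝓜)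
    (hL : ∀ ν, Module.length A (𝓜 ν) = sumCoeff L ν)
    (hdim : ∀ p ∈ L, ((∑ i, p.2 i : ℕ) : WithBot ℕ∞) ≤ Module.supportDim B M) :
    (Module.supportDim B M = ⊥ ∧ L = 0) ∨ ∃ d : ℕ, Module.supportDim B M = d ∧
      (∀ p ∈ L, ∑ i, p.2 i ≤ d) ∧ ∃ p ∈ L, ∑ i, p.2 i = d := by
  classical
  rcases isEmpty_or_nonempty (Module.support B M) with hM | ⟨⟨x⟩⟩
  · left
    have hbot : Module.supportDim B M = ⊥ := Order.krullDim_eq_bot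
    refine ⟨hbot, Multiset.eq_zero_of_forall_notMem fun p hp => ?_⟩
    have := hdim p hp
    rw [hbot, le_bot_iff] at this
    exact WithBot.coe_ne_bot this
  · right
    obtain ⟨p, hp, -⟩ := h.exists_length_le hL (RelSeries.singleton _ x)
    obtain ⟨q, hq, hmax⟩ := L.toFinset.exists_max_image (fun p => ∑ i, p.2 i)
      ⟨p, Multiset.mem_toFinset.2 hp⟩
    rw [Multiset.mem_toFinset] at hq
    refine ⟨∑ i, q.2 i, le_antisymm (iSup_le fun s => ?_) (hdim q hq),
      fun p hp => hmax p (Multiset.mem_toFinset.2 hp), q, hq, rfl⟩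
    obtain ⟨p, hp, hs⟩ := h.exists_length_le hL s
    exact_mod_cast hs.trans (hmax p (Multiset.mem_toFinset.2 hp))

theorem IsGradedModule.sum_le_of_mem [IsArtinianRing A] (h𝓑 : IsStandard 𝓑) (h : IsGradedModule 𝓑 𝓜)
    (hL : ∀ ν, Module.length A (𝓜 ν) = sumCoeff L ν) {k : ℕ}
    (hk : ∀ s : LTSeries (relevantSupport 𝓑 M), s.length ≤ k)
    {p : (Fin r → ℤ) × (Fin r → ℕ)} (hp : p ∈ L) (hp' : ∀ i, p.2 i ≠ 0) :
    ∑ i, p.2 i ≤ k + r := by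
  obtain ⟨C, n₀, hC⟩ := h.hasDiagonalBound h𝓑 k hk
  refine sum_le_of_sumCoeff_le (C := C) (n₀ := n₀) hp hp' fun n hn => ?_
  have := hC n hn
  rw [hL] at this
  exact_mod_cast this

/-- The dimension of the relevant support, increased by `r`, is the maximal total order of the
terms of the Hilbert series with a pole in each of the variables. -/
theorem IsGradedModule.relevantDim_eq [IsArtinianRing A] (h𝓑 : IsStandard 𝓑)
    (h : IsGradedModule 𝓑 𝓜) (hL : ∀ ν, Module.length A (𝓜 ν) = sumCoeff L ν) :
    (relevantDim 𝓑 M = ⊥ ∧ ∀ p ∈ L, ∃ i, p.2 i = 0) ∨ ∃ d : ℕ, relevantDim 𝓑 M = d ∧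
      (∀ p ∈ L, (∀ i, p.2 i ≠ 0) → ∑ i, p.2 i ≤ d + r) ∧
        ∃ p ∈ L, (∀ i, p.2 i ≠ 0) ∧ ∑ i, p.2 i = d + r := by
  classical
  rw [relevantDim_eq_krullDim]
  rcases isEmpty_or_nonempty (relevantSupport 𝓑 M) with hM | ⟨⟨x⟩⟩
  · left
    refine ⟨Order.krullDim_eq_bot, fun p hp => ?_⟩
    by_contra! hp'
    obtain ⟨c, hc⟩ := h.exists_eq_bot_of_isEmpty h𝓑 hM
    obtain ⟨ν, hν, hpos⟩ := exists_sumCoeff_pos hp hp' c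
    have := hL ν
    rw [hc ν hν, Module.length_bot] at this
    have h0 : (0 : ℕ) = sumCoeff L ν := by exact_mod_cast this
    omega
  · right
    obtain ⟨p, hp, hp', hle⟩ := h.exists_length_add_le h𝓑 hL (RelSeries.singleton _ x)
    obtain ⟨q, hq, hmax⟩ := (L.toFinset.filter fun p => ∀ i, p.2 i ≠ 0).exists_max_image
      (fun p => ∑ i, p.2 i) ⟨p, Finset.mem_filter.2 ⟨Multiset.mem_toFinset.2 hp, hp'⟩⟩
    replace hmax : ∀ p ∈ L, (∀ i, p.2 i ≠ 0) → ∑ i, p.2 i ≤ ∑ i, q.2 i := fun p hp hp' =>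
      hmax p (Finset.mem_filter.2 ⟨Multiset.mem_toFinset.2 hp, hp'⟩)
    rw [Finset.mem_filter, Multiset.mem_toFinset] at hq
    obtain ⟨d, hd⟩ : ∃ d, ∑ i, q.2 i = d + r :=
      ⟨∑ i, q.2 i - r, by have := hmax p hp hp'; omega⟩
    have hlen : ∀ s : LTSeries (relevantSupport 𝓑 M), s.length ≤ d := fun s => by
      obtain ⟨p, hp, hp', hle⟩ := h.exists_length_add_le h𝓑 hL s
      have := hmax p hp hp'
      omega
    refine ⟨d, le_antisymm (iSup_le fun s => by exact_mod_cast hlen s) ?_, hd ▸ hmax,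
      q, hq.1, hq.2, hd⟩
    by_contra! hlt
    rw [Order.krullDim_lt_coe_iff] at hlt
    have h0 := hlt (RelSeries.singleton _ x)
    have := h.sum_le_of_mem h𝓑 hL (k := d - 1) (fun s => by have := hlt s; omega) hq.1 hq.2
    omega

end PoleOrders

/-! ### The quotient by the torsion of the irrelevant ideal -/

section Torsion

variable {r : ℕ} {A B M : Type*} [CommRing A] [CommRing B] [Algebra A B]
  {𝓑 : (Fin r → ℕ) → Submodule A B}
  [AddCommGroup M] [Module B M]

theorem exists_pow_smul_torsionSubmodule [IsNoetherianRing B] [Module.Finite B M] (I : Ideal B) :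
    ∃ k : ℕ, ∀ b ∈ I ^ k, ∀ x ∈ torsionSubmodule I M, b • x = 0 := by
  obtain ⟨G, hG⟩ := IsNoetherian.noetherian (torsionSubmodule I M)
  have hmem : ∀ g ∈ G, ∃ k : ℕ, ∀ b ∈ I ^ k, b • g = 0 := fun g hg =>
    (hG ▸ Submodule.subset_span hg : g ∈ torsionSubmodule I M)
  choose! k hk using hmem
  refine ⟨G.sup k, fun b hb x hx => ?_⟩
  rw [← hG] at hx
  induction hx using Submodule.span_induction with
  | mem g hg => exact hk g hg b (Ideal.pow_le_pow_right (Finset.le_sup hg) hb)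
  | zero => exact smul_zero _
  | add x y _ _ hx hy => rw [smul_add, hx, hy, add_zero]
  | smul c x _ hx => rw [smul_comm, hx, smul_zero]

theorem eq_zero_of_irrelevantIdeal_smul [IsNoetherianRing B] [Module.Finite B M] (I : Ideal B)
    {x : M ⧸ torsionSubmodule I M} (hx : ∀ b ∈ I, b • x = 0) : x = 0 := by
  obtain ⟨k, hk⟩ := exists_pow_smul_torsionSubmodule (M := M) I
  obtain ⟨m, rfl⟩ := Submodule.mkQ_surjective _ x
  refine (Submodule.Quotient.mk_eq_zero _).2 ⟨k + 1, fun b hb => ?_⟩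
  rw [pow_succ] at hb
  induction hb using Submodule.mul_induction_on' with
  | mem_mul_mem a ha b hb =>
    rw [mul_smul]
    refine hk a ha _ ((Submodule.Quotient.mk_eq_zero _).1 ?_)
    have := hx b hb
    rwa [← map_smul] at this
  | add a _ b _ ha hb => rw [add_smul, ha, hb, add_zero]

variable [GradedAlgebra 𝓑]

theorem relevantSupport_quotient_torsionSubmodule [IsNoetherianRing B] [Module.Finite B M] :
    relevantSupport 𝓑 (M ⧸ torsionSubmodule (irrelevantIdeal 𝓑) M) = relevantSupport 𝓑 M := by
  set T := torsionSubmodule (irrelevantIdeal 𝓑) M with hT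
  refine (relevantSupport_subset
    (Module.support_subset_of_surjective _ T.mkQ_surjective)).antisymm fun p hp => ?_
  refine ⟨hp.1, hp.2.1, ?_⟩
  have hsupp := hp.2.2
  rw [Module.support_of_exact (LinearMap.exact_subtype_mkQ T) T.subtype_injective
    T.mkQ_surjective] at hsupp
  refine hsupp.resolve_left fun hpT => hp.2.1 ?_
  obtain ⟨k, hk⟩ := exists_pow_smul_torsionSubmodule (M := M) (irrelevantIdeal 𝓑)
  refine p.isPrime.le_of_pow_le (n := k) (le_trans (fun b hb => ?_)
    (Module.annihilator_le_of_mem_support hpT))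
  exact Module.mem_annihilator.2 fun x => Subtype.ext (hk b hb x x.2)

variable [Module A M] {𝓜 : (Fin r → ℤ) → Submodule A M}

theorem IsGradedModule.isGradedSubmodule_torsionSubmodule (h : IsGradedModule 𝓑 𝓜) :
    h.IsGradedSubmodule (torsionSubmodule (irrelevantIdeal 𝓑) M) := fun ν _ ⟨k, hk⟩ =>
  ⟨k, h.smul_component_eq_zero (isHomogeneous_irrelevantIdeal_pow k) hk ν⟩

variable [IsScalarTower A B M]

theorem IsGradedModule.exists_length_quotientGrading_eq [IsNoetherianRing A] [Module.Finite B M]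
    (h𝓑 : IsStandard 𝓑) (h : IsGradedModule 𝓑 𝓜) :
    ∃ c : ℤ, ∀ ν : Fin r → ℤ, (∀ i, c ≤ ν i) → Module.length A (𝓜 ν) =
      Module.length A (quotientGrading (torsionSubmodule (irrelevantIdeal 𝓑) M) 𝓜 ν) := by
  have := h𝓑.isNoetherianRing
  obtain ⟨k, hk⟩ := exists_pow_smul_torsionSubmodule (M := M) (irrelevantIdeal 𝓑)
  obtain ⟨c, hc⟩ := (h.sub h.isGradedSubmodule_torsionSubmodule).exists_eq_bot_of_killed h𝓑
    (k := k) fun b hb x => Subtype.ext (hk b hb x x.2)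
  refine ⟨c, fun ν hν => ?_⟩
  rw [length_eq_length_subGrading_add (torsionSubmodule (irrelevantIdeal 𝓑) M), hc ν hν,
    Module.length_bot, zero_add]

/-- If no nonzero element is killed by the irrelevant ideal, which is generated by finitely many
elements of degree `(1, …, 1)`, then multiplication by these embeds `[M]_ν` into a power of
`[M]_{ν + (1, …, 1)}`. -/
theorem IsGradedModule.exists_length_le_mul [IsNoetherianRing A] (h𝓑 : IsStandard 𝓑)
    (h : IsGradedModule 𝓑 𝓜) (hM : ∀ x : M, (∀ b ∈ irrelevantIdeal 𝓑, b • x = 0) → x = 0) :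
    ∃ K : ℕ, ∀ ν, Module.length A (𝓜 ν) ≤ K * Module.length A (𝓜 (ν + 1)) := by
  obtain ⟨S, hS, hspan⟩ := h𝓑.exists_generators_irrelevantIdeal
  refine ⟨S.card, fun ν => ?_⟩
  have hmem : ∀ y ∈ S, ∀ x ∈ 𝓜 ν, y • x ∈ 𝓜 (ν + 1) := fun y hy x hx => by
    have := h.smul_mem 1 ν y x (hS y hy) hx
    rw [add_comm] at this
    convert this using 3
    simp [Pi.one_def]
  let φ : 𝓜 ν →ₗ[A] S → 𝓜 (ν + 1) := LinearMap.pi fun y =>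
    { toFun := fun x => ⟨(y : B) • (x : M), hmem y y.2 x x.2⟩
      map_add' := fun a b => Subtype.ext (smul_add _ _ _)
      map_smul' := fun a x => Subtype.ext (smul_comm (y : B) a (x : M)) }
  have hinj : Function.Injective φ := by
    rw [injective_iff_map_eq_zero]
    intro x hx
    refine Subtype.ext (hM x fun b hb => ?_)
    rw [← hspan] at hb
    induction hb using Submodule.span_induction with
    | mem y hy => exact congrArg Subtype.val (congrFun hx ⟨y, hy⟩)
    | zero => exact zero_smul _ _
    | add a b _ _ ha hb => rw [add_smul, ha, hb, add_zero]
    | smul a b _ hb => rw [smul_assoc, hb, smul_zero]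
  refine (Module.length_le_of_injective φ hinj).trans (le_of_eq ?_)
  rw [Module.length_pi_of_fintype]
  simp

/-- For `M' = M / H^0_𝔑(M)` the terms of the Hilbert series of maximal total order have poles in
all variables, whence `dim M' = r + dim Supp_{++}(M)`. -/
theorem IsGradedModule.supportDim_quotient_torsionSubmodule [IsArtinianRing A] [Module.Finite B M]
    (h𝓑 : IsStandard 𝓑) (h : IsGradedModule 𝓑 𝓜) :
    Module.supportDim B (M ⧸ torsionSubmodule (irrelevantIdeal 𝓑) M) =
      relevantDim 𝓑 M + (r : WithBot ℕ∞) := by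
  have := h𝓑.isNoetherianRing
  have h' := h.quotient h.isGradedSubmodule_torsionSubmodule
  obtain ⟨L, hL, hdim⟩ := h'.hasFractionSum h𝓑
  have hrel : relevantDim 𝓑 M =
      relevantDim 𝓑 (M ⧸ torsionSubmodule (irrelevantIdeal 𝓑) M) := by
    rw [relevantDim, relevantDim, relevantSupport_quotient_torsionSubmodule]
  obtain ⟨K, hK⟩ := h'.exists_length_le_mul h𝓑
    fun x hx => eq_zero_of_irrelevantIdeal_smul (irrelevantIdeal 𝓑) hx
  have hfull : ∀ p ∈ L, ∃ q ∈ L, (∀ i, q.2 i ≠ 0) ∧ ∑ i, p.2 i ≤ ∑ i, q.2 i := fun p hp => by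
    refine exists_full_of_le_mul (K := K) (fun ν => ?_) hp
    have := hK ν
    rw [hL, hL] at this
    exact_mod_cast this
  rw [hrel]
  rcases h'.supportDim_eq hL hdim with ⟨hbot, rfl⟩ | ⟨d, hd, hle, p, hp, hpd⟩
  · rcases h'.relevantDim_eq h𝓑 hL with ⟨hbot', -⟩ | ⟨-, -, -, p, hp, -⟩
    · rw [hbot, hbot', WithBot.bot_add]
    · exact absurd hp (Multiset.notMem_zero p)
  · obtain ⟨q, hq, hq', hpq⟩ := hfull p hp
    rcases h'.relevantDim_eq h𝓑 hL with ⟨-, hno⟩ | ⟨d', hd', hle', p', hp', -, hpd'⟩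
    · obtain ⟨i, hi⟩ := hno q hq
      exact absurd hi (hq' i)
    · have h1 := hle' q hq hq'
      have h2 := hle p' hp'
      rw [hd, hd', show d = d' + r by omega, Nat.cast_add]

end Torsion

/-! ### Mixed multiplicities -/

section Multiplicities

variable {r : ℕ} {A B M : Type*} [CommRing A] [CommRing B]
  [AddCommGroup M] [Module A M] [Module B M]
  {𝓜 : (Fin r → ℤ) → Submodule A M} {L : Multiset ((Fin r → ℤ) × (Fin r → ℕ))}

theorem hilbertFunction_eq {ν : Fin r → ℤ} {m : ℕ} (h : Module.length A (𝓜 ν) = m) :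
    hilbertFunction 𝓜 ν = m := by
  rw [hilbertFunction, h, ENat.toNat_natCast]

theorem seriesMultiplicity_eq {Q : (Fin r → ℕ) → LaurentPoly r}
    (hQ : IsHilbertDecomposition B 𝓜 Q) {n : Fin r → ℕ}
    (hn : ((∑ i, n i : ℕ) : WithBot ℕ∞) = Module.supportDim B M) :
    seriesMultiplicity B 𝓜 (fun i => (n i : ℤ) - 1) = (Q n).evalOne := by
  have hn' : (fun i => ((n i : ℤ) - 1 + 1).toNat) = n := by
    ext i
    simp
  have hex : ∃ Q, IsHilbertDecomposition B 𝓜 Q := ⟨Q, hQ⟩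
  have hchoose := hex.choose_spec
  rw [seriesMultiplicity, dif_pos ⟨hex, fun i => by omega, by simpa using hn⟩]
  change (hex.choose _).evalOne = _
  rw [hn']
  refine evalOne_eq_of_fractionSum_eq (d := ∑ i, n i) ?_ rfl
  ext ν
  rw [IsHilbertDecomposition, ← hn] at hQ hchoose
  rw [hQ, hchoose]

theorem seriesMultiplicity_of_ne {n : Fin r → ℕ}
    (hn : ((∑ i, n i : ℕ) : WithBot ℕ∞) ≠ Module.supportDim B M) :
    seriesMultiplicity B 𝓜 (fun i => (n i : ℤ) - 1) = 0 := by
  rw [seriesMultiplicity, dif_neg]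
  rintro ⟨-, -, h⟩
  exact hn (by simpa using h)

theorem IsHilbertPolynomial.unique {e e' : (Fin r → ℕ) →₀ ℤ}
    (h : IsHilbertPolynomial 𝓜 (binomialSum e)) (h' : IsHilbertPolynomial 𝓜 (binomialSum e')) :
    e = e' := by
  obtain ⟨c, hc⟩ := h
  obtain ⟨c', hc'⟩ := h'
  refine binomialSum_injective (eq_of_eval_eq (c := c ⊔ c') fun ν hν => ?_)
  rw [hc ν (le_sup_left.trans hν), hc' ν (le_sup_right.trans hν)]

theorem coeff_sum_monomial (W : Finset (Fin r → ℕ)) (c : (Fin r → ℕ) → ℚ) (m : Fin r →₀ ℕ) :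
    (∑ n ∈ W, MvPolynomial.monomial (Finsupp.equivFunOnFinite.symm n) (c n)).coeff m =
      if ⇑m ∈ W then c m else 0 := by
  classical
  have hm : ∀ n : Fin r → ℕ, Finsupp.equivFunOnFinite.symm n = m ↔ n = ⇑m := fun n =>
    Equiv.symm_apply_eq _
  simp only [MvPolynomial.coeff_sum, MvPolynomial.coeff_monomial, hm, Finset.sum_ite_eq']

variable [Algebra A B] {𝓑 : (Fin r → ℕ) → Submodule A B} [GradedAlgebra 𝓑]

theorem polyMultiplicity_eq {e : (Fin r → ℕ) →₀ ℤ} (h : IsHilbertPolynomial 𝓜 (binomialSum e))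
    {n : Fin r → ℕ} (hn : ((∑ i, n i : ℕ) : WithBot ℕ∞) = relevantDim 𝓑 M) :
    polyMultiplicity 𝓑 𝓜 n = e n := by
  have hex : ∃ e, IsHilbertPolynomial 𝓜 (binomialSum e) := ⟨e, h⟩
  rw [polyMultiplicity, dif_pos ⟨hex, hn⟩, hex.choose_spec.unique h]

theorem polyMultiplicity_of_ne {n : Fin r → ℕ}
    (hn : ((∑ i, n i : ℕ) : WithBot ℕ∞) ≠ relevantDim 𝓑 M) : polyMultiplicity 𝓑 𝓜 n = 0 := by
  rw [polyMultiplicity, dif_neg]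
  exact fun h => hn h.2

variable [IsScalarTower A B M] [Module.Finite B M]

/-- The decomposition of the Hilbert series whose numerators take as values at `1` the numbers of
terms with the corresponding denominators. -/
theorem IsGradedModule.exists_isHilbertDecomposition (h : IsGradedModule 𝓑 𝓜)
    (hL : ∀ ν, Module.length A (𝓜 ν) = sumCoeff L ν)
    (hdim : ∀ p ∈ L, ((∑ i, p.2 i : ℕ) : WithBot ℕ∞) ≤ Module.supportDim B M) :
    ∃ Q : (Fin r → ℕ) → LaurentPoly r, IsHilbertDecomposition B 𝓜 Q ∧
      ∀ n ∈ weightIndices r (Module.supportDim B M),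
        (Q n).evalOne = (L.countP fun p => p.2 = n : ℕ) ∧
        (Q n ≠ 0 → (Q n).evalOne = 0 → ∃ i, n i ≠ 0 ∧ LaurentPoly.oneSub i ∣ Q n) := by
  rcases h.supportDim_eq hL hdim with ⟨hbot, rfl⟩ | ⟨d, hd, hle, hmax⟩
  · have hempty : ∀ n : Fin r → ℕ, n ∉ weightIndices r (Module.supportDim B M) := fun n hn => by
      rw [mem_weightIndices, hbot] at hn
      exact WithBot.coe_ne_bot hn
    refine ⟨0, fun ν => ?_, fun n hn => absurd hn (hempty n)⟩
    rw [hilbertFunction_eq (hL ν), fractionSum, Finset.eq_empty_of_forall_notMem hempty]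
    simp
  · obtain ⟨Q, hQ, hQ1, hQ2⟩ := exists_numerators hle hmax
    rw [hd]
    refine ⟨Q, fun ν => ?_, fun n hn => ?_⟩
    · rw [hilbertFunction_eq (hL ν), hd]
      exact hQ ν
    · rw [natCast_mem_weightIndices] at hn
      exact ⟨hQ1 n hn, hQ2 n hn⟩

/-- The coefficients of the Hilbert polynomial in terms of the Hilbert series of
`M' = M / H^0_𝔑(M)`, which has the same Hilbert function in large degrees: those of weight at least
`dim Supp_{++}(M)` are the mixed multiplicities of `M'`. -/
theorem IsGradedModule.exists_isHilbertPolynomial [IsArtinianRing A] (h𝓑 : IsStandard 𝓑)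
    (h : IsGradedModule 𝓑 𝓜) :
    ∃ e : (Fin r → ℕ) →₀ ℤ, IsHilbertPolynomial 𝓜 (binomialSum e) ∧
      totalDeg (binomialSum e) = relevantDim 𝓑 M ∧
      (∀ n, relevantDim 𝓑 M < ((∑ i, n i : ℕ) : WithBot ℕ∞) → e n = 0) ∧
      ∀ n, relevantDim 𝓑 M ≤ ((∑ i, n i : ℕ) : WithBot ℕ∞) → 0 ≤ e n ∧ e n =
        seriesMultiplicity B (quotientGrading (torsionSubmodule (irrelevantIdeal 𝓑) M) 𝓜)
          fun i => (n i : ℤ) := by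
  have h' := h.quotient h.isGradedSubmodule_torsionSubmodule
  have := h𝓑.isNoetherianRing
  obtain ⟨L, hL, hdim⟩ := h'.hasFractionSum h𝓑
  obtain ⟨Q, hQ, hQ1⟩ := h'.exists_isHilbertDecomposition hL hdim
  obtain ⟨e, ⟨b, hb⟩, he⟩ := exists_binomialSum_eq_sumCoeff L
  obtain ⟨c, hc⟩ := h.exists_length_quotientGrading_eq h𝓑
  have hrel : relevantDim 𝓑 (M ⧸ torsionSubmodule (irrelevantIdeal 𝓑) M) = relevantDim 𝓑 M := by
    rw [relevantDim, relevantDim, relevantSupport_quotient_torsionSubmodule]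
  have hcount : ∀ n, relevantDim 𝓑 M ≤ ((∑ i, n i : ℕ) : WithBot ℕ∞) →
      e n = (L.countP fun p => p.2 = n + 1 : ℕ) := fun n hn => by
    rcases h'.relevantDim_eq h𝓑 hL with ⟨-, hno⟩ | ⟨d, hd, hle, -⟩
    · exact he 0 (fun p hp hp' => absurd (hno p hp) (by simpa using hp')) n (Nat.zero_le _)
    · rw [← hrel, hd] at hn
      exact he d hle n (by exact_mod_cast hn)
  have hzero : ∀ n, relevantDim 𝓑 M < ((∑ i, n i : ℕ) : WithBot ℕ∞) → e n = 0 := fun n hn => by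
    rw [hcount n hn.le, Multiset.countP_eq_zero.2, Nat.cast_zero]
    intro p hp hpn
    have hp' : ∀ i, p.2 i ≠ 0 := fun i => by rw [hpn]; exact Nat.succ_ne_zero _
    rcases h'.relevantDim_eq h𝓑 hL with ⟨-, hno⟩ | ⟨d, hd, hle, -⟩
    · obtain ⟨i, hi⟩ := hno p hp
      exact hp' i hi
    · have hsum := hle p hp hp'
      rw [← hrel, hd] at hn
      have hlt : d < ∑ i, n i := by exact_mod_cast hn
      simp only [hpn, Pi.add_apply, Pi.one_apply, Finset.sum_add_distrib, Finset.sum_const,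
        Finset.card_univ, Fintype.card_fin, smul_eq_mul, mul_one] at hsum
      omega
  refine ⟨e, ⟨fun _ => max b c, fun ν hν => ?_⟩, ?_, hzero, fun n hn => ⟨?_, ?_⟩⟩
  · rw [hb ν fun i => (le_max_left b c).trans (hν i), hilbertFunction_eq
      ((hc ν fun i => (le_max_right b c).trans (hν i)).trans (hL ν))]
    simp
  · rw [← hrel]
    rcases h'.relevantDim_eq h𝓑 hL with ⟨hbot, hno⟩ | ⟨d, hd, hle, p, hp, hp', hpd⟩
    · have he0 : e = 0 := by
        ext n
        refine hzero n ?_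
        rw [← hrel, hbot]
        exact WithBot.bot_lt_coe _
      rw [he0, binomialSum_zero, hbot]
      rfl
    · have hp1 : p.2 - 1 + 1 = p.2 :=
        tsub_add_cancel_of_le fun i => Nat.one_le_iff_ne_zero.2 (hp' i)
      have hpsum : ∑ i, (p.2 - 1) i = d := by
        have : ∑ i, (p.2 - 1 + 1) i = d + r := by rw [hp1, hpd]
        simpa [Finset.sum_add_distrib] using this
      rw [hd]
      refine totalDeg_binomialSum (fun n hn => ?_) ⟨p.2 - 1, ?_, hpsum⟩
      · by_contra! hlt
        refine hn ?_
        refine hzero n ?_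
        rw [← hrel, hd]
        exact_mod_cast hlt
      · rw [hcount _ (by rw [← hrel, hd, hpsum]), hp1]
        exact Nat.cast_ne_zero.2
          (Multiset.countP_pos (p := fun q => q.2 = p.2).2 ⟨p, hp, rfl⟩).ne'
  · rw [hcount n hn]
    exact Int.natCast_nonneg _
  · rw [hcount n hn]
    have hsum : ((∑ i, (n + 1 : Fin r → ℕ) i : ℕ) : WithBot ℕ∞) =
        ((∑ i, n i : ℕ) : WithBot ℕ∞) + (r : WithBot ℕ∞) := by
      rw [← Nat.cast_add]
      simp [Finset.sum_add_distrib]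
    have hshift : (fun i => (n i : ℤ)) = fun i => (((n + 1 : Fin r → ℕ) i : ℕ) : ℤ) - 1 := by
      ext i
      simp
    rw [hshift]
    by_cases hn' : ((∑ i, (n + 1 : Fin r → ℕ) i : ℕ) : WithBot ℕ∞) =
        Module.supportDim B (M ⧸ torsionSubmodule (irrelevantIdeal 𝓑) M)
    · rw [seriesMultiplicity_eq hQ hn', (hQ1 _ (mem_weightIndices.2 hn')).1]
    · rw [seriesMultiplicity_of_ne hn', Multiset.countP_eq_zero.2, Nat.cast_zero]
      intro p hp hpn
      refine hn' (le_antisymm (hpn ▸ hdim p hp) ?_)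
      rw [h.supportDim_quotient_torsionSubmodule h𝓑, hsum]
      gcongr

end Multiplicities

end MultiMixed

end

theorem theoremA {r : ℕ} {A B M : Type*} [CommRing A] [IsArtinianRing A] [IsLocalRing A]
    [CommRing B] [Algebra A B] (𝓑 : (Fin r → ℕ) → Submodule A B) [GradedAlgebra 𝓑]
    (h𝓑 : MultiMixed.IsStandard 𝓑)
    [AddCommGroup M] [Module A M] [Module B M] [IsScalarTower A B M] [Module.Finite B M]
    (𝓜 : (Fin r → ℤ) → Submodule A M) (h𝓜 : MultiMixed.IsGradedModule 𝓑 𝓜) :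
    -- the graded parts of `M` have finite length
    (∀ ν, Module.length A (𝓜 ν) ≠ ⊤) ∧
    -- structure of the Hilbert series
    (∃ Q : (Fin r → ℕ) → MultiMixed.LaurentPoly r,
      MultiMixed.IsHilbertDecomposition B 𝓜 Q ∧
      (∀ n ∈ MultiMixed.weightIndices r (Module.supportDim B M), 0 ≤ (Q n).evalOne) ∧
      (Nontrivial M →
        ∃ n ∈ MultiMixed.weightIndices r (Module.supportDim B M), 0 < (Q n).evalOne) ∧
      (∀ n ∈ MultiMixed.weightIndices r (Module.supportDim B M),
        Q n ≠ 0 → (Q n).evalOne = 0 →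
          ∃ i, n i ≠ 0 ∧
            (1 - AddMonoidAlgebra.single (Pi.single i 1) 1 : MultiMixed.LaurentPoly r) ∣ Q n)) ∧
    -- the values at `1` are determined by the sum of the fractions
    (∀ (d : ℕ) (Q Q' : (Fin r → ℕ) → MultiMixed.LaurentPoly r),
      MultiMixed.fractionSum d Q = MultiMixed.fractionSum d Q' →
        ∀ n : Fin r → ℕ, ∑ i, n i = d → (Q n).evalOne = (Q' n).evalOne) ∧
    -- hence `e_n(M) = Q_{n+1}(1)` for every decomposition of the Hilbert series of `M`
    (∀ Q : (Fin r → ℕ) → MultiMixed.LaurentPoly r, MultiMixed.IsHilbertDecomposition B 𝓜 Q →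
      ∀ n ∈ MultiMixed.weightIndices r (Module.supportDim B M),
        MultiMixed.seriesMultiplicity B 𝓜 (fun i => (n i : ℤ) - 1) = (Q n).evalOne) ∧
    -- `dim (M / H^0_𝔑(M)) = dim Supp_{++}(M) + r`
    Module.supportDim B (M ⧸ MultiMixed.torsionSubmodule (MultiMixed.irrelevantIdeal 𝓑) M) =
      MultiMixed.relevantDim 𝓑 M + (r : WithBot ℕ∞) ∧
    -- existence, uniqueness and properties of the Hilbert polynomial
    (∃ e : (Fin r → ℕ) →₀ ℤ,
      MultiMixed.IsHilbertPolynomial 𝓜 (MultiMixed.binomialSum e) ∧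
      (∀ e' : (Fin r → ℕ) →₀ ℤ,
        MultiMixed.IsHilbertPolynomial 𝓜 (MultiMixed.binomialSum e') → e' = e) ∧
      MultiMixed.totalDeg (MultiMixed.binomialSum e) = MultiMixed.relevantDim 𝓑 M ∧
      (∀ n ∈ MultiMixed.weightIndices r (MultiMixed.relevantDim 𝓑 M), 0 ≤ e n) ∧
      (∀ m ∈ (MultiMixed.binomialSum e -
          ∑ n ∈ MultiMixed.weightIndices r (MultiMixed.relevantDim 𝓑 M),
            MvPolynomial.monomial (Finsupp.equivFunOnFinite.symm n)
              ((MultiMixed.seriesMultiplicity B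
                (MultiMixed.quotientGrading
                  (MultiMixed.torsionSubmodule (MultiMixed.irrelevantIdeal 𝓑) M) 𝓜)
                (fun i => (n i : ℤ)) : ℚ) / ((∏ i, (n i).factorial : ℕ) : ℚ))).support,
        ((∑ i, m i : ℕ) : WithBot ℕ∞) < MultiMixed.relevantDim 𝓑 M)) ∧
    -- equality of the two notions of mixed multiplicities
    (∀ n : Fin r → ℕ, MultiMixed.relevantDim 𝓑 M ≤ ((∑ i, n i : ℕ) : WithBot ℕ∞) →
      MultiMixed.polyMultiplicity 𝓑 𝓜 n =
        MultiMixed.seriesMultiplicity B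
          (MultiMixed.quotientGrading
            (MultiMixed.torsionSubmodule (MultiMixed.irrelevantIdeal 𝓑) M) 𝓜)
          (fun i => (n i : ℤ))) := by
  classical
  obtain ⟨L, hL, hdim⟩ := h𝓜.hasFractionSum h𝓑
  obtain ⟨Q, hQ, hQ1⟩ := h𝓜.exists_isHilbertDecomposition hL hdim
  obtain ⟨e, he, hdeg, hzero, heq⟩ := h𝓜.exists_isHilbertPolynomial h𝓑
  have hd := h𝓜.supportDim_quotient_torsionSubmodule h𝓑
  refine ⟨fun ν => by rw [hL]; exact ENat.natCast_ne_top _, ⟨Q, hQ, fun n hn => ?_, fun hM => ?_,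
    fun n hn => (hQ1 n hn).2⟩, fun d Q Q' h n hn => MultiMixed.evalOne_eq_of_fractionSum_eq h hn,
    fun Q hQ n hn => MultiMixed.seriesMultiplicity_eq hQ (MultiMixed.mem_weightIndices.1 hn), hd,
    ⟨e, he, fun e' he' => he'.unique he, hdeg, fun n hn => ?_, fun m hm => ?_⟩, fun n hn => ?_⟩
  · rw [(hQ1 n hn).1]
    exact Int.natCast_nonneg _
  · rcases h𝓜.supportDim_eq hL hdim with ⟨hbot, -⟩ | ⟨d, hd, -, p, hp, hpd⟩
    · exact absurd hbot (Module.supportDim_ne_bot_of_nontrivial B M)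
    · have hmem : p.2 ∈ MultiMixed.weightIndices r (Module.supportDim B M) := by
        rw [MultiMixed.mem_weightIndices, hd, hpd]
      refine ⟨p.2, hmem, ?_⟩
      rw [(hQ1 _ hmem).1]
      exact Nat.cast_pos.2 (Multiset.countP_pos.2 ⟨p, hp, rfl⟩)
  · exact (heq n (MultiMixed.mem_weightIndices.1 hn).ge).1
  · by_contra! hlt
    rw [MvPolynomial.mem_support_iff, MvPolynomial.coeff_sub, MultiMixed.coeff_sum_monomial,
      MultiMixed.coeff_binomialSum] at hm
    · refine hm ?_
      split_ifs with hmem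
      · rw [(heq m hlt).2, sub_self]
      · rw [MultiMixed.mem_weightIndices] at hmem
        rw [hzero m (lt_of_le_of_ne hlt (Ne.symm hmem)), Int.cast_zero, zero_div, sub_zero]
    · intro n hn
      have hle : ((∑ i, n i : ℕ) : WithBot ℕ∞) ≤ MultiMixed.relevantDim 𝓑 M :=
        not_lt.1 fun h => hn (hzero n h)
      exact_mod_cast hle.trans hlt
  · rcases eq_or_ne ((∑ i, n i : ℕ) : WithBot ℕ∞) (MultiMixed.relevantDim 𝓑 M) with hn' | hn'
    · rw [MultiMixed.polyMultiplicity_eq he hn', (heq n hn).2]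
    · rw [MultiMixed.polyMultiplicity_of_ne hn', ← (heq n hn).2,
        hzero n (lt_of_le_of_ne hn (Ne.symm hn'))]
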